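/- Notation. Let $r\in\mathbb N$ ($r\ge 1$). For a finitely supported sequence $c:\mathbb Z\to\mathbb C^{s\times t}$ put $\widehat c(\xi)=\sum_{k}c(k)e^{-ik\xi}$. For smooth functions near $0$, $f(\xi)=g(\xi)+O(|\xi|^{n})$ as $\xi\to0$ means $f^{(j)}(0)=g^{(j)}(0)$ for all $0\le j<n$ (entrywise for vectors). A mask is a finitely supported $a:\mathbb Z\to\mathbb C^{r\times r}$; its subdivision operator is $(S_a v)(j)=2\sum_{k\in\mathbb Z}v(k)a(j-2k)$, $j\in\mathbb Z$, for $v:\mathbb Z\to\mathbb C^{s\times r}$. Further, $[x*u](j)=\sum_k x(j-k)u(k)$, $\boldsymbol\delta$ is the Dirac sequence, $e_\ell$ is the $\ell$-th unit column vector, and $\widehat f(\xi)=\int_{\mathbb R} f(x)e^{-ix\xi}\,dx$, extended to tempered distributions by duality. A finitely supported $v:\mathbb Z\to\mathbb C^{1\times r}$ is an order $n$ matching filter of $a$ if $\widehat v(0)\ne0$ and $\widehat v(2\xi)\widehat a(\xi)=\widehat v(\xi)+O(|\xi|^{n})$ as $\xi\to0$; the mask $a$ has order $n$ sum rules with $v$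 if, in addition, $\widehat v(2\xi)\widehat a(\xi+\pi)=O(|\xi|^{n})$. Let $\operatorname{sr}(a)$ be the largest $n\ge0$ such that $a$ has order $n$ sum rules with some filter $v$. Define $\operatorname{sm}_\infty(a)=-\log_2\rho_{\operatorname{sr}(a)}(a,w)$, where $w$ is any filter with which $a$ has order $\operatorname{sr}(a)$ sum rules (the theorem holds for every such choice of $w$), and $$\rho_j(a,w)=\sup\Big\{\limsup_{n\to\infty}\big\|(S_a^n(\boldsymbol\delta I_r))*u\big\|_{\ell_\infty}^{1/n}\;:\;u:\mathbb Z\to\mathbb C^{r}\text{ finitely supported},\ \widehat w(\xi)\widehat u(\xi)=O(|\xi|^{j})\ \text{as }\xi\to 0\Big\}.$$ For a distribution $f$ on $\mathbb R$, $\operatorname{sm}_\infty(f)$ is the supremum of all $k+\tau$ with $k\in\mathbb N\cup\{0\}$, $0\le\tau<1$ such that $f$ is a function in the Sobolev space $W^{k}_\infty(\mathbb R)$ with $\|f^{(k)}-f^{(k)}(\cdot-t)\|_{L_\infty(\mathbb R)}\le C|t|^\tau$ for all $t\in\mathbb R$ and some constant $C$ ($-\infty$ if there is no such pair); for a vector $\phi=(\phi_1,\dots,\phi_r)^{\mathsf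 T}$, $\operatorname{sm}_\infty(\phi)=\min_\ell\operatorname{sm}_\infty(\phi_\ell)$. Let $m\in\mathbb N\cup\{0\}$ and let $\mathcal I=\{\nu_1,\dots,\nu_r\}\subseteq\{0,\dots,m\}$ be an ordered multiset with $\nu_1=0$; put $m_{\mathcal I}=\max(\nu_1,\dots,\nu_r)$. The generalized Hermite subdivision scheme of type $\mathcal I$ with mask $a$ is convergent with limiting functions in $C^m(\mathbb R)$ if for every $w_0:\mathbb Z\to\mathbb C^{1\times r}$ there is $\eta\in C^m(\mathbb R)$ such that for every $K>0$ and every $\ell=1,\dots,r$, $$\lim_{n\to\infty}\ \sup_{k\in\mathbb Z\cap[-2^nK,2^nK]}\big|(S_a^nw_0)(k)\,2^{\nu_\ell n}e_\ell-\eta^{(\nu_\ell)}(2^{-n}k)\big|=0 .$$ Theorem. Let $m$ and $\mathcal I$ be as above. Let $a:\mathbb Z\to\mathbb C^{r\times r}$ be finitely supported such that $1$ is a simple eigenvalue of $\widehat a(0)$ and no $2^k$, $k\in\mathbb N$, $k\ge1$, is an eigenvalue of $\widehat a(0)$. Let $v_a:\mathbb Z\to\mathbb C^{1\times r}$ be an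 order $m_{\mathcal I}+1$ matching filter of $a$ such that the first nonzero entry of $\widehat{v_a}(0)$ is $1$. Let $\phi$ be a vector of compactly supported distributions on $\mathbb R$ with $\widehat\phi(2\xi)=\widehat a(\xi)\widehat\phi(\xi)$ for all $\xi\in\mathbb R$ and $\widehat{v_a}(0)\widehat\phi(0)=1$. Consider the condition $$\widehat{v_a}(\xi)=\big[(i\xi)^{\nu_1}+O(|\xi|^{\nu_1+1}),\ (i\xi)^{\nu_2}+O(|\xi|^{\nu_2+1}),\ \dots,\ (i\xi)^{\nu_r}+O(|\xi|^{\nu_r+1})\big],\qquad \xi\to0. \tag{$*$}$$ (1) If the generalized Hermite subdivision scheme of type $\mathcal I$ with mask $a$ is convergent with limiting functions in $C^m(\mathbb R)$, then $\operatorname{sm}_\infty(a)>0$, $\operatorname{sm}_\infty(\phi)>m$ and $(*)$ holds. (2) If $\operatorname{sm}_\infty(a)>m_{\mathcal I}$, $\operatorname{sm}_\infty(\phi)>m$ and $(*)$ holds, then the generalized Hermite subdivision scheme of type $\mathcal I$ with mask $a$ is convergent with limiting functions in $C^m(\mathbb R)$. -/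

import Mathlib

open Filter Topology MeasureTheory
open scoped ENNReal FourierTransform SchwartzMap ContDiff

noncomputable section

namespace VectorSubdivision

/-- Finitely supported sequences `ℤ → ℂ^{σ × τ}` of matrices. -/
abbrev FinSeq (σ τ : Type) : Type := ℤ →₀ Matrix σ τ ℂ

/-- The symbol `∑ k, c k * exp (-i k ξ)` of a finitely supported sequence of matrices. -/
def symbol {σ τ : Type} (c : FinSeq σ τ) (ξ : ℝ) : Matrix σ τ ℂ :=
  c.sum fun k A => Complex.exp (-(Complex.I * (k : ℂ) * (ξ : ℂ))) • A

/-- `f ξ = g ξ + O(|ξ| ^ n)` as `ξ → 0`, understood for smooth functions as the equality at `0` of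
all derivatives of order less than `n`. -/
def EqUpToOrder (n : ℕ) (f g : ℝ → ℂ) : Prop :=
  ∀ j < n, iteratedDeriv j f 0 = iteratedDeriv j g 0

variable {r : ℕ}

/-- The subdivision operator `(S_a v)(j) = 2 ∑ k, v k * a (j - 2 k)` (a finite sum for each `j`). -/
def subdivision {σ : Type} (a : FinSeq (Fin r) (Fin r)) (v : ℤ → Matrix σ (Fin r) ℂ) :
    ℤ → Matrix σ (Fin r) ℂ :=
  fun j => (2 : ℂ) • ∑ᶠ k : ℤ, v k * a (j - 2 * k)

/-- The convolution `(x * u)(j) = ∑ k, x (j - k) * u k` with a finitely supported `u`. -/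
def convolution {σ τ : Type} (x : ℤ → Matrix σ (Fin r) ℂ) (u : FinSeq (Fin r) τ) :
    ℤ → Matrix σ τ ℂ :=
  fun j => u.sum fun k A => x (j - k) * A

/-- The sequence `δ I_r`. -/
def diracId (r : ℕ) : ℤ → Matrix (Fin r) (Fin r) ℂ :=
  fun k => if k = 0 then 1 else 0

/-- The `ℓ_∞` norm of a sequence of matrices (largest modulus of an entry), possibly infinite. -/
def supNorm {σ τ : Type} (x : ℤ → Matrix σ τ ℂ) : ℝ≥0∞ :=
  ⨆ (k : ℤ) (i : σ) (j : τ), ‖x k i j‖ₑ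

/-- `1` is a simple eigenvalue of `â(0)`, and none of `2, 4, 8, …` is an eigenvalue of `â(0)`. -/
def SpectralCondition (a : FinSeq (Fin r) (Fin r)) : Prop :=
  (symbol a 0).charpoly.rootMultiplicity 1 = 1 ∧
    ∀ k : ℕ, 1 ≤ k → ¬ Module.End.HasEigenvalue (Matrix.toLin' (symbol a 0)) ((2 : ℂ) ^ k)

/-- `v` is an order `n` matching filter of `a`: `v̂(0) ≠ 0` and
`v̂(2ξ) â(ξ) = v̂(ξ) + O(|ξ| ^ n)` as `ξ → 0`. -/
def IsMatchingFilter (a : FinSeq (Fin r) (Fin r)) (n : ℕ) (v : FinSeq (Fin 1) (Fin r)) : Prop :=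
  symbol v 0 ≠ 0 ∧
    ∀ l : Fin r, EqUpToOrder n (fun ξ => (symbol v (2 * ξ) * symbol a ξ) 0 l)
      (fun ξ => symbol v ξ 0 l)

/-- `a` has order `n` sum rules with the matching filter `v`: in addition,
`v̂(2ξ) â(ξ + π) = O(|ξ| ^ n)` as `ξ → 0`. -/
def HasSumRules (a : FinSeq (Fin r) (Fin r)) (n : ℕ) (v : FinSeq (Fin 1) (Fin r)) : Prop :=
  IsMatchingFilter a n v ∧
    ∀ l : Fin r, EqUpToOrder n (fun ξ => (symbol v (2 * ξ) * symbol a (ξ + Real.pi)) 0 l)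
      (fun _ => 0)

/-- `sr(a)`, the largest order of sum rules of `a`. -/
def sr (a : FinSeq (Fin r) (Fin r)) : ℕ :=
  sSup {n : ℕ | ∃ v : FinSeq (Fin 1) (Fin r), HasSumRules a n v}

/-- The space `𝒱_{j-1,v}` of all finitely supported `u : ℤ → ℂ^r` with
`v̂(ξ) û(ξ) = O(|ξ| ^ j)` as `ξ → 0`. -/
def vanishingSpace (j : ℕ) (v : FinSeq (Fin 1) (Fin r)) : Set (FinSeq (Fin r) (Fin 1)) :=
  {u | EqUpToOrder j (fun ξ => (symbol v ξ * symbol u ξ) 0 0) (fun _ => 0)}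

/-- `ρ_j(a, v)_∞`, the supremum over `u ∈ 𝒱_{j-1,v}` of
`limsup_n ‖(S_a^n (δ I_r)) * u‖_∞ ^ (1 / n)`. -/
def rho (a : FinSeq (Fin r) (Fin r)) (j : ℕ) (v : FinSeq (Fin 1) (Fin r)) : ℝ≥0∞ :=
  ⨆ u ∈ vanishingSpace j v,
    limsup (fun n : ℕ =>
      supNorm (convolution ((subdivision a)^[n] (diracId r)) u) ^ (1 / (n : ℝ))) atTop

/-- `sm_∞(a) = - log₂ ρ_{sr(a)}(a, v)_∞`, computed with a filter `v` with which `a` has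
order `sr(a)` sum rules. -/
def smMask (a : FinSeq (Fin r) (Fin r)) (v : FinSeq (Fin 1) (Fin r)) : EReal :=
  -(ENNReal.log (rho a (sr a) v) / ((Real.log 2 : ℝ) : EReal))

/-- `f` is in the Sobolev space `W^k_∞(ℝ)`: `f, …, f^{(k-1)}` are (locally) absolutely continuous,
and `f, …, f^{(k)}` are essentially bounded. -/
def MemSobolevInf (k : ℕ) (f : ℝ → ℂ) : Prop :=
  (∀ j < k, ∀ x y : ℝ, AbsolutelyContinuousOnInterval (iteratedDeriv j f) x y) ∧
    ∀ j ≤ k, MemLp (iteratedDeriv j f) ∞ volume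

/-- `g ∈ Lip(τ, L_∞)`. -/
def MemLipInf (τ : ℝ) (g : ℝ → ℂ) : Prop :=
  ∃ C : ℝ, 0 < C ∧ ∀ t : ℝ,
    eLpNorm (fun x => g x - g (x - t)) ∞ volume ≤ ENNReal.ofReal (C * |t| ^ τ)

/-- `sm_∞(T)`: the supremum of all `k + τ` with `k ∈ ℕ`, `0 ≤ τ < 1` such that `T` is (given by) a
function `f ∈ W^k_∞(ℝ)` with `f^{(k)} ∈ Lip(τ, L_∞)`. It is `-∞` if `T` is not given by an
essentially bounded function. -/
def smDistribution (T : 𝓢'(ℝ, ℂ)) : EReal :=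
  sSup {s : EReal | ∃ (k : ℕ) (τ : ℝ) (f : ℝ → ℂ), 0 ≤ τ ∧ τ < 1 ∧
    MemSobolevInf k f ∧ MemLipInf τ (iteratedDeriv k f) ∧
    (∀ g : 𝓢(ℝ, ℂ), T g = ∫ x, g x * f x) ∧ s = (((k : ℝ) + τ : ℝ) : EReal)}

/-- `sm_∞` of a vector of distributions: the smallest `sm_∞` of its entries. -/
def smVector (φ : Fin r → 𝓢'(ℝ, ℂ)) : EReal :=
  ⨅ l, smDistribution (φ l)

/-- The function `F` is the Fourier transform of the tempered distribution `T`, in the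
normalization `T̂(ξ) = ∫ T(x) exp (-i x ξ) dx`. Mathlib's `𝓕` has the kernel `exp (-2 π i x ξ)`,
whence the dilation. By the Paley-Wiener-Schwartz theorem, each compactly supported `T` has exactly
one such `F`, and it is smooth with all derivatives of at most polynomial growth. -/
def IsFourierTransform (T : 𝓢'(ℝ, ℂ)) (F : ℝ → ℂ) : Prop :=
  ∃ h : Function.HasTemperateGrowth (fun x : ℝ => F (2 * Real.pi * x)),
    𝓕 T = Function.HasTemperateGrowth.toTemperedDistribution volume h

/-- The generalized Hermite subdivision scheme of type `{ν_1, …, ν_r}` with mask `a` is convergent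
with limiting functions in `C^m(ℝ)`. -/
def HermiteConvergent (m : ℕ) (ν : Fin r → ℕ) (a : FinSeq (Fin r) (Fin r)) : Prop :=
  ∀ w₀ : ℤ → Matrix (Fin 1) (Fin r) ℂ, ∃ η : ℝ → ℂ, ContDiff ℝ m η ∧
    ∀ K : ℝ, 0 < K → ∀ l : Fin r,
      Tendsto (fun n : ℕ => ⨆ (k : ℤ) (_ : |(k : ℝ)| ≤ 2 ^ n * K),
        ‖((subdivision a)^[n] w₀) k 0 l * (2 : ℂ) ^ (ν l * n) -
          iteratedDeriv (ν l) η ((k : ℝ) / 2 ^ n)‖ₑ) atTop (𝓝 0)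

/-- `v̂(ξ) = [(iξ)^{ν_1} + O(|ξ|^{ν_1+1}), …, (iξ)^{ν_r} + O(|ξ|^{ν_r+1})]` as `ξ → 0`. -/
def HermiteFilterCondition (ν : Fin r → ℕ) (v : FinSeq (Fin 1) (Fin r)) : Prop :=
  ∀ l : Fin r, EqUpToOrder (ν l + 1) (fun ξ => symbol v ξ 0 l)
    (fun ξ => (Complex.I * (ξ : ℂ)) ^ ν l)

end VectorSubdivision

end

/-! Everything is read off from the iterated masks A_n = S_a^n(δ I_r), because S_a^n w₀ is a locally
finite combination of shifts of A_n. Two mechanisms carry the proof.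

Duality (`fconv_fsub`): (A_{n+1} * u)(γ + 2k) = (A_n * T_γ u)(k), where the transition operators
T_0, T_1 shrink supports to a fixed interval and leave the sequences supported there invariant. On
such a finite-dimensional space, decay of l^n A_n * u without any rate improves to exponential decay
with a constant controlled by the sup norm of u (`exists_decay_rate_of_supportedIn`).

Moments: the matching condition iterates to v̂(2^n ξ) Â_n(ξ) = 2^n v̂(ξ) + O(|ξ|^N). If 2^{νn} A_n *
u approaches the dyadic samples of η_j^{(ν)}, then Riemann sums against monomials and integration by
parts give v̂ û = c (iξ)^ν + O(|ξ|^{ν+1}) with c = ∑_j v̂_j(0) ∫ η_j, independent of u and ν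
(`IsMatchingFilter.coeff_of_sampleLimit`).

Necessity. Unit initial data produce limit functions η_j for the rows of A_n. The moment argument
applied to the columns of A_n gives (*), the normalization of v fixing c = 1. Columns with ν_l > 0
vanish in the limit, so iterating the refinement equation identifies φ with η. Every u annihilated
at ξ = 0 by the limiting row decays; this yields a first-order sum rule, and the exponential rate
yields sm_∞(a) > 0. The same rate, applied to differences of sample sequences of η^{(m)}, gives
Hölder continuity of η^{(m)}, hence sm_∞(φ) > m.

Sufficiency. Here φ is a compactly supported C^m refinable vector f. If u_l is the sequence of
integer samples of f^{(ν_l)}, refinement says that 2^{ν_l n} A_n * u_l equals the dyadic samples of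
f^{(ν_l)} exactly. By the moment argument and (*), v̂ does not distinguish δ e_l from u_l up to
order ν_l. So their difference has vanishing order ν_l + 1 against v, and sm_∞(a) > m_I makes it
decay faster than 2^{-ν_l n} (`HasSumRules.decays_of_lt_smMask`). -/

noncomputable section

namespace VectorSubdivision

variable {r : ℕ} {σ τ κ : Type}

/-! ### Symbols of finitely supported sequences -/

/-- The character `ξ ↦ exp (-i k ξ)`. -/
def expChar (k : ℤ) (ξ : ℝ) : ℂ := Complex.exp (-(Complex.I * (k : ℂ) * (ξ : ℂ)))

lemma expChar_add (k l : ℤ) (ξ : ℝ) : expChar (k + l) ξ = expChar k ξ * expChar l ξ := by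
  simp only [expChar, ← Complex.exp_add]; congr 1; push_cast; ring

@[simp] lemma expChar_zero_left (ξ : ℝ) : expChar 0 ξ = 1 := by simp [expChar]

@[simp] lemma expChar_zero_right (k : ℤ) : expChar k 0 = 1 := by simp [expChar]

lemma expChar_add_right (k : ℤ) (ξ ζ : ℝ) : expChar k (ξ + ζ) = expChar k ξ * expChar k ζ := by
  simp only [expChar, ← Complex.exp_add]; congr 1; push_cast; ring

lemma expChar_two_mul (k : ℤ) (ξ : ℝ) : expChar k (2 * ξ) = expChar (2 * k) ξ := by
  simp only [expChar]; congr 1; push_cast; ring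

lemma expChar_int_mul_pi (k : ℤ) : expChar k Real.pi = (-1) ^ k := by
  have h : (-(Complex.I * (k : ℂ) * (Real.pi : ℂ))) = ((-k : ℤ) : ℂ) * (Real.pi * Complex.I) := by
    push_cast; ring
  rw [expChar, h, Complex.exp_int_mul, Complex.exp_pi_mul_I, zpow_neg, ← inv_zpow]
  norm_num

lemma symbol_eq_sum (c : FinSeq σ τ) (ξ : ℝ) :
    symbol c ξ = c.sum fun k A => expChar k ξ • A := rfl

lemma symbol_apply (c : FinSeq σ τ) (ξ : ℝ) (i : σ) (j : τ) :
    symbol c ξ i j = ∑ k ∈ c.support, expChar k ξ * c k i j := by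
  rw [symbol_eq_sum, Finsupp.sum, Matrix.sum_apply]; rfl

@[simp] lemma symbol_add (c d : FinSeq σ τ) (ξ : ℝ) :
    symbol (c + d) ξ = symbol c ξ + symbol d ξ := by
  classical
  rw [symbol_eq_sum, symbol_eq_sum, symbol_eq_sum, Finsupp.sum_add_index']
  · simp
  · intros; rw [smul_add]

@[simp] lemma symbol_single (k : ℤ) (A : Matrix σ τ ℂ) (ξ : ℝ) :
    symbol (Finsupp.single k A : FinSeq σ τ) ξ = expChar k ξ • A := by
  rw [symbol_eq_sum, Finsupp.sum_single_index]; simp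

/-- The symbol as a linear map. -/
def symbolₗ (ξ : ℝ) : FinSeq σ τ →ₗ[ℂ] Matrix σ τ ℂ where
  toFun c := symbol c ξ
  map_add' c d := symbol_add c d ξ
  map_smul' z c := by
    rw [symbol_eq_sum, symbol_eq_sum, Finsupp.sum_smul_index' (by simp)]
    simp only [RingHom.id_apply, Finsupp.smul_sum]
    exact Finset.sum_congr rfl fun k _ => smul_comm _ _ _

lemma symbol_smul (z : ℂ) (c : FinSeq σ τ) (ξ : ℝ) : symbol (z • c) ξ = z • symbol c ξ :=
  (symbolₗ ξ).map_smul z c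

lemma symbol_sub (c d : FinSeq σ τ) (ξ : ℝ) : symbol (c - d) ξ = symbol c ξ - symbol d ξ :=
  (symbolₗ ξ).map_sub c d

lemma symbol_sum {ι : Type*} (s : Finset ι) (c : ι → FinSeq σ τ) (ξ : ℝ) :
    symbol (∑ i ∈ s, c i) ξ = ∑ i ∈ s, symbol (c i) ξ :=
  map_sum (symbolₗ ξ) c s

/-! ### Convolution of finitely supported sequences -/

section Convolution

variable [Fintype κ]

/-- Convolution of finitely supported sequences of matrices. -/
def fconv (x : FinSeq σ κ) (u : FinSeq κ τ) : FinSeq σ τ :=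
  u.sum fun k A => x.sum fun i B => Finsupp.single (i + k) (B * A)

lemma fconv_apply (x : FinSeq σ κ) (u : FinSeq κ τ) (j : ℤ) :
    fconv x u j = ∑ k ∈ u.support, x (j - k) * u k := by
  classical
  simp only [fconv, Finsupp.sum, Finsupp.finsetSum_apply, Finsupp.single_apply]
  refine Finset.sum_congr rfl fun k _ => ?_
  rw [Finset.sum_eq_single (j - k)]
  · simp
  · intro b _ hb
    rw [if_neg]; omega
  · intro h
    simp [Finsupp.notMem_support_iff.mp h]

lemma fconv_apply_of_subset (x : FinSeq σ κ) (u : FinSeq κ τ) (j : ℤ) (s : Finset ℤ)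
    (hs : u.support ⊆ s) : fconv x u j = ∑ k ∈ s, x (j - k) * u k := by
  rw [fconv_apply]
  refine Finset.sum_subset hs fun k _ hk => ?_
  rw [Finsupp.notMem_support_iff.mp hk, Matrix.mul_zero]

lemma fconv_apply_left (x : FinSeq σ κ) (u : FinSeq κ τ) (j : ℤ) :
    fconv x u j = ∑ i ∈ x.support, x i * u (j - i) := by
  classical
  simp only [fconv, Finsupp.sum, Finsupp.finsetSum_apply, Finsupp.single_apply]
  rw [Finset.sum_comm]
  refine Finset.sum_congr rfl fun i _ => ?_
  rw [Finset.sum_eq_single (j - i)]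
  · simp
  · intro b _ hb
    rw [if_neg]; omega
  · intro h
    simp [Finsupp.notMem_support_iff.mp h]

lemma symbol_fconv (x : FinSeq σ κ) (u : FinSeq κ τ) (ξ : ℝ) :
    symbol (fconv x u) ξ = symbol x ξ * symbol u ξ := by
  simp only [fconv, Finsupp.sum, symbol_sum, symbol_single]
  rw [symbol_eq_sum x, symbol_eq_sum u, Finsupp.sum, Finsupp.sum, Matrix.sum_mul,
    Finset.sum_comm]
  simp only [Matrix.mul_sum]
  refine Finset.sum_congr rfl fun i _ => Finset.sum_congr rfl fun k _ => ?_
  rw [expChar_add, Matrix.smul_mul, Matrix.mul_smul, smul_smul]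

lemma fconv_add (x : FinSeq σ κ) (u w : FinSeq κ τ) :
    fconv x (u + w) = fconv x u + fconv x w := by
  ext j : 1
  simp only [Finsupp.add_apply, fconv_apply_left, Matrix.mul_add, Finset.sum_add_distrib]

lemma fconv_smul (x : FinSeq σ κ) (z : ℂ) (u : FinSeq κ τ) :
    fconv x (z • u) = z • fconv x u := by
  ext j : 1
  simp only [Finsupp.smul_apply, fconv_apply_left, Matrix.mul_smul, Finset.smul_sum]

/-- Convolution from the left as a linear map. -/
def fconvₗ (x : FinSeq σ κ) : FinSeq κ τ →ₗ[ℂ] FinSeq σ τ where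
  toFun := fconv x
  map_add' := fconv_add x
  map_smul' z u := fconv_smul x z u

lemma fconv_sub (x : FinSeq σ κ) (u w : FinSeq κ τ) :
    fconv x (u - w) = fconv x u - fconv x w := (fconvₗ x).map_sub u w

lemma fconv_sum {ι : Type*} (x : FinSeq σ κ) (s : Finset ι) (u : ι → FinSeq κ τ) :
    fconv x (∑ i ∈ s, u i) = ∑ i ∈ s, fconv x (u i) := map_sum (fconvₗ x) u s

end Convolution

lemma coe_fconv (x : FinSeq σ (Fin r)) (u : FinSeq (Fin r) τ) :
    ⇑(fconv x u) = convolution x u := by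
  ext j : 1
  rw [fconv_apply]; rfl

/-! ### The subdivision operator on finitely supported sequences -/

/-- The subdivision operator on finitely supported sequences. -/
def fsub (a : FinSeq (Fin r) (Fin r)) (x : FinSeq σ (Fin r)) : FinSeq σ (Fin r) :=
  x.sum fun k B => a.sum fun i A => Finsupp.single (2 * k + i) ((2 : ℂ) • (B * A))

lemma fsub_apply (a : FinSeq (Fin r) (Fin r)) (x : FinSeq σ (Fin r)) (j : ℤ) :
    fsub a x j = (2 : ℂ) • ∑ k ∈ x.support, x k * a (j - 2 * k) := by
  classical
  simp only [fsub, Finsupp.sum, Finsupp.finsetSum_apply, Finsupp.single_apply, Finset.smul_sum]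
  refine Finset.sum_congr rfl fun k _ => ?_
  rw [Finset.sum_eq_single (j - 2 * k)]
  · simp
  · intro b _ hb
    rw [if_neg]; omega
  · intro h
    simp [Finsupp.notMem_support_iff.mp h]

lemma coe_fsub (a : FinSeq (Fin r) (Fin r)) (x : FinSeq σ (Fin r)) :
    ⇑(fsub a x) = subdivision a x := by
  ext j : 1
  rw [fsub_apply, subdivision, finsum_eq_sum_of_support_subset]
  intro k hk
  simp only [Finset.mem_coe, Finsupp.mem_support_iff]
  rintro h
  simp [h] at hk

lemma symbol_fsub (a : FinSeq (Fin r) (Fin r)) (x : FinSeq σ (Fin r)) (ξ : ℝ) :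
    symbol (fsub a x) ξ = (2 : ℂ) • (symbol x (2 * ξ) * symbol a ξ) := by
  simp only [fsub, Finsupp.sum, symbol_sum, symbol_single]
  rw [symbol_eq_sum x, symbol_eq_sum a, Finsupp.sum, Finsupp.sum, Matrix.sum_mul,
    Finset.smul_sum]
  refine Finset.sum_congr rfl fun i _ => ?_
  rw [Matrix.mul_sum, Finset.smul_sum]
  refine Finset.sum_congr rfl fun k _ => ?_
  rw [expChar_add, Matrix.smul_mul, Matrix.mul_smul, smul_smul, smul_smul, expChar_two_mul,
    smul_smul]
  congr 1; ring

/-- The iterated masks `S_a^n (δ I_r)` as finitely supported sequences. -/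
def iterMask (a : FinSeq (Fin r) (Fin r)) : ℕ → FinSeq (Fin r) (Fin r)
  | 0 => Finsupp.single 0 1
  | n + 1 => fsub a (iterMask a n)

lemma coe_iterMask (a : FinSeq (Fin r) (Fin r)) (n : ℕ) :
    ⇑(iterMask a n) = (subdivision a)^[n] (diracId r) := by
  induction n with
  | zero =>
    ext k : 1
    simp [iterMask, diracId, Finsupp.single_apply, eq_comm]
  | succ n ih => rw [Function.iterate_succ_apply', ← ih, iterMask, coe_fsub]

/-! ### Transition operators, dual to subdivision -/

lemma injective_add_two_mul (γ : ℤ) : Function.Injective fun q : ℤ => γ + 2 * q :=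
  fun p q h => by simpa using h

/-- The sequence `k ↦ 2 (a * u)(γ + 2 k)`, where `*` is the convolution. -/
def transition (a : FinSeq (Fin r) (Fin r)) (γ : ℤ) (u : FinSeq (Fin r) τ) : FinSeq (Fin r) τ :=
  (2 : ℂ) • (fconv a u).comapDomain (fun q : ℤ => γ + 2 * q) (injective_add_two_mul γ).injOn

lemma transition_apply (a : FinSeq (Fin r) (Fin r)) (γ : ℤ) (u : FinSeq (Fin r) τ) (k : ℤ) :
    transition a γ u k = (2 : ℂ) • fconv a u (γ + 2 * k) := by
  rw [transition, Finsupp.smul_apply, Finsupp.comapDomain_apply]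

/-- `transition` as a linear map. -/
def transitionₗ (a : FinSeq (Fin r) (Fin r)) (γ : ℤ) :
    FinSeq (Fin r) τ →ₗ[ℂ] FinSeq (Fin r) τ where
  toFun := transition a γ
  map_add' u w := by
    ext k : 1
    simp [transition_apply, fconv_add]
  map_smul' z u := by
    ext k : 1
    simp only [transition_apply, fconv_smul, RingHom.id_apply, Finsupp.smul_apply]
    rw [smul_comm]

/-- A subdivision step on the left factor is traded for a transition on the right factor once the
parity of the index is fixed. Iterating it reads off the binary digits of the index, so A_n * u is
governed by products of T_0 and T_1 applied to u. -/
lemma fconv_fsub (a : FinSeq (Fin r) (Fin r)) (x : FinSeq σ (Fin r)) (u : FinSeq (Fin r) τ)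
    (γ k : ℤ) : fconv (fsub a x) u (γ + 2 * k) = fconv x (transition a γ u) k := by
  rw [fconv_apply, fconv_apply_left]
  simp only [transition_apply, fsub_apply, fconv_apply, Matrix.smul_mul, Matrix.mul_smul,
    ← Finset.smul_sum, Matrix.sum_mul, Matrix.mul_sum]
  rw [Finset.sum_comm]
  congr 1
  refine Finset.sum_congr rfl fun i _ => Finset.sum_congr rfl fun p _ => ?_
  rw [Matrix.mul_assoc, show γ + 2 * k - p - 2 * i = γ + 2 * (k - i) - p by ring]

lemma fconv_iterMask_succ (a : FinSeq (Fin r) (Fin r)) (n : ℕ) (u : FinSeq (Fin r) τ)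
    (γ k : ℤ) : fconv (iterMask a (n + 1)) u (γ + 2 * k) =
      fconv (iterMask a n) (transition a γ u) k :=
  fconv_fsub a (iterMask a n) u γ k

lemma fconv_iterMask_zero (a : FinSeq (Fin r) (Fin r)) (u : FinSeq (Fin r) τ) :
    fconv (iterMask a 0) u = u := by
  ext k : 1
  rw [iterMask, fconv_apply_left]
  rw [Finset.sum_subset Finsupp.support_single_subset fun i _ hi => by
    rw [Finsupp.notMem_support_iff.mp hi, Matrix.zero_mul]]
  simp

/-- Combining the values at ξ and ξ + π with the sign (-1)^γ cancels the indices of the wrong parity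
and doubles the others. -/
lemma symbol_two_smul_comapDomain (c : FinSeq σ τ) (γ : ℤ) (ξ : ℝ) :
    (2 : ℂ) • symbol (c.comapDomain (fun q : ℤ => γ + 2 * q) (injective_add_two_mul γ).injOn)
        (2 * ξ) =
      expChar (-γ) ξ • (symbol c ξ + ((-1 : ℂ) ^ γ) • symbol c (ξ + Real.pi)) := by
  classical
  rw [symbol_eq_sum, symbol_eq_sum, symbol_eq_sum, Finsupp.sum, Finsupp.sum, Finsupp.sum,
    Finset.smul_sum, Finset.smul_sum, ← Finset.sum_add_distrib, Finset.smul_sum]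
  have hsub : ∑ k ∈ c.support, expChar (-γ) ξ • (expChar k ξ • c k +
        (-1 : ℂ) ^ γ • expChar k (ξ + Real.pi) • c k) =
      ∑ k ∈ c.support, if Even (k + γ) then (2 : ℂ) • (expChar (k - γ) ξ • c k) else 0 := by
    refine Finset.sum_congr rfl fun k _ => ?_
    rw [expChar_add_right, expChar_int_mul_pi, sub_eq_neg_add, expChar_add]
    split_ifs with h
    · have : (-1 : ℂ) ^ γ * (-1 : ℂ) ^ k = 1 := by
        rw [← zpow_add₀ (by norm_num), add_comm]; exact h.neg_one_zpow
      simp only [smul_smul, ← add_smul]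
      congr 1
      linear_combination (expChar (-γ) ξ * expChar k ξ) * this
    · have : (-1 : ℂ) ^ γ * (-1 : ℂ) ^ k = -1 := by
        rw [← zpow_add₀ (by norm_num), add_comm]
        exact (Int.not_even_iff_odd.mp h).neg_one_zpow
      simp only [smul_smul, ← add_smul]
      have h0 : expChar (-γ) ξ * (expChar k ξ + (-1 : ℂ) ^ γ * (expChar k ξ * (-1) ^ k)) = 0 := by
        linear_combination (expChar (-γ) ξ * expChar k ξ) * this
      rw [h0, zero_smul]
  rw [hsub, ← Finset.sum_filter]
  refine Finset.sum_bij' (fun q _ => γ + 2 * q) (fun k _ => (k - γ) / 2) ?_ ?_ ?_ ?_ ?_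
  · intro q hq
    simp only [Finsupp.comapDomain_support, Finset.mem_preimage] at hq
    simp only [Finset.mem_filter, hq, true_and]
    exact ⟨γ + q, by ring⟩
  · intro k hk
    simp only [Finset.mem_filter] at hk
    obtain ⟨h1, s, hs⟩ := hk
    simp only [Finsupp.comapDomain_support, Finset.mem_preimage]
    convert h1 using 1
    omega
  · intro q _
    simp
  · intro k hk
    simp only [Finset.mem_filter] at hk
    obtain ⟨h1, s, hs⟩ := hk
    omega
  · intro q _
    rw [Finsupp.comapDomain_apply, expChar_two_mul]
    congr 3
    ring

lemma symbol_transition (a : FinSeq (Fin r) (Fin r)) (γ : ℤ) (u : FinSeq (Fin r) τ) (ξ : ℝ) :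
    symbol (transition a γ u) (2 * ξ) = expChar (-γ) ξ • (symbol a ξ * symbol u ξ +
      ((-1 : ℂ) ^ γ) • (symbol a (ξ + Real.pi) * symbol u (ξ + Real.pi))) := by
  rw [transition, symbol_smul, symbol_two_smul_comapDomain, symbol_fconv, symbol_fconv]

open PowerSeries

/-! ### Taylor series at the origin -/

/-- The Taylor series of `f` at `0`. -/
def taylor (f : ℝ → ℂ) : PowerSeries ℂ :=
  PowerSeries.mk fun j => iteratedDeriv j f 0 / (j.factorial : ℂ)

lemma coeff_taylor (f : ℝ → ℂ) (j : ℕ) :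
    coeff j (taylor f) = iteratedDeriv j f 0 / (j.factorial : ℂ) := by
  rw [taylor, coeff_mk]

lemma constantCoeff_taylor (f : ℝ → ℂ) : constantCoeff (taylor f) = f 0 := by
  rw [← coeff_zero_eq_constantCoeff_apply, coeff_taylor]; simp

/-- Moves all O(|ξ|^n) conditions into the power series ring, where products of symbols are
products, dilations are `rescale`, and vanishing to order n is divisibility by X^n. -/
lemma eqUpToOrder_iff_dvd {n : ℕ} {f g : ℝ → ℂ} :
    EqUpToOrder n f g ↔ (X : PowerSeries ℂ) ^ n ∣ taylor f - taylor g := by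
  rw [X_pow_dvd_iff]
  refine forall₂_congr fun j _ => ?_
  have hj : (j.factorial : ℂ) ≠ 0 := Nat.cast_ne_zero.mpr j.factorial_ne_zero
  rw [map_sub, coeff_taylor, coeff_taylor, sub_eq_zero, div_left_inj' hj]

lemma taylor_zero : taylor (fun _ => 0) = 0 := by
  ext j; simp [coeff_taylor]

lemma taylor_mul {f g : ℝ → ℂ} (hf : ContDiff ℝ ∞ f) (hg : ContDiff ℝ ∞ g) :
    taylor (fun ξ => f ξ * g ξ) = taylor f * taylor g := by
  ext n
  rw [coeff_taylor, iteratedDeriv_fun_mul (hf.of_le (by exact_mod_cast le_top)).contDiffAt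
    (hg.of_le (by exact_mod_cast le_top)).contDiffAt, coeff_mul,
    Finset.Nat.sum_antidiagonal_eq_sum_range_succ_mk, Finset.sum_div]
  refine Finset.sum_congr rfl fun i hi => ?_
  have hi' : i ≤ n := Nat.lt_succ_iff.mp (Finset.mem_range.mp hi)
  rw [coeff_taylor, coeff_taylor, Nat.cast_choose ℂ hi']
  have h1 : (n.factorial : ℂ) ≠ 0 := Nat.cast_ne_zero.mpr n.factorial_ne_zero
  have h2 : (i.factorial : ℂ) ≠ 0 := Nat.cast_ne_zero.mpr i.factorial_ne_zero
  have h3 : ((n - i).factorial : ℂ) ≠ 0 := Nat.cast_ne_zero.mpr (n - i).factorial_ne_zero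
  field_simp

lemma taylor_add {f g : ℝ → ℂ} (hf : ContDiff ℝ ∞ f) (hg : ContDiff ℝ ∞ g) :
    taylor (fun ξ => f ξ + g ξ) = taylor f + taylor g := by
  ext n
  rw [coeff_taylor, iteratedDeriv_fun_add (hf.of_le (by exact_mod_cast le_top)).contDiffAt
    (hg.of_le (by exact_mod_cast le_top)).contDiffAt, map_add, coeff_taylor, coeff_taylor, add_div]

lemma taylor_const_mul (c : ℂ) (f : ℝ → ℂ) : taylor (fun ξ => c * f ξ) = c • taylor f := by
  ext n
  simp [coeff_taylor, mul_div_assoc]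

lemma taylor_sum {ι : Type*} (s : Finset ι) {f : ι → ℝ → ℂ} (hf : ∀ i ∈ s, ContDiff ℝ ∞ (f i)) :
    taylor (fun ξ => ∑ i ∈ s, f i ξ) = ∑ i ∈ s, taylor (f i) := by
  ext n
  rw [coeff_taylor, iteratedDeriv_fun_sum
    fun i hi => ((hf i hi).of_le (by exact_mod_cast le_top)).contDiffAt, map_sum, Finset.sum_div]
  simp only [coeff_taylor]

lemma taylor_comp_mul {f : ℝ → ℂ} (hf : ContDiff ℝ ∞ f) (c : ℝ) :
    taylor (fun ξ => f (c * ξ)) = rescale (c : ℂ) (taylor f) := by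
  ext n
  rw [coeff_taylor, coeff_rescale, coeff_taylor,
    iteratedDeriv_comp_const_smul (hf.of_le (by exact_mod_cast le_top))]
  simp [mul_div_assoc]

/-! ### Taylor series of matrix functions and symbols -/

/-- Entrywise smoothness of a matrix function. -/
def SmoothEntries (F : ℝ → Matrix σ τ ℂ) : Prop := ∀ i j, ContDiff ℝ ∞ fun ξ => F ξ i j

/-- Entrywise Taylor series of a matrix function. -/
def taylorMatrix (F : ℝ → Matrix σ τ ℂ) : Matrix σ τ (PowerSeries ℂ) :=
  Matrix.of fun i j => taylor fun ξ => F ξ i j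

lemma taylorMatrix_apply (F : ℝ → Matrix σ τ ℂ) (i : σ) (j : τ) :
    taylorMatrix F i j = taylor fun ξ => F ξ i j := rfl

lemma SmoothEntries.mul [Fintype κ] {F : ℝ → Matrix σ κ ℂ} {G : ℝ → Matrix κ τ ℂ}
    (hF : SmoothEntries F) (hG : SmoothEntries G) : SmoothEntries fun ξ => F ξ * G ξ := by
  intro i j
  simp only [Matrix.mul_apply]
  exact ContDiff.sum fun k _ => (hF i k).mul (hG k j)

lemma SmoothEntries.comp_mul {F : ℝ → Matrix σ τ ℂ} (hF : SmoothEntries F) (c : ℝ) :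
    SmoothEntries fun ξ => F (c * ξ) := fun i j =>
  (hF i j).comp (contDiff_const.mul contDiff_id)

lemma SmoothEntries.comp_add {F : ℝ → Matrix σ τ ℂ} (hF : SmoothEntries F) (c : ℝ) :
    SmoothEntries fun ξ => F (ξ + c) := fun i j =>
  (hF i j).comp (contDiff_id.add contDiff_const)

lemma SmoothEntries.add {F G : ℝ → Matrix σ τ ℂ} (hF : SmoothEntries F) (hG : SmoothEntries G) :
    SmoothEntries fun ξ => F ξ + G ξ := fun i j => (hF i j).add (hG i j)

lemma SmoothEntries.const_smul {F : ℝ → Matrix σ τ ℂ} (c : ℂ) (hF : SmoothEntries F) :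
    SmoothEntries fun ξ => c • F ξ := fun i j => contDiff_const.mul (hF i j)

lemma taylorMatrix_mul [Fintype κ] {F : ℝ → Matrix σ κ ℂ} {G : ℝ → Matrix κ τ ℂ}
    (hF : SmoothEntries F) (hG : SmoothEntries G) :
    taylorMatrix (fun ξ => F ξ * G ξ) = taylorMatrix F * taylorMatrix G := by
  ext1 i j
  simp only [taylorMatrix_apply, Matrix.mul_apply]
  rw [taylor_sum _ fun k _ => (hF i k).mul (hG k j)]
  exact Finset.sum_congr rfl fun k _ => taylor_mul (hF i k) (hG k j)

lemma taylorMatrix_add {F G : ℝ → Matrix σ τ ℂ}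
    (hF : SmoothEntries F) (hG : SmoothEntries G) :
    taylorMatrix (fun ξ => F ξ + G ξ) = taylorMatrix F + taylorMatrix G := by
  ext1 i j
  exact taylor_add (hF i j) (hG i j)

lemma taylorMatrix_const_smul (c : ℂ) (F : ℝ → Matrix σ τ ℂ) :
    taylorMatrix (fun ξ => c • F ξ) = c • taylorMatrix F := by
  ext1 i j
  exact taylor_const_mul c _

lemma taylorMatrix_smul {f : ℝ → ℂ} {F : ℝ → Matrix σ τ ℂ} (hf : ContDiff ℝ ∞ f)
    (hF : SmoothEntries F) :
    taylorMatrix (fun ξ => f ξ • F ξ) = taylor f • taylorMatrix F := by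
  ext1 i j
  exact taylor_mul hf (hF i j)

lemma taylorMatrix_comp_mul {F : ℝ → Matrix σ τ ℂ} (hF : SmoothEntries F) (c : ℝ) :
    taylorMatrix (fun ξ => F (c * ξ)) = (taylorMatrix F).map (rescale (c : ℂ)) := by
  ext1 i j
  exact taylor_comp_mul (hF i j) c

lemma contDiff_expChar (k : ℤ) : ContDiff ℝ ∞ (expChar k) := by
  unfold expChar
  have : ContDiff ℝ ∞ (fun ξ : ℝ => (ξ : ℂ)) := Complex.ofRealCLM.contDiff
  fun_prop

lemma smoothEntries_symbol (c : FinSeq σ τ) : SmoothEntries (symbol c) := by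
  intro i j
  simp only [symbol_apply]
  exact ContDiff.sum fun k _ => (contDiff_expChar k).mul contDiff_const

/-- The Taylor series at `0` of the symbol. -/
def symbolSeries (c : FinSeq σ τ) : Matrix σ τ (PowerSeries ℂ) := taylorMatrix (symbol c)

lemma iteratedDeriv_expChar (k : ℤ) (j : ℕ) :
    iteratedDeriv j (expChar k) = fun ξ => (-(Complex.I * k)) ^ j * expChar k ξ := by
  induction j with
  | zero => simp
  | succ j ih =>
    rw [iteratedDeriv_succ, ih]
    ext ξ
    have h : HasDerivAt (expChar k) (expChar k ξ * -(Complex.I * k)) ξ := by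
      have h1 : HasDerivAt (fun ξ : ℝ => -(Complex.I * (k : ℂ) * (ξ : ℂ))) (-(Complex.I * k)) ξ := by
        have h2 := ((Complex.ofRealCLM.hasDerivAt (x := ξ)).const_mul (Complex.I * (k : ℂ))).neg
        rw [Complex.ofRealCLM_apply, Complex.ofReal_one, mul_one] at h2
        exact h2
      exact h1.cexp
    rw [(h.const_mul _).deriv]
    ring

lemma coeff_symbolSeries (c : FinSeq σ τ) (i : σ) (l : τ) (j : ℕ) :
    coeff j (symbolSeries c i l) =
      ∑ k ∈ c.support, (-(Complex.I * k)) ^ j / (j.factorial : ℂ) * c k i l := by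
  have h : (fun ξ => symbol c ξ i l) = fun ξ => ∑ k ∈ c.support, c k i l * expChar k ξ := by
    ext ξ; rw [symbol_apply]; exact Finset.sum_congr rfl fun k _ => mul_comm _ _
  rw [symbolSeries, taylorMatrix_apply, h,
    taylor_sum _ fun k _ => contDiff_const.mul (contDiff_expChar k), map_sum]
  refine Finset.sum_congr rfl fun k _ => ?_
  rw [taylor_const_mul, coeff_smul, coeff_taylor, iteratedDeriv_expChar]
  simp [mul_comm]

lemma constantCoeff_symbolSeries (c : FinSeq σ τ) (i : σ) (l : τ) :
    constantCoeff (symbolSeries c i l) = symbol c 0 i l := constantCoeff_taylor _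

lemma symbolSeries_fconv [Fintype κ] (x : FinSeq σ κ) (u : FinSeq κ τ) :
    symbolSeries (fconv x u) = symbolSeries x * symbolSeries u := by
  rw [symbolSeries, funext (symbol_fconv x u),
    taylorMatrix_mul (smoothEntries_symbol x) (smoothEntries_symbol u)]
  rfl

lemma symbolSeries_add (c d : FinSeq σ τ) :
    symbolSeries (c + d) = symbolSeries c + symbolSeries d := by
  rw [symbolSeries, funext (symbol_add c d),
    taylorMatrix_add (smoothEntries_symbol c) (smoothEntries_symbol d)]
  rfl

lemma symbolSeries_smul (z : ℂ) (c : FinSeq σ τ) :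
    symbolSeries (z • c) = z • symbolSeries c := by
  rw [symbolSeries, funext (symbol_smul z c), taylorMatrix_const_smul]
  rfl

lemma symbolSeries_sub (c d : FinSeq σ τ) :
    symbolSeries (c - d) = symbolSeries c - symbolSeries d := by
  have h := symbolSeries_add (c - d) d
  rw [sub_add_cancel] at h
  exact (sub_eq_of_eq_add h).symm

lemma symbolSeries_fsub (a : FinSeq (Fin r) (Fin r)) (x : FinSeq σ (Fin r)) :
    symbolSeries (fsub a x) =
      (2 : ℂ) • ((symbolSeries x).map (rescale (2 : ℂ)) * symbolSeries a) := by
  rw [symbolSeries, funext (symbol_fsub a x), taylorMatrix_const_smul,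
    taylorMatrix_mul ((smoothEntries_symbol x).comp_mul 2) (smoothEntries_symbol a),
    taylorMatrix_comp_mul (smoothEntries_symbol x)]
  simp only [symbolSeries, Complex.ofReal_ofNat]

lemma symbolSeries_single_zero [DecidableEq σ] :
    symbolSeries (Finsupp.single 0 (1 : Matrix σ σ ℂ)) = 1 := by
  ext i j k
  rw [symbolSeries, taylorMatrix_apply]
  have h : (fun ξ => symbol (Finsupp.single 0 (1 : Matrix σ σ ℂ)) ξ i j) =
      fun _ => (1 : Matrix σ σ ℂ) i j := by
    ext ξ; simp
  rw [h, coeff_taylor, iteratedDeriv_const, Matrix.one_apply, Matrix.one_apply]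
  split_ifs with h1 h2 <;> simp_all [coeff_one]

/-! ### Matching filters and sum rules through Taylor series -/

lemma exists_eq_add_X_pow_smul {n : ℕ} {F G : Matrix σ τ (PowerSeries ℂ)}
    (h : ∀ i j, (X : PowerSeries ℂ) ^ n ∣ F i j - G i j) :
    ∃ R : Matrix σ τ (PowerSeries ℂ), F = G + (X : PowerSeries ℂ) ^ n • R := by
  choose R hR using h
  refine ⟨Matrix.of R, ?_⟩
  ext1 i j
  rw [Matrix.add_apply, Matrix.smul_apply, Matrix.of_apply, smul_eq_mul, ← hR]
  ring

lemma IsMatchingFilter.exists_series {a : FinSeq (Fin r) (Fin r)} {n : ℕ}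
    {v : FinSeq (Fin 1) (Fin r)} (h : IsMatchingFilter a n v) :
    ∃ R : Matrix (Fin 1) (Fin r) (PowerSeries ℂ),
      (symbolSeries v).map (rescale (2 : ℂ)) * symbolSeries a =
        symbolSeries v + (X : PowerSeries ℂ) ^ n • R := by
  apply exists_eq_add_X_pow_smul
  intro i l
  obtain rfl : i = 0 := Subsingleton.elim _ _
  have h1 := eqUpToOrder_iff_dvd.mp (h.2 l)
  have h2 := taylorMatrix_mul ((smoothEntries_symbol v).comp_mul 2) (smoothEntries_symbol a)
  rw [taylorMatrix_comp_mul (smoothEntries_symbol v)] at h2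
  rw [show (2 : ℂ) = ((2 : ℝ) : ℂ) by norm_num]
  unfold symbolSeries
  rw [← h2]
  exact h1

lemma HasSumRules.exists_series {a : FinSeq (Fin r) (Fin r)} {n : ℕ}
    {v : FinSeq (Fin 1) (Fin r)} (h : HasSumRules a n v) :
    ∃ R : Matrix (Fin 1) (Fin r) (PowerSeries ℂ),
      (symbolSeries v).map (rescale (2 : ℂ)) *
          taylorMatrix (fun ξ => symbol a (ξ + Real.pi)) =
        (X : PowerSeries ℂ) ^ n • R := by
  have := exists_eq_add_X_pow_smul (n := n) (F := (symbolSeries v).map (rescale (2 : ℂ)) *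
          taylorMatrix (fun ξ => symbol a (ξ + Real.pi))) (G := 0) ?_
  · simpa using this
  intro i l
  obtain rfl : i = 0 := Subsingleton.elim _ _
  have h1 := eqUpToOrder_iff_dvd.mp (h.2 l)
  have h2 := taylorMatrix_mul ((smoothEntries_symbol v).comp_mul 2)
    ((smoothEntries_symbol a).comp_add Real.pi)
  rw [taylorMatrix_comp_mul (smoothEntries_symbol v)] at h2
  rw [show (2 : ℂ) = ((2 : ℝ) : ℂ) by norm_num]
  unfold symbolSeries
  rw [← h2]
  rw [taylor_zero] at h1
  exact h1

lemma mem_vanishingSpace_iff {j : ℕ} {v : FinSeq (Fin 1) (Fin r)} {u : FinSeq (Fin r) (Fin 1)} :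
    u ∈ vanishingSpace j v ↔
      (X : PowerSeries ℂ) ^ j ∣ (symbolSeries v * symbolSeries u) 0 0 := by
  rw [vanishingSpace, Set.mem_ofPred_eq, eqUpToOrder_iff_dvd, taylor_zero, sub_zero]
  unfold symbolSeries
  rw [← taylorMatrix_mul (smoothEntries_symbol v) (smoothEntries_symbol u)]
  rfl

lemma map_rescale_X_pow_smul (c : ℂ) (n : ℕ) (R : Matrix σ τ (PowerSeries ℂ)) :
    ((X : PowerSeries ℂ) ^ n • R).map (rescale c) =
      (X : PowerSeries ℂ) ^ n • (c ^ n • R.map (rescale c)) := by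
  ext1 i j
  simp only [Matrix.map_apply, Matrix.smul_apply, smul_eq_mul, map_mul, map_pow, rescale_X,
    mul_pow]
  rw [← map_pow, smul_eq_C_mul]
  ring

lemma map_rescale_smul (c z : ℂ) (R : Matrix σ τ (PowerSeries ℂ)) :
    (z • R).map (rescale c) = z • R.map (rescale c) := by
  ext i j
  simp only [Matrix.map_apply, Matrix.smul_apply, coeff_rescale, coeff_smul]
  simp only [smul_eq_mul]
  ring

/-- The matching condition telescopes along the iteration. The factor 2^n comes from the 2 in S_a,
and errors keep their order because a dilation only multiplies X^N by a constant. -/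
lemma IsMatchingFilter.exists_series_iterMask {a : FinSeq (Fin r) (Fin r)} {N : ℕ}
    {v : FinSeq (Fin 1) (Fin r)} (h : IsMatchingFilter a N v) (n : ℕ) :
    ∃ R : Matrix (Fin 1) (Fin r) (PowerSeries ℂ),
      (symbolSeries v).map (rescale ((2 : ℂ) ^ n)) * symbolSeries (iterMask a n) =
        (2 : ℂ) ^ n • symbolSeries v + (X : PowerSeries ℂ) ^ N • R := by
  induction n with
  | zero =>
    refine ⟨0, ?_⟩
    rw [iterMask, symbolSeries_single_zero]
    simp [rescale_one]
  | succ n ih =>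
    obtain ⟨R, hR⟩ := ih
    obtain ⟨S, hS⟩ := h.exists_series
    have hmap : (symbolSeries v).map (rescale ((2 : ℂ) ^ (n + 1))) =
        ((symbolSeries v).map (rescale ((2 : ℂ) ^ n))).map (rescale (2 : ℂ)) := by
      ext1 i j
      simp only [Matrix.map_apply, rescale_rescale, pow_succ]
    rw [iterMask, symbolSeries_fsub, Matrix.mul_smul, ← Matrix.mul_assoc, hmap, ← Matrix.map_mul,
      hR, Matrix.map_add _ (map_add _), map_rescale_X_pow_smul, map_rescale_smul, Matrix.add_mul,
      Matrix.smul_mul, Matrix.smul_mul, hS, smul_add, smul_add, smul_add, smul_smul, ← pow_succ',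
      add_assoc]
    refine ⟨(2 : ℂ) ^ (n + 1) • S + (2 : ℂ) • (((2 : ℂ) ^ N • R.map (rescale (2 : ℂ))) *
      symbolSeries a), ?_⟩
    rw [smul_add, smul_comm ((2 : ℂ) ^ n) ((X : PowerSeries ℂ) ^ N), smul_comm (2 : ℂ)
      ((X : PowerSeries ℂ) ^ N), smul_comm (2 : ℂ) ((X : PowerSeries ℂ) ^ N), smul_smul (2 : ℂ),
      ← pow_succ']

/-- The action of the transition operators on the Taylor coefficients of `v̂ û`. -/
lemma HasSumRules.exists_series_transition {a : FinSeq (Fin r) (Fin r)} {n : ℕ}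
    {v : FinSeq (Fin 1) (Fin r)} (h : HasSumRules a n v) (γ : ℤ) (u : FinSeq (Fin r) (Fin 1)) :
    ∃ R : PowerSeries ℂ,
      rescale (2 : ℂ) ((symbolSeries v * symbolSeries (transition a γ u)) 0 0) =
        taylor (expChar (-γ)) * (symbolSeries v * symbolSeries u) 0 0 +
          (X : PowerSeries ℂ) ^ n * R := by
  obtain ⟨S, hS⟩ := h.1.exists_series
  obtain ⟨Q, hQ⟩ := h.exists_series
  have hu := smoothEntries_symbol u
  have ha := smoothEntries_symbol a
  have h1 : (symbolSeries (transition a γ u)).map (rescale (2 : ℂ)) =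
      taylor (expChar (-γ)) • (symbolSeries a * symbolSeries u + (-1 : ℂ) ^ γ •
        (taylorMatrix (fun ξ => symbol a (ξ + Real.pi)) *
          taylorMatrix (fun ξ => symbol u (ξ + Real.pi)))) := by
    have h2 := taylorMatrix_comp_mul (smoothEntries_symbol (transition a γ u)) 2
    rw [Complex.ofReal_ofNat] at h2
    rw [symbolSeries, ← h2, funext (symbol_transition a γ u),
      taylorMatrix_smul (contDiff_expChar _) ((ha.mul hu).add
        (((ha.comp_add _).mul (hu.comp_add _)).const_smul _)),
      taylorMatrix_add (ha.mul hu) (((ha.comp_add _).mul (hu.comp_add _)).const_smul _),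
      taylorMatrix_const_smul, taylorMatrix_mul ha hu,
      taylorMatrix_mul (ha.comp_add _) (hu.comp_add _)]
    rfl
  have h3 : rescale (2 : ℂ) ((symbolSeries v * symbolSeries (transition a γ u)) 0 0) =
      ((symbolSeries v).map (rescale (2 : ℂ)) *
        (symbolSeries (transition a γ u)).map (rescale (2 : ℂ))) 0 0 := by
    rw [← Matrix.map_mul]; rfl
  -- `hS` reproduces v̂ in the term at ξ, while the sum rule `hQ` makes the term at ξ + π a multiple
  -- of X^n; only the character survives as a factor.
  rw [h3, h1, Matrix.mul_smul, Matrix.mul_add, Matrix.mul_smul, ← Matrix.mul_assoc,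
    ← Matrix.mul_assoc, hS, hQ, Matrix.add_mul, Matrix.smul_mul, Matrix.smul_mul]
  refine ⟨taylor (expChar (-γ)) * ((S * symbolSeries u) 0 0 +
    ((-1 : ℂ) ^ γ • (Q * taylorMatrix (fun ξ => symbol u (ξ + Real.pi))) 0 0)), ?_⟩
  simp only [Matrix.add_apply, Matrix.smul_apply, smul_eq_mul, smul_eq_C_mul]
  ring

/-! ### Riemann sums -/

/-- The indices of the points of `2⁻ⁿ ℤ` in `[-M, M)`. -/
def dyadicBox (n M : ℕ) : Finset ℤ := Finset.Ico (-(2 ^ n * M : ℤ)) (2 ^ n * M)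

lemma card_dyadicBox (n M : ℕ) : ((dyadicBox n M).card : ℝ) = 2 ^ n * (2 * M) := by
  have h : (dyadicBox n M).card = 2 ^ n * (2 * M) := by
    rw [dyadicBox, Int.card_Ico]
    have : (2 ^ n * M - -(2 ^ n * M) : ℤ) = ((2 ^ n * (2 * M) : ℕ) : ℤ) := by push_cast; ring
    rw [this, Int.toNat_natCast]
  rw [h]; push_cast; ring

lemma notMem_dyadicBox {n M : ℕ} {k : ℤ} (hk : k ∉ dyadicBox n M) : (2 ^ n * M : ℤ) ≤ |k| := by
  rw [dyadicBox, Finset.mem_Ico, not_and_or, not_le, not_lt] at hk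
  rcases hk with h | h
  · have := neg_le_abs k; omega
  · exact h.trans (le_abs_self k)

lemma abs_div_le_of_mem_dyadicBox {n M : ℕ} {k : ℤ} (hk : k ∈ dyadicBox n M) :
    |(k : ℝ) / 2 ^ n| ≤ M := by
  rw [dyadicBox, Finset.mem_Ico] at hk
  have h2 : (0 : ℝ) < 2 ^ n := by positivity
  rw [abs_le, le_div_iff₀ h2, div_le_iff₀ h2]
  have h3 : ((-(2 ^ n * M : ℤ) : ℤ) : ℝ) ≤ k := by exact_mod_cast hk.1
  have h4 : (k : ℝ) ≤ ((2 ^ n * M : ℤ) : ℝ) := by exact_mod_cast hk.2.le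
  push_cast at h3 h4
  constructor <;> linarith

lemma hasCompactSupport_of_le_abs {f : ℝ → ℂ} {M : ℕ} (hf : ∀ x, (M : ℝ) ≤ |x| → f x = 0) :
    HasCompactSupport f := by
  refine HasCompactSupport.intro (isCompact_Icc (a := -(M : ℝ)) (b := M)) fun x hx => hf x ?_
  by_contra h
  exact hx (abs_le.mp (not_le.mp h).le)

lemma uniformContinuous_of_le_abs {f : ℝ → ℂ} {M : ℕ} (hfc : Continuous f)
    (hf : ∀ x, (M : ℝ) ≤ |x| → f x = 0) : UniformContinuous f :=
  (hasCompactSupport_of_le_abs hf).uniformContinuous_of_continuous hfc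

lemma integrable_of_le_abs {f : ℝ → ℂ} {M : ℕ} (hfc : Continuous f)
    (hf : ∀ x, (M : ℝ) ≤ |x| → f x = 0) : Integrable f :=
  hfc.integrable_of_hasCompactSupport (hasCompactSupport_of_le_abs hf)

lemma integral_eq_sum_dyadicBox {f : ℝ → ℂ} {M : ℕ} (hfc : Continuous f)
    (hf : ∀ x, (M : ℝ) ≤ |x| → f x = 0) (n : ℕ) :
    ∫ x, f x = ∑ k ∈ dyadicBox n M, ∫ x in ((k : ℝ) / 2 ^ n)..((k + 1 : ℝ) / 2 ^ n), f x := by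
  have h1 : ∫ x, f x = ∫ x in (-(M : ℝ))..M, f x := by
    rw [intervalIntegral.integral_eq_integral_of_support_subset]
    intro x hx
    have h : |x| < M := by
      by_contra h
      exact hx (hf x (not_lt.mp h))
    exact ⟨(abs_lt.mp h).1, (abs_lt.mp h).2.le⟩
  have h2 := intervalIntegral.sum_integral_adjacent_intervals (μ := volume) (f := f)
    (a := fun i : ℕ => ((i : ℝ) - 2 ^ n * M) / 2 ^ n) (n := 2 ^ n * (2 * M))
    fun k _ => hfc.intervalIntegrable _ _
  have h3 : (2 : ℝ) ^ n ≠ 0 := by positivity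
  rw [h1]
  have h4 : ((((0 : ℕ) : ℝ) - 2 ^ n * M) / 2 ^ n) = -(M : ℝ) := by push_cast; field_simp; ring
  have h5 : (((2 ^ n * (2 * M) : ℕ) : ℝ) - 2 ^ n * M) / 2 ^ n = M := by
    push_cast; field_simp; ring
  rw [h4, h5] at h2
  rw [← h2]
  refine Finset.sum_bij' (fun (i : ℕ) _ => ((i : ℤ) - 2 ^ n * M : ℤ))
    (fun k _ => (k + 2 ^ n * M).toNat) ?_ ?_ ?_ ?_ ?_
  · intro i hi
    rw [Finset.mem_range] at hi
    rw [dyadicBox, Finset.mem_Ico]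
    have : (i : ℤ) < 2 ^ n * (2 * M) := by exact_mod_cast hi
    constructor
    · omega
    · linarith
  · intro k hk
    rw [dyadicBox, Finset.mem_Ico] at hk
    rw [Finset.mem_range]
    have : (((k + 2 ^ n * M).toNat : ℕ) : ℤ) < ((2 ^ n * (2 * M) : ℕ) : ℤ) := by
      rw [Int.toNat_of_nonneg (by linarith)]
      push_cast; linarith
    exact_mod_cast this
  · intro i _
    simp
  · intro k hk
    rw [dyadicBox, Finset.mem_Ico] at hk
    rw [Int.toNat_of_nonneg (by linarith)]
    ring
  · intro i _
    push_cast
    congr 1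
    ring

lemma tendsto_riemannSum {f : ℝ → ℂ} {M : ℕ} (hfc : Continuous f)
    (hf : ∀ x, (M : ℝ) ≤ |x| → f x = 0) :
    Tendsto (fun n : ℕ => ((2 : ℂ) ^ n)⁻¹ * ∑ k ∈ dyadicBox n M, f ((k : ℝ) / 2 ^ n)) atTop
      (𝓝 (∫ x, f x)) := by
  rw [Metric.tendsto_atTop]
  intro ε hε
  -- `2 * M + 1` instead of the length `2 * M` of the interval: it cannot vanish, and it leaves room
  -- for a strict inequality at the end.
  have hM : (0 : ℝ) < 2 * M + 1 := by positivity
  obtain ⟨δ, hδ, hδf⟩ := Metric.uniformContinuous_iff.mp (uniformContinuous_of_le_abs hfc hf)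
    (ε / (2 * M + 1)) (by positivity)
  obtain ⟨n₀, hn₀⟩ := exists_pow_lt_of_lt_one hδ (show (2 : ℝ)⁻¹ < 1 by norm_num)
  refine ⟨n₀, fun n hn => ?_⟩
  have hpow : ((2 : ℝ) ^ n)⁻¹ < δ := by
    rw [← inv_pow]
    exact (pow_le_pow_of_le_one (by norm_num) (by norm_num) hn).trans_lt hn₀
  have h2 : (0 : ℝ) < 2 ^ n := by positivity
  rw [dist_eq_norm, integral_eq_sum_dyadicBox hfc hf n, Finset.mul_sum, ← Finset.sum_sub_distrib]
  have hterm : ∀ k ∈ dyadicBox n M, ‖((2 : ℂ) ^ n)⁻¹ * f ((k : ℝ) / 2 ^ n) -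
      ∫ x in ((k : ℝ) / 2 ^ n)..((k + 1 : ℝ) / 2 ^ n), f x‖ ≤
        ε / (2 * M + 1) * ((2 : ℝ) ^ n)⁻¹ := by
    intro k _
    have hlen : ((k + 1 : ℝ) / 2 ^ n) - (k : ℝ) / 2 ^ n = ((2 : ℝ) ^ n)⁻¹ := by
      field_simp; ring
    have hc : ((2 : ℂ) ^ n)⁻¹ * f ((k : ℝ) / 2 ^ n) =
        ∫ x in ((k : ℝ) / 2 ^ n)..((k + 1 : ℝ) / 2 ^ n), f ((k : ℝ) / 2 ^ n) := by
      rw [intervalIntegral.integral_const, hlen, Complex.real_smul]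
      push_cast; ring
    rw [hc, ← intervalIntegral.integral_sub (by simp) (hfc.intervalIntegrable _ _)]
    have := intervalIntegral.norm_integral_le_of_norm_le_const (a := (k : ℝ) / 2 ^ n)
      (b := (k + 1 : ℝ) / 2 ^ n) (C := ε / (2 * M + 1))
      (f := fun x => f ((k : ℝ) / 2 ^ n) - f x) ?_
    · rwa [hlen, abs_of_pos (inv_pos.mpr h2)] at this
    intro x hx
    rw [Set.uIoc_of_le (by gcongr; linarith)] at hx
    rw [← dist_eq_norm]
    refine (hδf ?_).le
    rw [Real.dist_eq, abs_lt]
    constructor <;> linarith [hx.1, hx.2]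
  calc _ ≤ ∑ k ∈ dyadicBox n M, ε / (2 * M + 1) * ((2 : ℝ) ^ n)⁻¹ := norm_sum_le_of_le _ hterm
    _ = ε / (2 * M + 1) * (2 * M) := by
      rw [Finset.sum_const, nsmul_eq_mul, card_dyadicBox]; field_simp
    _ < ε := by
      rw [div_mul_eq_mul_div, div_lt_iff₀ hM]; nlinarith

/-- Uniform closeness of a family of sequences to the dyadic samples of a function. -/
def SampleLimit (b : ℕ → ℤ → ℂ) (f : ℝ → ℂ) : Prop :=
  ∀ ε > 0, ∀ᶠ n : ℕ in atTop, ∀ k : ℤ, ‖b n k - f ((k : ℝ) / 2 ^ n)‖ ≤ ε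

lemma SampleLimit.tendsto_sum {b : ℕ → ℤ → ℂ} {f h : ℝ → ℂ} {M : ℕ} (hb : SampleLimit b f)
    (hfc : Continuous f) (hf : ∀ x, (M : ℝ) ≤ |x| → f x = 0) (hh : Continuous h) :
    Tendsto (fun n : ℕ => ((2 : ℂ) ^ n)⁻¹ * ∑ k ∈ dyadicBox n M, b n k * h ((k : ℝ) / 2 ^ n)) atTop
      (𝓝 (∫ x, f x * h x)) := by
  have h1 := tendsto_riemannSum (f := fun x => f x * h x) (M := M) (hfc.mul hh)
    fun x hx => by rw [hf x hx, zero_mul]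
  refine h1.congr_dist ?_
  obtain ⟨B, hB⟩ := (isCompact_Icc (a := -(M : ℝ)) (b := M)).exists_bound_of_continuousOn
    hh.continuousOn
  rw [Metric.tendsto_atTop']
  intro ε hε
  have hM : (0 : ℝ) < 2 * M + 1 := by positivity
  have hB' : 0 < |B| + 1 := by positivity
  obtain ⟨n₀, hn₀⟩ := (hb (ε / ((2 * M + 1) * (|B| + 1))) (by positivity)).exists_forall_of_atTop
  refine ⟨n₀, fun n hn => ?_⟩
  rw [Real.dist_0_eq_abs, abs_of_nonneg dist_nonneg, dist_comm, dist_eq_norm, ← mul_sub,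
    ← Finset.sum_sub_distrib, norm_mul, norm_inv, norm_pow, Complex.norm_ofNat]
  have h2 : (0 : ℝ) < 2 ^ n := by positivity
  have hterm : ∀ k ∈ dyadicBox n M, ‖b n k * h ((k : ℝ) / 2 ^ n) -
      f ((k : ℝ) / 2 ^ n) * h ((k : ℝ) / 2 ^ n)‖ ≤ ε / (2 * M + 1) := by
    intro k hk
    rw [← sub_mul, norm_mul]
    have h3 := hn₀ n hn.le k
    have h4 : ‖h ((k : ℝ) / 2 ^ n)‖ ≤ |B| + 1 :=
      ((hB _ (abs_le.mp (abs_div_le_of_mem_dyadicBox hk))).trans (le_abs_self B)).trans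
        (by linarith)
    calc _ ≤ ε / ((2 * M + 1) * (|B| + 1)) * (|B| + 1) := by gcongr
      _ = ε / (2 * M + 1) := by field_simp
  calc _ ≤ ((2 : ℝ) ^ n)⁻¹ * ∑ k ∈ dyadicBox n M, ε / (2 * M + 1) := by
        gcongr; exact norm_sum_le_of_le _ hterm
    _ = ε / (2 * M + 1) * (2 * M) := by
      rw [Finset.sum_const, nsmul_eq_mul, card_dyadicBox]; field_simp
    _ < ε := by
      rw [div_mul_eq_mul_div, div_lt_iff₀ hM]; nlinarith

/-! ### Moments of derivatives -/

lemma iteratedDeriv_eq_zero_of_le_abs {f : ℝ → ℂ} {M : ℕ}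
    (hf : ∀ x, (M : ℝ) ≤ |x| → f x = 0) (j : ℕ) (x : ℝ) (hx : (M + 1 : ℝ) ≤ |x|) :
    iteratedDeriv j f x = 0 := by
  have h : f =ᶠ[𝓝 x] fun _ => 0 := by
    have : ∀ᶠ y in 𝓝 x, (M : ℝ) < |y| := by
      apply continuous_abs.continuousAt.eventually (lt_mem_nhds _)
      linarith
    filter_upwards [this] with y hy using hf y hy.le
  rw [h.iteratedDeriv_eq]
  simp

/-- Integration by parts ν times, without boundary terms. For j < ν the descending factorial is
zero, which makes the truncated exponent `j - ν` harmless and later removes all moments of order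
below ν. -/
lemma integral_iteratedDeriv_mul_pow {f : ℝ → ℂ} {M : ℕ} (hf : ∀ x, (M : ℝ) ≤ |x| → f x = 0)
    (ν j : ℕ) (hfν : ContDiff ℝ ν f) :
    ∫ x, iteratedDeriv ν f x * (x : ℂ) ^ j =
      (-1) ^ ν * (j.descFactorial ν : ℂ) * ∫ x, f x * (x : ℂ) ^ (j - ν) := by
  induction ν generalizing j with
  | zero => simp
  | succ ν ih =>
    have hsupp := fun i => iteratedDeriv_eq_zero_of_le_abs hf i
    have hsupp' : ∀ i x, ((M + 1 : ℕ) : ℝ) ≤ |x| → iteratedDeriv i f x = 0 := fun i x hx =>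
      hsupp i x (by exact_mod_cast hx)
    have hcont : ∀ i ≤ ν + 1, Continuous (iteratedDeriv i f) := fun i hi =>
      hfν.continuous_iteratedDeriv i (by exact_mod_cast hi)
    have hint : ∀ i ≤ ν + 1, ∀ h : ℝ → ℂ, Continuous h →
        Integrable (fun x => h x * iteratedDeriv i f x) := fun i hi h hh =>
      integrable_of_le_abs (M := M + 1) (hh.mul (hcont i hi)) fun x hx => by
        rw [hsupp' i x hx, mul_zero]
    have hpowc : ∀ i : ℕ, Continuous fun x : ℝ => (x : ℂ) ^ i := fun i =>
      Complex.continuous_ofReal.pow i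
    have hder : ∀ x : ℝ, HasDerivAt (fun x : ℝ => (x : ℂ) ^ j) ((j : ℂ) * (x : ℂ) ^ (j - 1)) x :=
      fun x => (hasDerivAt_pow j (x : ℂ)).comp_ofReal
    have hdf : ∀ x, HasDerivAt (iteratedDeriv ν f) (iteratedDeriv (ν + 1) f x) x := by
      intro x
      rw [iteratedDeriv_succ]
      exact ((hfν.differentiable_iteratedDeriv ν (by exact_mod_cast Nat.lt_succ_self ν)) x).hasDerivAt
    have key := integral_mul_deriv_eq_deriv_mul_of_integrable
      (u := fun x : ℝ => (x : ℂ) ^ j) (v := iteratedDeriv ν f)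
      (u' := fun x : ℝ => (j : ℂ) * (x : ℂ) ^ (j - 1)) (v' := iteratedDeriv (ν + 1) f)
      (fun x _ => hder x) (fun x _ => hdf x) (hint _ le_rfl _ (hpowc j))
      (hint _ (Nat.le_succ ν) _ (continuous_const.mul (hpowc _)))
      (hint _ (Nat.le_succ ν) _ (hpowc j))
    have e1 : ∫ x, iteratedDeriv (ν + 1) f x * (x : ℂ) ^ j =
        ∫ x : ℝ, (x : ℂ) ^ j * iteratedDeriv (ν + 1) f x := by simp only [mul_comm]
    have e2 : ∫ x : ℝ, (j : ℂ) * (x : ℂ) ^ (j - 1) * iteratedDeriv ν f x =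
        j * ∫ x : ℝ, iteratedDeriv ν f x * (x : ℂ) ^ (j - 1) := by
      rw [← integral_const_mul]
      congr 1; ext x; ring
    rw [e1, key, e2, ih (j - 1) (hfν.of_le (by exact_mod_cast Nat.le_succ ν))]
    rcases j with _ | j
    · simp
    · rw [Nat.succ_descFactorial_succ, Nat.add_sub_cancel, Nat.add_sub_add_right]
      push_cast; ring

/-! ### Supports -/

/-- The sequence `c` vanishes outside `[-N, N]`. -/
def SupportedIn (N : ℤ) (c : FinSeq σ τ) : Prop := ∀ k : ℤ, N < |k| → c k = 0

lemma exists_supportedIn (c : FinSeq σ τ) : ∃ N : ℕ, SupportedIn N c := by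
  refine ⟨∑ k ∈ c.support, k.natAbs, fun k hk => ?_⟩
  by_contra h
  have h1 : k.natAbs ≤ ∑ k ∈ c.support, k.natAbs :=
    Finset.single_le_sum (f := fun k : ℤ => k.natAbs) (fun _ _ => Nat.zero_le _)
      (Finsupp.mem_support_iff.mpr h)
  have h2 : ((k.natAbs : ℕ) : ℤ) ≤ ((∑ k ∈ c.support, k.natAbs : ℕ) : ℤ) := Nat.cast_le.mpr h1
  rw [Int.natCast_natAbs] at h2
  exact absurd h2 (not_le.mpr hk)

lemma SupportedIn.mono {N M : ℤ} {c : FinSeq σ τ} (h : SupportedIn N c) (hNM : N ≤ M) :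
    SupportedIn M c := fun k hk => h k (hNM.trans_lt hk)

lemma SupportedIn.fconv [Fintype κ] {N M : ℤ} {x : FinSeq σ κ} {u : FinSeq κ τ}
    (hx : SupportedIn N x) (hu : SupportedIn M u) : SupportedIn (N + M) (fconv x u) := by
  intro k hk
  rw [fconv_apply]
  refine Finset.sum_eq_zero fun p _ => ?_
  by_cases hp : M < |p|
  · rw [hu p hp, Matrix.mul_zero]
  · rw [hx (k - p), Matrix.zero_mul]
    have := abs_sub_abs_le_abs_sub k p
    omega

lemma SupportedIn.fsub {N M : ℤ} {x : FinSeq σ (Fin r)} {a : FinSeq (Fin r) (Fin r)}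
    (hx : SupportedIn N x) (ha : SupportedIn M a) : SupportedIn (2 * N + M) (fsub a x) := by
  intro k hk
  rw [fsub_apply, Finset.sum_eq_zero, smul_zero]
  intro p _
  by_cases hp : N < |p|
  · rw [hx p hp, Matrix.zero_mul]
  · rw [ha (k - 2 * p), Matrix.mul_zero]
    have := abs_sub_abs_le_abs_sub k (2 * p)
    rw [abs_mul, abs_two] at this
    omega

lemma SupportedIn.iterMask {N : ℤ} {a : FinSeq (Fin r) (Fin r)} (ha : SupportedIn N a) (n : ℕ) :
    SupportedIn ((2 ^ n - 1) * N) (iterMask a n) := by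
  induction n with
  | zero =>
    intro k hk
    rw [VectorSubdivision.iterMask, Finsupp.single_apply, if_neg]
    rintro rfl
    simp at hk
  | succ n ih =>
    have := ih.fsub ha
    rw [show 2 * ((2 ^ n - 1) * N) + N = (2 ^ (n + 1) - 1) * N by ring] at this
    exact this

lemma fconv_iterMask_eq_zero {N M : ℕ} {a : FinSeq (Fin r) (Fin r)} {u : FinSeq (Fin r) τ}
    (ha : SupportedIn N a) (hu : SupportedIn M u) (n : ℕ) (k : ℤ)
    (hk : k ∉ dyadicBox n (N + M + 1)) : fconv (iterMask a n) u k = 0 := by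
  refine ((ha.iterMask n).fconv hu) k (lt_of_lt_of_le ?_ (notMem_dyadicBox hk))
  have h1 : (1 : ℤ) ≤ 2 ^ n := one_le_pow₀ (by norm_num)
  push_cast
  nlinarith

/-! ### Rescaled moments of the iterated masks -/

/-- The Taylor coefficient of order `j` of `2⁻ⁿ ĉ(2⁻ⁿ ξ)`. -/
def moment (n j : ℕ) (c : FinSeq σ τ) (i : σ) (l : τ) : ℂ :=
  ((2 : ℂ) ^ n)⁻¹ * (((2 : ℂ) ^ n) ^ j)⁻¹ * coeff j (symbolSeries c i l)

lemma moment_eq_sum {n M : ℕ} {c : FinSeq σ τ} (hc : ∀ k ∉ dyadicBox n M, c k = 0) (j : ℕ)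
    (i : σ) (l : τ) : moment n j c i l = ((2 : ℂ) ^ n)⁻¹ * ∑ k ∈ dyadicBox n M,
      c k i l * ((-Complex.I) ^ j / (j.factorial : ℂ) * (((k : ℝ) / 2 ^ n : ℝ) : ℂ) ^ j) := by
  have hsub : c.support ⊆ dyadicBox n M := fun k hk => by
    by_contra h
    exact (Finsupp.mem_support_iff.mp hk) (hc k h)
  rw [moment, coeff_symbolSeries, mul_assoc]
  congr 1
  rw [Finset.mul_sum, Finset.sum_subset hsub fun k _ hk => by
    rw [Finsupp.notMem_support_iff.mp hk]; simp]
  refine Finset.sum_congr rfl fun k _ => ?_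
  push_cast
  rw [div_pow, neg_mul_eq_neg_mul, mul_pow]
  field_simp

lemma norm_moment_le {n M : ℕ} {c : FinSeq σ τ} (hc : ∀ k ∉ dyadicBox n M, c k = 0) (j : ℕ)
    (i : σ) (l : τ) {B : ℝ} (hB : ∀ k, ‖c k i l‖ ≤ B) :
    ‖moment n j c i l‖ ≤ 2 * M * M ^ j * B := by
  have hB0 : 0 ≤ B := (norm_nonneg _).trans (hB 0)
  rw [moment_eq_sum hc, norm_mul, norm_inv, norm_pow, Complex.norm_ofNat]
  have h2 : (0 : ℝ) < 2 ^ n := by positivity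
  have hterm : ∀ k ∈ dyadicBox n M, ‖c k i l * ((-Complex.I) ^ j / (j.factorial : ℂ) *
      (((k : ℝ) / 2 ^ n : ℝ) : ℂ) ^ j)‖ ≤ B * M ^ j := by
    intro k hk
    rw [norm_mul, norm_mul, norm_div, norm_pow, norm_neg, Complex.norm_I, one_pow, norm_pow,
      Complex.norm_real, Complex.norm_natCast, Real.norm_eq_abs]
    have h3 : (1 : ℝ) / j.factorial ≤ 1 := by
      rw [div_le_one (by positivity)]
      exact_mod_cast Nat.one_le_iff_ne_zero.mpr j.factorial_ne_zero
    calc _ ≤ B * (1 * (M : ℝ) ^ j) := by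
          gcongr
          · exact hB k
          · exact abs_div_le_of_mem_dyadicBox hk
      _ = _ := by ring
  calc _ ≤ ((2 : ℝ) ^ n)⁻¹ * ∑ k ∈ dyadicBox n M, B * (M : ℝ) ^ j := by
        gcongr; exact norm_sum_le_of_le _ hterm
    _ = _ := by
      rw [Finset.sum_const, nsmul_eq_mul, card_dyadicBox]; field_simp

/-- The moment identity for matching filters. -/
lemma IsMatchingFilter.sum_moment {a : FinSeq (Fin r) (Fin r)} {N : ℕ}
    {v : FinSeq (Fin 1) (Fin r)} (h : IsMatchingFilter a N v) (u : FinSeq (Fin r) (Fin 1))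
    (n : ℕ) {d : ℕ} (hd : d < N) :
    ∑ p ∈ Finset.HasAntidiagonal.antidiagonal d, ∑ l, coeff p.1 (symbolSeries v 0 l) *
        moment n p.2 (fconv (iterMask a n) u) l 0 =
      (((2 : ℂ) ^ n) ^ d)⁻¹ * coeff d ((symbolSeries v * symbolSeries u) 0 0) := by
  obtain ⟨R, hR⟩ := h.exists_series_iterMask n
  have h1 : (symbolSeries v).map (rescale ((2 : ℂ) ^ n)) *
      symbolSeries (fconv (VectorSubdivision.iterMask a n) u) =
      (2 : ℂ) ^ n • (symbolSeries v * symbolSeries u) +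
        (X : PowerSeries ℂ) ^ N • (R * symbolSeries u) := by
    rw [symbolSeries_fconv, ← Matrix.mul_assoc, hR, Matrix.add_mul, Matrix.smul_mul,
      Matrix.smul_mul]
  have h2 := congrArg (fun F => coeff d (F 0 0)) h1
  simp only [Matrix.add_apply, Matrix.smul_apply, map_add, coeff_smul, smul_eq_mul] at h2
  rw [coeff_X_pow_mul', if_neg (not_le.mpr hd), add_zero, Matrix.mul_apply, map_sum] at h2
  simp only [coeff_mul, Matrix.map_apply, coeff_rescale] at h2
  rw [Finset.sum_comm] at h2
  have h3 : ((2 : ℂ) ^ n) ≠ 0 := pow_ne_zero _ two_ne_zero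
  have h4 : coeff d ((symbolSeries v * symbolSeries u) 0 0) =
      ((2 : ℂ) ^ n)⁻¹ * (2 ^ n * coeff d ((symbolSeries v * symbolSeries u) 0 0)) := by
    rw [inv_mul_cancel_left₀ h3]
  rw [h4, ← h2, Finset.mul_sum, Finset.mul_sum]
  refine Finset.sum_congr rfl fun p hp => ?_
  rw [Finset.mul_sum, Finset.mul_sum]
  refine Finset.sum_congr rfl fun l _ => ?_
  rw [moment, ← Finset.HasAntidiagonal.mem_antidiagonal.mp hp, pow_add]
  field_simp

/-- Matching filters see the lowest order Taylor coefficients through the limit functions. -/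
theorem IsMatchingFilter.coeff_of_sampleLimit {a : FinSeq (Fin r) (Fin r)} {N : ℕ}
    {v : FinSeq (Fin 1) (Fin r)} (h : IsMatchingFilter a N v) {ν : ℕ} (hν : ν < N)
    (u : FinSeq (Fin r) (Fin 1)) {η : Fin r → ℝ → ℂ} (hη : ∀ j, ContDiff ℝ ν (η j))
    {M : ℕ} (hM : ∀ j x, (M : ℝ) ≤ |x| → η j x = 0)
    (hlim : ∀ j, SampleLimit (fun n k => (2 : ℂ) ^ (ν * n) * fconv (iterMask a n) u k j 0)
      (iteratedDeriv ν (η j))) :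
    (∀ d < ν, coeff d ((symbolSeries v * symbolSeries u) 0 0) = 0) ∧
      coeff ν ((symbolSeries v * symbolSeries u) 0 0) =
        Complex.I ^ ν * ∑ j, symbol v 0 0 j * ∫ x, η j x := by
  obtain ⟨Na, hNa⟩ := exists_supportedIn a
  obtain ⟨Nu, hNu⟩ := exists_supportedIn u
  set L := Na + Nu + M + 1 with hL
  have hbox : ∀ n, ∀ k ∉ dyadicBox n L, fconv (VectorSubdivision.iterMask a n) u k = 0 := by
    intro n k hk
    have := fconv_iterMask_eq_zero hNa (hNu.mono (M := ((Nu + M : ℕ) : ℤ)) (by push_cast; omega)) n k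
    apply this
    rwa [← add_assoc, ← hL]
  have hsupp : ∀ j x, (L : ℝ) ≤ |x| → iteratedDeriv ν (η j) x = 0 := by
    intro j x hx
    refine iteratedDeriv_eq_zero_of_le_abs (hM j) ν x (le_trans ?_ hx)
    rw [hL]; push_cast
    have h1 : (0 : ℝ) ≤ Na := Nat.cast_nonneg _
    have h2 : (0 : ℝ) ≤ Nu := Nat.cast_nonneg _
    linarith
  -- the limits of the rescaled moments
  have hmom : ∀ (q : ℕ) (j : Fin r), Tendsto (fun n : ℕ => (2 : ℂ) ^ (ν * n) *
      moment n q (fconv (VectorSubdivision.iterMask a n) u) j 0) atTop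
      (𝓝 ((-Complex.I) ^ q / (q.factorial : ℂ) *
        ((-1) ^ ν * (q.descFactorial ν : ℂ) * ∫ x, η j x * (x : ℂ) ^ (q - ν)))) := by
    intro q j
    have h1 := (hlim j).tendsto_sum (M := L) ((hη j).continuous_iteratedDeriv ν le_rfl) (hsupp j)
      (h := fun x : ℝ => (-Complex.I) ^ q / (q.factorial : ℂ) * (x : ℂ) ^ q)
      (continuous_const.mul (Complex.continuous_ofReal.pow q))
    have e1 : ∫ x, iteratedDeriv ν (η j) x * ((-Complex.I) ^ q / (q.factorial : ℂ) * (x : ℂ) ^ q) =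
        (-Complex.I) ^ q / (q.factorial : ℂ) * ∫ x, iteratedDeriv ν (η j) x * (x : ℂ) ^ q := by
      rw [← integral_const_mul]; congr 1; ext x; ring
    rw [e1, integral_iteratedDeriv_mul_pow (hM j) ν q (hη j)] at h1
    refine h1.congr fun n => ?_
    rw [moment_eq_sum (hbox n), mul_left_comm]
    congr 1
    rw [Finset.mul_sum]
    exact Finset.sum_congr rfl fun k _ => mul_assoc _ _ _
  -- the limit of the moment identity
  have hsum : ∀ d < N, Tendsto (fun n : ℕ => (2 : ℂ) ^ (ν * n) * ((((2 : ℂ) ^ n) ^ d)⁻¹ *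
      coeff d ((symbolSeries v * symbolSeries u) 0 0))) atTop
      (𝓝 (∑ p ∈ Finset.HasAntidiagonal.antidiagonal d, ∑ l, coeff p.1 (symbolSeries v 0 l) *
        ((-Complex.I) ^ p.2 / (p.2.factorial : ℂ) *
        ((-1) ^ ν * (p.2.descFactorial ν : ℂ) * ∫ x, η l x * (x : ℂ) ^ (p.2 - ν))))) := by
    intro d hd
    have h1 : Tendsto (fun n : ℕ => ∑ p ∈ Finset.HasAntidiagonal.antidiagonal d, ∑ l,
        coeff p.1 (symbolSeries v 0 l) * ((2 : ℂ) ^ (ν * n) *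
          moment n p.2 (fconv (VectorSubdivision.iterMask a n) u) l 0)) atTop _ :=
      tendsto_finsetSum _ fun p _ => tendsto_finsetSum _ fun l _ => (hmom p.2 l).const_mul _
    refine h1.congr fun n => ?_
    rw [← h.sum_moment u n hd, Finset.mul_sum]
    refine Finset.sum_congr rfl fun p _ => ?_
    rw [Finset.mul_sum]
    exact Finset.sum_congr rfl fun l _ => by ring
  constructor
  · intro d hd
    -- For d < ν all descending factorials in the limit vanish, whereas the sequence is the
    -- coefficient times 2^{(ν-d)n}, of modulus at least that of the coefficient.
    have h1 := hsum d (hd.trans hν)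
    rw [Finset.sum_eq_zero] at h1
    swap
    · intro p hp
      have : p.2 < ν := by
        have := Finset.HasAntidiagonal.mem_antidiagonal.mp hp
        omega
      simp [Nat.descFactorial_eq_zero_iff_lt.mpr this]
    rw [← norm_eq_zero]
    refine le_antisymm (ge_of_tendsto' (tendsto_zero_iff_norm_tendsto_zero.mp h1) fun n => ?_)
      (norm_nonneg _)
    rw [← mul_assoc, norm_mul]
    refine le_mul_of_one_le_left (norm_nonneg _) ?_
    rw [norm_mul, norm_inv, norm_pow, norm_pow, norm_pow, Complex.norm_ofNat, ← pow_mul,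
      ← div_eq_mul_inv, one_le_div (by positivity)]
    refine pow_le_pow_right₀ (by norm_num) ?_
    rw [mul_comm]
    exact Nat.mul_le_mul_right _ hd.le
  -- For d = ν the powers of two cancel, and only the splitting (0, ν) has a second index that is
  -- not below ν.
  · have h1 := hsum ν hν
    have h2 : (fun n : ℕ => (2 : ℂ) ^ (ν * n) * ((((2 : ℂ) ^ n) ^ ν)⁻¹ *
        coeff ν ((symbolSeries v * symbolSeries u) 0 0))) =
        fun _ => coeff ν ((symbolSeries v * symbolSeries u) 0 0) := by
      ext n
      rw [← pow_mul, mul_comm n ν, mul_inv_cancel_left₀ (pow_ne_zero _ two_ne_zero)]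
    rw [h2] at h1
    rw [tendsto_nhds_unique tendsto_const_nhds h1,
      Finset.sum_eq_single (0, ν)]
    · rw [Finset.mul_sum]
      refine Finset.sum_congr rfl fun l _ => ?_
      simp only [coeff_zero_eq_constantCoeff, constantCoeff_symbolSeries, Nat.descFactorial_self,
        Nat.sub_self, pow_zero, mul_one]
      have h3 : (ν.factorial : ℂ) ≠ 0 := Nat.cast_ne_zero.mpr ν.factorial_ne_zero
      have h4 : (-Complex.I) ^ ν * (-1) ^ ν = Complex.I ^ ν := by rw [← mul_pow]; simp
      rw [← h4]
      field_simp
    · rintro ⟨p, q⟩ hp hne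
      have hpq := Finset.HasAntidiagonal.mem_antidiagonal.mp hp
      have : q < ν := by
        rcases Nat.eq_zero_or_pos p with rfl | hp0
        · exfalso; apply hne; simp_all
        · simp only at hpq; omega
      simp [Nat.descFactorial_eq_zero_iff_lt.mpr this]
    · intro hn
      exact absurd (Finset.HasAntidiagonal.mem_antidiagonal.mpr (zero_add ν)) hn

/-! ### Uniform exponential decay of subdivision on decaying sequences -/

/-- Downsampling halves supports. For M = N + 1 the new radius is again N + 1, and any larger radius
strictly decreases; this is where finite-dimensional invariant spaces come from. -/
lemma SupportedIn.transition {N M : ℤ} {a : FinSeq (Fin r) (Fin r)} {u : FinSeq (Fin r) τ}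
    (ha : SupportedIn N a) (hu : SupportedIn M u) {γ : ℤ} (hγ : γ = 0 ∨ γ = 1) :
    SupportedIn ((N + M + 1) / 2) (transition a γ u) := by
  intro k hk
  rw [transition_apply, (ha.fconv hu) _, smul_zero]
  have : (N + M + 1) / 2 + 1 ≤ |k| := hk
  have h1 : N + M + 1 < 2 * |k| := by omega
  rcases abs_cases k with ⟨h, _⟩ | ⟨h, _⟩ <;> rcases abs_cases (γ + 2 * k) with ⟨h', _⟩ | ⟨h', _⟩ <;>
    rcases hγ with rfl | rfl <;> omega

lemma exists_eq_bit_add_two_mul (k : ℤ) : ∃ γ q : ℤ, (γ = 0 ∨ γ = 1) ∧ k = γ + 2 * q :=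
  ⟨k % 2, k / 2, by omega, by omega⟩

/-- Peels off n binary digits of k. The sequence u' left over consists of values of A_n * u, so a
bound for A_n * u becomes a bound for the input of the remaining n' steps; contraction estimates can
thus be chained. -/
lemma exists_fconv_iterMask_add {a : FinSeq (Fin r) (Fin r)} {X : Set (FinSeq (Fin r) τ)}
    (hX : ∀ u ∈ X, ∀ γ : ℤ, γ = 0 ∨ γ = 1 → transition a γ u ∈ X) (n : ℕ) (u : FinSeq (Fin r) τ)
    (hu : u ∈ X) (k : ℤ) : ∃ u' ∈ X, (∃ q, ∀ n', fconv (iterMask a (n' + n)) u k =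
      fconv (iterMask a n') u' q) ∧ ∀ q, ∃ k', u' q = fconv (iterMask a n) u k' := by
  induction n generalizing u k with
  | zero => exact ⟨u, hu, ⟨k, fun n' => rfl⟩, fun q => ⟨q, by rw [fconv_iterMask_zero]⟩⟩
  | succ n ih =>
    obtain ⟨γ, k₁, hγ, rfl⟩ := exists_eq_bit_add_two_mul k
    obtain ⟨u', hu', ⟨q, hq⟩, h2⟩ := ih (transition a γ u) (hX u hu γ hγ) k₁
    refine ⟨u', hu', ⟨q, fun n' => ?_⟩, fun q => ?_⟩
    · rw [← add_assoc, fconv_iterMask_succ, hq]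
    · obtain ⟨k', hk'⟩ := h2 q
      exact ⟨γ + 2 * k', by rw [hk', fconv_iterMask_succ]⟩

/-- The sequences `u` for which `lⁿ ‖S_aⁿ(δ I) * u‖_∞` tends to zero. -/
def Decays (a : FinSeq (Fin r) (Fin r)) (l : ℝ) (u : FinSeq (Fin r) (Fin 1)) : Prop :=
  ∀ ε > 0, ∀ᶠ n : ℕ in atTop, ∀ k i, l ^ n * ‖fconv (iterMask a n) u k i 0‖ ≤ ε

lemma Decays.transition {a : FinSeq (Fin r) (Fin r)} {l : ℝ} (hl : 0 < l)
    {u : FinSeq (Fin r) (Fin 1)} (hu : Decays a l u) (γ : ℤ) : Decays a l (transition a γ u) := by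
  intro ε hε
  filter_upwards [(tendsto_add_atTop_nat 1).eventually (hu (l * ε) (by positivity))] with n hn k i
  have := hn (γ + 2 * k) i
  rw [fconv_iterMask_succ, pow_succ', mul_assoc] at this
  exact le_of_mul_le_mul_left this hl

/-- The sequences supported in `[-N, N]` on which subdivision decays. -/
def decaySubmodule (a : FinSeq (Fin r) (Fin r)) (l : ℝ) (hl : 0 < l) (N : ℤ) :
    Submodule ℂ (FinSeq (Fin r) (Fin 1)) where
  carrier := {u | SupportedIn N u ∧ Decays a l u}
  zero_mem' := by
    refine ⟨fun _ _ => rfl, fun ε hε => Eventually.of_forall fun n k i => ?_⟩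
    rw [show fconv (iterMask a n) (0 : FinSeq (Fin r) (Fin 1)) = 0 from
      (fconvₗ (iterMask a n)).map_zero]
    simpa using hε.le
  add_mem' := by
    rintro u w ⟨hu, hu'⟩ ⟨hw, hw'⟩
    refine ⟨fun k hk => by rw [Finsupp.add_apply, hu k hk, hw k hk, add_zero], fun ε hε => ?_⟩
    filter_upwards [hu' (ε / 2) (by positivity), hw' (ε / 2) (by positivity)] with n h1 h2 k i
    rw [fconv_add, Finsupp.add_apply, Matrix.add_apply]
    calc _ ≤ l ^ n * (‖fconv (iterMask a n) u k i 0‖ + ‖fconv (iterMask a n) w k i 0‖) := by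
          gcongr; exact norm_add_le _ _
      _ ≤ ε := by linarith [h1 k i, h2 k i]
  smul_mem' := by
    rintro z u ⟨hu, hu'⟩
    refine ⟨fun k hk => by rw [Finsupp.smul_apply, hu k hk, smul_zero], fun ε hε => ?_⟩
    filter_upwards [hu' (ε / (‖z‖ + 1)) (by positivity)] with n h1 k i
    rw [fconv_smul, Finsupp.smul_apply, Matrix.smul_apply, norm_smul]
    have h2 : 0 < ‖z‖ + 1 := by positivity
    have h3 := (le_div_iff₀ h2).mp (h1 k i)
    have h4 : 0 ≤ l ^ n * ‖fconv (iterMask a n) u k i 0‖ := by positivity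
    nlinarith

/-- A finite family of sequences in `V` whose combinations, with the values of `u` as coefficients,
represent each `u ∈ V`. -/
lemma exists_representation {N : ℤ} (V : Submodule ℂ (FinSeq (Fin r) (Fin 1)))
    (hV : ∀ u ∈ V, SupportedIn N u) :
    ∃ f : (Finset.Icc (-N) N) × Fin r → FinSeq (Fin r) (Fin 1), (∀ p, f p ∈ V) ∧
      ∀ u ∈ V, u = ∑ p, u p.1 p.2 0 • f p := by
  classical
  let L : V →ₗ[ℂ] ((Finset.Icc (-N) N) × Fin r → ℂ) :=
    { toFun := fun u p => (u : FinSeq (Fin r) (Fin 1)) p.1 p.2 0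
      map_add' := fun u w => rfl
      map_smul' := fun z u => rfl }
  have hL : LinearMap.ker L = ⊥ := by
    rw [LinearMap.ker_eq_bot']
    intro u hu
    apply Subtype.ext
    ext k i j
    obtain rfl : j = 0 := Subsingleton.elim _ _
    by_cases hk : k ∈ Finset.Icc (-N) N
    · exact congrFun hu (⟨k, hk⟩, i)
    · rw [hV u u.2 k]
      · rfl
      · rw [Finset.mem_Icc, ← abs_le] at hk
        exact not_le.mp hk
  -- Sequences in V are determined by their values on [-N, N]; a left inverse of this evaluation map
  -- sends the unit vectors to the required family.
  have := LinearMap.exists_leftInverse_of_injective (K := ℂ) (V := V) (V' := (Finset.Icc (-N) N) × Fin r → ℂ) L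
  obtain ⟨M, hM⟩ := this hL
  refine ⟨fun p => (M (Pi.single p 1) : FinSeq (Fin r) (Fin 1)), fun p => (M _).2, fun u hu => ?_⟩
  have h1 : M (L ⟨u, hu⟩) = ⟨u, hu⟩ := LinearMap.congr_fun hM _
  have h2 : L ⟨u, hu⟩ = ∑ p, u p.1 p.2 0 • (Pi.single p 1 : (Finset.Icc (-N) N) × Fin r → ℂ) := by
    ext q
    rw [Finset.sum_apply]
    simp only [Pi.smul_apply, Pi.single_apply, smul_eq_mul, mul_ite, mul_one, mul_zero,
      Finset.sum_ite_eq, Finset.mem_univ, if_true]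
    rfl
  rw [h2, map_sum] at h1
  have h3 := congrArg Subtype.val h1
  simp only [map_smul] at h3
  rw [AddSubmonoidClass.coe_finsetSum] at h3
  exact h3.symm

lemma norm_fconv_le_of_representation {ι : Type*} [Fintype ι] {x : FinSeq (Fin r) (Fin r)}
    {c : ι → ℂ} {f : ι → FinSeq (Fin r) (Fin 1)} {B C : ℝ} (hB : 0 ≤ B) (hc : ∀ p, ‖c p‖ ≤ B)
    (k : ℤ) (i : Fin r) (hC : ∀ p, ‖fconv x (f p) k i 0‖ ≤ C) :
    ‖fconv x (∑ p, c p • f p) k i 0‖ ≤ Fintype.card ι * (B * C) := by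
  rw [fconv_sum, Finsupp.finsetSum_apply, Matrix.sum_apply]
  have : ∀ p ∈ (Finset.univ : Finset ι), ‖fconv x (c p • f p) k i 0‖ ≤ B * C := fun p _ => by
    rw [fconv_smul, Finsupp.smul_apply, Matrix.smul_apply, norm_smul]
    exact mul_le_mul (hc p) (hC p) (norm_nonneg _) hB
  refine (norm_sum_le_of_le _ this).trans ?_
  rw [Finset.sum_const, nsmul_eq_mul, Finset.card_univ]

lemma exists_bound_apply (c : FinSeq σ τ) (i : σ) (j : τ) : ∃ B : ℝ, 0 ≤ B ∧ ∀ k, ‖c k i j‖ ≤ B := by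
  refine ⟨∑ k ∈ c.support, ‖c k i j‖, Finset.sum_nonneg fun _ _ => norm_nonneg _, fun k => ?_⟩
  by_cases hk : k ∈ c.support
  · exact Finset.single_le_sum (f := fun k => ‖c k i j‖) (fun _ _ => norm_nonneg _) hk
  · rw [Finsupp.notMem_support_iff.mp hk]
    simpa using Finset.sum_nonneg fun _ _ => norm_nonneg _

lemma exists_bound_fconv {ι : Type*} [Fintype ι] (a : FinSeq (Fin r) (Fin r))
    (f : ι → FinSeq (Fin r) (Fin 1)) (n : ℕ) :
    ∃ C : ℝ, 0 ≤ C ∧ ∀ s < n, ∀ p k i, ‖fconv (iterMask a s) (f p) k i 0‖ ≤ C := by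
  have h : ∀ q : Fin n × ι × Fin r, ∃ B : ℝ, 0 ≤ B ∧
      ∀ k, ‖fconv (iterMask a q.1) (f q.2.1) k q.2.2 0‖ ≤ B := fun q => exists_bound_apply _ _ _
  choose B hB0 hB using h
  refine ⟨∑ q, B q, Finset.sum_nonneg fun q _ => hB0 q, fun s hs p k i => ?_⟩
  exact (hB (⟨s, hs⟩, p, i) k).trans
    (Finset.single_le_sum (f := B) (fun q _ => hB0 q) (Finset.mem_univ _))

/-- On a finite-dimensional invariant space decay is automatically exponential: one n₀ works for a
finite representing family, and then each block of n₀ steps halves the bound for every member of the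
space. Since the coefficients in the representation are values of u, the constant depends on u only
through its sup norm B. The Hölder estimate needs this uniformity for a whole family of sequences.
-/
theorem exists_decay_rate_of_supportedIn (a : FinSeq (Fin r) (Fin r)) {l : ℝ} (hl : 0 < l) {N : ℤ}
    (ha : SupportedIn N a) :
    ∃ τ > 0, ∀ M, M = N + 1 → ∃ C ≥ 0, ∀ u, SupportedIn M u → Decays a l u → ∀ B, 0 ≤ B →
      (∀ k i, ‖u k i 0‖ ≤ B) → ∀ n k i,
        l ^ n * ‖fconv (iterMask a n) u k i 0‖ ≤ C * B * (2 : ℝ) ^ (-(τ * (n : ℝ))) := by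
  obtain ⟨M, rfl⟩ : ∃ M, M = N + 1 := ⟨_, rfl⟩
  obtain ⟨f, hfX, hf⟩ := exists_representation (decaySubmodule a l hl (N + 1)) fun u hu => hu.1
  obtain ⟨K, hK⟩ : ∃ K : ℝ, K = Fintype.card ((Finset.Icc (-(N + 1)) (N + 1)) × Fin r) := ⟨_, rfl⟩
  have hK0 : 0 ≤ K := hK ▸ Nat.cast_nonneg _
  -- contraction after finitely many steps
  obtain ⟨n₀, hn₀1, hn₀⟩ : ∃ n₀ : ℕ, 1 ≤ n₀ ∧ ∀ p k i,
      l ^ n₀ * ‖fconv (iterMask a n₀) (f p) k i 0‖ ≤ (2 * (K + 1))⁻¹ := by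
    have h1 : ∀ᶠ n : ℕ in atTop, ∀ p k i,
        l ^ n * ‖fconv (iterMask a n) (f p) k i 0‖ ≤ (2 * (K + 1))⁻¹ :=
      eventually_all.mpr fun p => (hfX p).2 _ (by positivity)
    obtain ⟨n₀, h2, h3⟩ := (h1.and (eventually_ge_atTop 1)).exists
    exact ⟨n₀, h3, h2⟩
  obtain ⟨C₀, hC₀, hC₀'⟩ := exists_bound_fconv a f n₀
  obtain ⟨Λ, hΛ⟩ : ∃ Λ : ℝ, Λ = ∑ s ∈ Finset.range n₀, l ^ s := ⟨_, rfl⟩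
  have hΛs : ∀ s < n₀, l ^ s ≤ Λ := fun s hs => hΛ ▸
    Finset.single_le_sum (f := fun s => l ^ s) (fun _ _ => by positivity) (Finset.mem_range.mpr hs)
  have hΛ0 : 0 ≤ Λ := hΛ ▸ Finset.sum_nonneg fun _ _ => by positivity
  have hX : ∀ u ∈ (decaySubmodule a l hl (N + 1) : Set (FinSeq (Fin r) (Fin 1))), ∀ γ : ℤ,
      γ = 0 ∨ γ = 1 → transition a γ u ∈
        (decaySubmodule a l hl (N + 1) : Set (FinSeq (Fin r) (Fin 1))) := fun u hu γ hγ =>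
    ⟨(ha.transition hu.1 hγ).mono (by omega), hu.2.transition hl γ⟩
  have hmain : ∀ n, ∀ u ∈ decaySubmodule a l hl (N + 1), ∀ B, 0 ≤ B → (∀ k i, ‖u k i 0‖ ≤ B) →
      ∀ k i, l ^ n * ‖fconv (iterMask a n) u k i 0‖ ≤ Λ * (K * C₀) * B * (1 / 2) ^ (n / n₀) := by
    intro n
    induction n using Nat.strong_induction_on with
    | _ n ih =>
      intro u hu B hB huB k i
      rcases lt_or_ge n n₀ with hn | hn
      · rw [Nat.div_eq_of_lt hn, pow_zero, mul_one]
        have h1 := norm_fconv_le_of_representation (x := iterMask a n) (f := f)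
          (c := fun p => u p.1 p.2 0) hB (fun p => huB _ _) k i fun p => hC₀' n hn p k i
        rw [← hf u hu, ← hK] at h1
        calc _ ≤ Λ * (K * (B * C₀)) := by
              gcongr
              · exact hΛs n hn
          _ = _ := by ring
      · obtain ⟨n', rfl⟩ : ∃ n', n = n' + n₀ := ⟨n - n₀, by omega⟩
        obtain ⟨u', hu', ⟨q, hq⟩, h2⟩ := exists_fconv_iterMask_add hX n₀ u hu k
        -- There are K summands, each at most `B / (2 * (K + 1) * l ^ n₀)`, so the total stays below
        -- `B / (2 * l ^ n₀)`. The factor `l ^ n₀` is recovered from `l ^ n`, and a gain of 1/2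
        -- remains.
        have hB' : ∀ k i, ‖u' k i 0‖ ≤ B / (2 * l ^ n₀) := by
          intro k' i'
          obtain ⟨k'', hk''⟩ := h2 k'
          rw [hk'', le_div_iff₀ (by positivity)]
          have h1 := norm_fconv_le_of_representation (x := iterMask a n₀) (f := f)
            (c := fun p => u p.1 p.2 0) (C := (2 * (K + 1))⁻¹ / l ^ n₀) hB (fun p => huB _ _) k'' i'
            fun p => by
              rw [le_div_iff₀ (by positivity), mul_comm]
              exact hn₀ p k'' i'
          rw [← hf u hu, ← hK] at h1
          have h4 : (0 : ℝ) < l ^ n₀ := by positivity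
          calc _ ≤ K * (B * ((2 * (K + 1))⁻¹ / l ^ n₀)) * (2 * l ^ n₀) := by gcongr
            _ = B * (K / (K + 1)) := by field_simp
            _ ≤ B * 1 := by
              gcongr
              rw [div_le_one (by positivity)]; linarith
            _ = B := mul_one B
        have h5 := ih n' (by omega) u' hu' (B / (2 * l ^ n₀)) (by positivity) hB' q i
        rw [hq n', Nat.add_div_right _ hn₀1, pow_add, pow_succ]
        have h4 : (0 : ℝ) < l ^ n₀ := by positivity
        calc l ^ n' * l ^ n₀ * ‖fconv (iterMask a n') u' q i 0‖ =
              l ^ n₀ * (l ^ n' * ‖fconv (iterMask a n') u' q i 0‖) := by ring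
          _ ≤ l ^ n₀ * (Λ * (K * C₀) * (B / (2 * l ^ n₀)) * (1 / 2) ^ (n' / n₀)) := by gcongr
          _ = _ := by field_simp
  -- One halving per n₀ steps is the rate 2^{-n/n₀}; the rounding in `n / n₀` costs the factor 2.
  refine ⟨1 / n₀, by positivity, fun M hM => ⟨Λ * (K * C₀) * 2, by positivity, ?_⟩⟩
  subst hM
  intro u hu hu' B hB huB n k i
  refine (hmain n u ⟨hu, hu'⟩ B hB huB k i).trans ?_
  have hpow : ((1 : ℝ) / 2) ^ (n / n₀) ≤ 2 * (2 : ℝ) ^ (-(1 / (n₀ : ℝ) * n)) := by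
    have e1 : ((1 : ℝ) / 2) ^ (n / n₀) = (2 : ℝ) ^ (-((n / n₀ : ℕ) : ℝ)) := by
      rw [Real.rpow_neg (by norm_num), Real.rpow_natCast, one_div, inv_pow]
    have e2 : 2 * (2 : ℝ) ^ (-(1 / (n₀ : ℝ) * n)) = (2 : ℝ) ^ (1 + -(1 / (n₀ : ℝ) * n)) := by
      rw [Real.rpow_add (by norm_num), Real.rpow_one]
    rw [e1, e2]
    apply Real.rpow_le_rpow_of_exponent_le (by norm_num)
    have h6 : (n : ℝ) ≤ n₀ * ((n / n₀ : ℕ) + 1) := by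
      exact_mod_cast (Nat.lt_mul_div_succ n (by omega)).le
    have h7 : (0 : ℝ) < n₀ := by exact_mod_cast hn₀1
    have h8 : 1 / (n₀ : ℝ) * n ≤ (n / n₀ : ℕ) + 1 := by
      rw [one_div, inv_mul_le_iff₀ h7]; exact h6
    linarith
  calc _ ≤ Λ * (K * C₀) * B * (2 * (2 : ℝ) ^ (-(1 / (n₀ : ℝ) * n))) := by gcongr
    _ = _ := by ring

/-- A common exponential rate for all decaying sequences. -/
theorem exists_decay_rate (a : FinSeq (Fin r) (Fin r)) {l : ℝ} (hl : 0 < l) :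
    ∃ τ > 0, ∀ u, Decays a l u → ∃ C ≥ 0, ∀ n k i,
      l ^ n * ‖fconv (iterMask a n) u k i 0‖ ≤ C * (2 : ℝ) ^ (-(τ * (n : ℝ))) := by
  obtain ⟨N, ha⟩ := exists_supportedIn a
  obtain ⟨τ, hτ, h⟩ := exists_decay_rate_of_supportedIn a hl ha
  obtain ⟨C₀, hC₀, h⟩ := h _ rfl
  refine ⟨τ, hτ, ?_⟩
  -- Induction on the excess d of the support over the invariant radius N + 1: a transition reduces
  -- the excess, at the price of one step of the iteration.
  have key : ∀ d : ℕ, ∀ u, SupportedIn (N + 1 + d) u → Decays a l u → ∃ C ≥ 0, ∀ n k i,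
      l ^ n * ‖fconv (iterMask a n) u k i 0‖ ≤ C * (2 : ℝ) ^ (-(τ * (n : ℝ))) := by
    intro d
    induction d with
    | zero =>
      intro u hu hu'
      choose B hB0 hB using fun i => exists_bound_apply u i 0
      refine ⟨C₀ * ∑ i, B i, mul_nonneg hC₀ (Finset.sum_nonneg fun i _ => hB0 i), ?_⟩
      exact h u (by simpa using hu) hu' _ (Finset.sum_nonneg fun i _ => hB0 i) fun k i =>
        (hB i k).trans (Finset.single_le_sum (f := B) (fun q _ => hB0 q) (Finset.mem_univ _))
    | succ d ih =>
      intro u hu hu'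
      have hT : ∀ γ : ℤ, γ = 0 ∨ γ = 1 → ∃ C ≥ 0, ∀ n k i,
          l ^ n * ‖fconv (iterMask a n) (transition a γ u) k i 0‖ ≤
            C * (2 : ℝ) ^ (-(τ * (n : ℝ))) := fun γ hγ =>
        ih _ ((ha.transition hu hγ).mono (by push_cast; omega)) (hu'.transition hl γ)
      obtain ⟨C1, hC1, h1⟩ := hT 0 (Or.inl rfl)
      obtain ⟨C2, hC2, h2⟩ := hT 1 (Or.inr rfl)
      choose B hB0 hB using fun i => exists_bound_apply u i 0
      have hB' : 0 ≤ ∑ i, B i := Finset.sum_nonneg fun i _ => hB0 i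
      -- The first summand serves n = 0; the second is the bound for the two transitions, with `l *
      -- 2 ^ τ` for the lost step.
      refine ⟨∑ i, B i + l * (C1 + C2) * (2 : ℝ) ^ τ, by positivity, fun n k i => ?_⟩
      rcases n with _ | n
      · rw [fconv_iterMask_zero]
        simp only [pow_zero, one_mul, Nat.cast_zero, mul_zero, neg_zero, Real.rpow_zero, mul_one]
        have : ‖u k i 0‖ ≤ ∑ i, B i := (hB i k).trans
          (Finset.single_le_sum (f := B) (fun q _ => hB0 q) (Finset.mem_univ _))
        have h3 : 0 ≤ l * (C1 + C2) * (2 : ℝ) ^ τ := by positivity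
        linarith
      · have e : (2 : ℝ) ^ (-(τ * (n : ℝ))) = (2 : ℝ) ^ τ * (2 : ℝ) ^ (-(τ * ((n + 1 : ℕ) : ℝ))) := by
          rw [← Real.rpow_add (by norm_num)]; congr 1; push_cast; ring
        have hstep : ∀ γ k', (γ = 0 ∨ γ = 1) →
            l ^ n * ‖fconv (iterMask a n) (transition a γ u) k' i 0‖ ≤
              (C1 + C2) * (2 : ℝ) ^ (-(τ * (n : ℝ))) := by
          rintro γ k' (rfl | rfl)
          · refine (h1 n k' i).trans ?_
            gcongr; linarith
          · refine (h2 n k' i).trans ?_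
            gcongr; linarith
        obtain ⟨γ, q, hγ, rfl⟩ := exists_eq_bit_add_two_mul k
        rw [fconv_iterMask_succ, pow_succ', mul_assoc]
        calc _ ≤ l * ((C1 + C2) * (2 : ℝ) ^ (-(τ * (n : ℝ)))) :=
              mul_le_mul_of_nonneg_left (hstep γ q hγ) hl.le
          _ = (l * (C1 + C2) * (2 : ℝ) ^ τ) * (2 : ℝ) ^ (-(τ * ((n + 1 : ℕ) : ℝ))) := by
            rw [e]; ring
          _ ≤ _ := by gcongr; linarith
  intro u hu
  obtain ⟨M, hM⟩ := exists_supportedIn u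
  exact key M u (hM.mono (by omega)) hu

/-! ### Vanishing orders -/

lemma mul_mul_apply_zero (V : Matrix (Fin 1) (Fin r) (PowerSeries ℂ))
    (U : Matrix (Fin r) (Fin 1) (PowerSeries ℂ)) (S : Matrix (Fin 1) (Fin 1) (PowerSeries ℂ)) :
    (V * (U * S)) 0 0 = (V * U) 0 0 * S 0 0 := by
  rw [← Matrix.mul_assoc, Matrix.mul_apply]
  simp

/-- Scalar sequences whose symbol vanishes to order exactly `d`. -/
lemma exists_scalar_order (d : ℕ) : ∃ (s : FinSeq (Fin 1) (Fin 1)) (G : PowerSeries ℂ),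
    constantCoeff G ≠ 0 ∧ symbolSeries s 0 0 = (X : PowerSeries ℂ) ^ d * G := by
  induction d with
  | zero =>
    refine ⟨Finsupp.single 0 1, 1, by simp, ?_⟩
    rw [symbolSeries_single_zero]; simp
  | succ d ih =>
    obtain ⟨s, G, hG, hs⟩ := ih
    set D : FinSeq (Fin 1) (Fin 1) := Finsupp.single 0 1 - Finsupp.single 1 1 with hD
    have h0 : symbol D 0 0 0 = 0 := by rw [hD, symbol_sub]; simp
    have h1 : coeff 1 (symbolSeries D 0 0) = Complex.I := by
      rw [hD, symbolSeries_sub, symbolSeries_single_zero, Matrix.sub_apply, map_sub,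
        coeff_symbolSeries, Finset.sum_subset (Finsupp.support_single_subset) fun k _ hk => by
          rw [Finsupp.notMem_support_iff.mp hk]; simp]
      simp [coeff_one]
    obtain ⟨H, hH⟩ : X ∣ symbolSeries D 0 0 := by
      rw [X_dvd_iff, constantCoeff_symbolSeries, h0]
    refine ⟨fconv s D, G * H, ?_, ?_⟩
    · rw [map_mul]
      refine mul_ne_zero hG ?_
      rw [hH, show (1 : ℕ) = 0 + 1 from rfl, coeff_succ_X_mul, coeff_zero_eq_constantCoeff] at h1
      rw [h1]; exact Complex.I_ne_zero
    · rw [symbolSeries_fconv, Matrix.mul_apply]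
      simp only [Finset.univ_unique, Fin.default_eq_zero, Fin.isValue, Finset.sum_singleton]
      rw [hs, hH]; ring

/-- The sequence `δ e_y`. -/
def diracCol (y : Fin r) : FinSeq (Fin r) (Fin 1) :=
  Finsupp.single 0 (Matrix.of fun i _ => if i = y then 1 else 0)

lemma symbolSeries_mul_diracCol (V : FinSeq (Fin 1) (Fin r)) (y : Fin r) :
    (symbolSeries V * symbolSeries (diracCol y)) 0 0 = symbolSeries V 0 y := by
  have h : symbolSeries (diracCol y) = Matrix.of fun i (_ : Fin 1) => if i = y then 1 else 0 := by
    ext i j k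
    have h : (fun ξ => symbol (diracCol y) ξ i j) = fun _ => if i = y then (1 : ℂ) else 0 := by
      ext ξ; rw [diracCol, symbol_single]; simp
    rw [symbolSeries, taylorMatrix_apply, h, coeff_taylor, iteratedDeriv_const]
    by_cases h1 : i = y <;> by_cases h2 : k = 0 <;> simp [h1, h2, coeff_one]
  rw [h, Matrix.mul_apply]
  simp

lemma exists_symbol_ne_zero {v : FinSeq (Fin 1) (Fin r)} (hv : symbol v 0 ≠ 0) :
    ∃ l, symbol v 0 0 l ≠ 0 := by
  by_contra h
  push Not at h
  apply hv
  ext i l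
  obtain rfl : i = 0 := Subsingleton.elim _ _
  exact h l

lemma X_pow_dvd_of_mul {n : ℕ} {F G : PowerSeries ℂ} (hF : constantCoeff F ≠ 0)
    (h : (X : PowerSeries ℂ) ^ n ∣ F * G) : (X : PowerSeries ℂ) ^ n ∣ G := by
  have hu : IsUnit F := isUnit_iff_constantCoeff.mpr (isUnit_iff_ne_zero.mpr hF)
  exact (hu.dvd_mul_left).mp h

/-- For any u the sequence u * w_y - δ e_y * (w * u) is annihilated by w exactly, so it lies in the
space on the left. Membership in the space on the right says (v̂ û) ŵ_y ≡ v̂_y (ŵ û) modulo X^M,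
that is, v̂ is proportional to ŵ up to order M. With ŵ_y(0) ≠ 0 also v̂_y(0) ≠ 0, so both factors
are units. This links the given filter v to the filter w that computes the exponent. -/
lemma le_of_vanishingSpace_subset {v w : FinSeq (Fin 1) (Fin r)} (hv : symbol v 0 ≠ 0)
    (hw : symbol w 0 ≠ 0) {J M : ℕ} (hM : 1 ≤ M) (h : vanishingSpace J w ⊆ vanishingSpace M v) :
    M ≤ J ∧ ∀ j ≤ M, vanishingSpace j v ⊆ vanishingSpace j w := by
  obtain ⟨y, hy⟩ := exists_symbol_ne_zero hw
  have hWE : constantCoeff (symbolSeries w 0 y) ≠ 0 := by rwa [constantCoeff_symbolSeries]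
  have key : ∀ u : FinSeq (Fin r) (Fin 1), (X : PowerSeries ℂ) ^ M ∣
      (symbolSeries v * symbolSeries u) 0 0 * symbolSeries w 0 y -
        symbolSeries v 0 y * (symbolSeries w * symbolSeries u) 0 0 := by
    intro u
    have hexp : ∀ z : FinSeq (Fin 1) (Fin r), (symbolSeries z * symbolSeries
        (fconv u (fconv w (diracCol y)) - fconv (diracCol y) (fconv w u))) 0 0 =
        (symbolSeries z * symbolSeries u) 0 0 * symbolSeries w 0 y -
          symbolSeries z 0 y * (symbolSeries w * symbolSeries u) 0 0 := by
      intro z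
      rw [symbolSeries_sub, Matrix.mul_sub, Matrix.sub_apply, symbolSeries_fconv,
        mul_mul_apply_zero, symbolSeries_fconv, symbolSeries_mul_diracCol, symbolSeries_fconv,
        mul_mul_apply_zero, symbolSeries_mul_diracCol, symbolSeries_fconv]
    have h1 := h (a := fconv u (fconv w (diracCol y)) - fconv (diracCol y) (fconv w u)) (by
      rw [mem_vanishingSpace_iff, hexp w, mul_comm, sub_self]
      exact dvd_zero _)
    rwa [mem_vanishingSpace_iff, hexp] at h1
  have hVE : constantCoeff (symbolSeries v 0 y) ≠ 0 := by
    intro h0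
    obtain ⟨l, hl⟩ := exists_symbol_ne_zero hv
    have h1 := (dvd_pow_self (X : PowerSeries ℂ) (by omega : M ≠ 0)).trans (key (diracCol l))
    rw [X_dvd_iff, map_sub, map_mul, map_mul, h0, zero_mul, sub_zero, symbolSeries_mul_diracCol,
      constantCoeff_symbolSeries] at h1
    exact (mul_ne_zero hl hWE) h1
  constructor
  -- A scalar sequence of exact order J, placed in the entry y, lies in the space of w; against v it
  -- also vanishes to order exactly J, since v̂_y(0) ≠ 0.
  · obtain ⟨s, G, hG, hs⟩ := exists_scalar_order J
    have h1 := h (a := fconv (diracCol y) s) (by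
      rw [mem_vanishingSpace_iff, symbolSeries_fconv, mul_mul_apply_zero, hs]
      exact (dvd_mul_right _ G).mul_left _)
    rw [mem_vanishingSpace_iff, symbolSeries_fconv, mul_mul_apply_zero, hs,
      symbolSeries_mul_diracCol] at h1
    have h2 := X_pow_dvd_of_mul hVE h1
    rw [mul_comm] at h2
    have h3 := X_pow_dvd_of_mul hG h2
    exact (pow_dvd_pow_iff X_ne_zero X_prime.not_isUnit).mp h3
  · intro j hj u hu
    rw [mem_vanishingSpace_iff] at hu ⊢
    refine X_pow_dvd_of_mul hVE ?_
    have h1 := (pow_dvd_pow (X : PowerSeries ℂ) hj).trans (key u)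
    exact (dvd_sub_right (hu.mul_right _)).mp h1

/-! ### The order of sum rules is bounded -/

lemma taylor_expChar_zero : taylor (expChar 0) = 1 := by
  ext n
  have : expChar 0 = fun _ => 1 := funext expChar_zero_left
  rw [coeff_taylor, this, iteratedDeriv_const, coeff_one]
  split_ifs with h
  · simp [h]
  · simp

/-- For γ = 0 the character is 1, so the Taylor functionals of v̂ û are eigenvectors of the dual of
T_0 for the eigenvalues 2^{-d}. -/
lemma HasSumRules.coeff_transition {a : FinSeq (Fin r) (Fin r)} {n : ℕ}
    {v : FinSeq (Fin 1) (Fin r)} (h : HasSumRules a n v) (u : FinSeq (Fin r) (Fin 1)) {d : ℕ}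
    (hd : d < n) : (2 : ℂ) ^ d * coeff d ((symbolSeries v * symbolSeries (transition a 0 u)) 0 0) =
      coeff d ((symbolSeries v * symbolSeries u) 0 0) := by
  obtain ⟨R, hR⟩ := h.exists_series_transition 0 u
  rw [neg_zero, taylor_expChar_zero, one_mul] at hR
  have := congrArg (coeff d) hR
  rwa [coeff_rescale, map_add, coeff_X_pow_mul', if_neg (not_le.mpr hd), add_zero] at this

/-- The space of sequences supported in `[-N, N]`. -/
def supportedSubmodule (r : ℕ) (N : ℤ) : Submodule ℂ (FinSeq (Fin r) (Fin 1)) where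
  carrier := {u | SupportedIn N u}
  zero_mem' := fun _ _ => rfl
  add_mem' := fun {u w} hu hw k hk => by rw [Finsupp.add_apply, hu k hk, hw k hk, add_zero]
  smul_mem' := fun z u hu k hk => by rw [Finsupp.smul_apply, hu k hk, smul_zero]

/-- The functional sending `u` to the Taylor coefficient of order `d` of `v̂ û`. -/
def coeffFunctional (v : FinSeq (Fin 1) (Fin r)) (d : ℕ) : FinSeq (Fin r) (Fin 1) →ₗ[ℂ] ℂ where
  toFun u := coeff d ((symbolSeries v * symbolSeries u) 0 0)
  map_add' u w := by
    rw [symbolSeries_add, Matrix.mul_add, Matrix.add_apply, map_add]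
  map_smul' z u := by
    rw [symbolSeries_smul, Matrix.mul_smul, Matrix.smul_apply, coeff_smul]
    simp

/-- Sum rules of order n give n eigenvectors of the dual of T_0 with the distinct eigenvalues
2^{-d}, d < n, on a space whose dimension depends only on the mask. The resulting bound makes the
supremum in `sr` meaningful: `sSup` of an unbounded set in ℕ would be 0. -/
lemma HasSumRules.le_finrank {a : FinSeq (Fin r) (Fin r)} {N n : ℕ} (ha : SupportedIn N a)
    {v : FinSeq (Fin 1) (Fin r)} (h : HasSumRules a n v) :
    n ≤ Fintype.card ((Finset.Icc (-((N : ℤ) + 1)) (N + 1)) × Fin r) := by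
  obtain ⟨f, hf, hrep⟩ := exists_representation (supportedSubmodule r (N + 1)) fun u hu => hu
  let T : Module.End ℂ (supportedSubmodule r (N + 1)) :=
    (transitionₗ a 0).restrict fun u hu => (ha.transition hu (Or.inl rfl)).mono (by omega)
  let L : Fin n → Module.Dual ℂ (supportedSubmodule r (N + 1)) := fun d =>
    (coeffFunctional v d).comp (supportedSubmodule r (N + 1)).subtype
  have hL : ∀ d : Fin n, Module.End.HasEigenvector (T.dualMap : Module.End ℂ (Module.Dual ℂ _))
      (((2 : ℂ) ^ (d : ℕ))⁻¹) (L d) := by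
    intro d
    have h2 : ((2 : ℂ) ^ (d : ℕ)) ≠ 0 := pow_ne_zero _ two_ne_zero
    refine ⟨Module.End.mem_eigenspace_iff.mpr ?_, ?_⟩
    · ext u
      have := h.coeff_transition u.1 d.2
      change coeff d ((symbolSeries v * symbolSeries (transition a 0 u.1)) 0 0) =
        ((2 : ℂ) ^ (d : ℕ))⁻¹ * coeff d ((symbolSeries v * symbolSeries u.1) 0 0)
      rw [← this, inv_mul_cancel_left₀ h2]
    · intro h0
      -- If the functional vanished on the invariant space, it would vanish on all sequences, since
      -- T_0 shrinks supports and only rescales the functional; a sequence of exact order d excludes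
      -- this.
      have key : ∀ e : ℕ, ∀ u : FinSeq (Fin r) (Fin 1), SupportedIn (N + 1 + e) u →
          coeff (d : ℕ) ((symbolSeries v * symbolSeries u) 0 0) = 0 := by
        intro e
        induction e with
        | zero =>
          intro u hu
          exact LinearMap.congr_fun h0 ⟨u, hu.mono (by simp)⟩
        | succ e ih =>
          intro u hu
          rw [← h.coeff_transition u d.2, ih _
            ((ha.transition hu (Or.inl rfl)).mono (by push_cast; omega)), mul_zero]
      obtain ⟨y, hy⟩ := exists_symbol_ne_zero h.1.1
      obtain ⟨s, G, hG, hs⟩ := exists_scalar_order (d : ℕ)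
      obtain ⟨M, hM⟩ := exists_supportedIn (fconv (diracCol y) s)
      have h1 := key M _ (hM.mono (by omega))
      rw [symbolSeries_fconv, mul_mul_apply_zero, hs, symbolSeries_mul_diracCol, mul_left_comm,
        coeff_X_pow_mul', if_pos le_rfl, Nat.sub_self, coeff_zero_eq_constantCoeff_apply, map_mul,
        constantCoeff_symbolSeries] at h1
      exact (mul_ne_zero hy hG) h1
  have hinj : Function.Injective fun d : Fin n => ((2 : ℂ) ^ (d : ℕ))⁻¹ := by
    intro d e hde
    have h1 : ((2 : ℕ) : ℂ) ^ (d : ℕ) = ((2 : ℕ) : ℂ) ^ (e : ℕ) := by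
      simpa using inv_injective hde
    exact Fin.ext (Nat.pow_right_injective le_rfl (by exact_mod_cast h1))
  have hli := Module.End.eigenvectors_linearIndependent' _ _ hinj L hL
  let ev : Module.Dual ℂ (supportedSubmodule r (N + 1)) →ₗ[ℂ]
      ((Finset.Icc (-((N : ℤ) + 1)) (N + 1)) × Fin r → ℂ) :=
    LinearMap.pi fun p => LinearMap.applyₗ ⟨f p, hf p⟩
  have hev : LinearMap.ker ev = ⊥ := by
    rw [LinearMap.ker_eq_bot']
    intro ψ hψ
    ext u
    have h1 : u = ∑ p, u.1 p.1 p.2 0 • (⟨f p, hf p⟩ : supportedSubmodule r (N + 1)) := by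
      apply Subtype.ext
      rw [AddSubmonoidClass.coe_finsetSum]
      exact hrep u.1 u.2
    rw [h1, map_sum]
    refine Finset.sum_eq_zero fun p _ => ?_
    rw [map_smul, show ψ ⟨f p, hf p⟩ = 0 from congrFun hψ p, smul_zero]
  have := (hli.map' ev hev).fintype_card_le_finrank
  rwa [Fintype.card_fin, Module.finrank_fintype_fun_eq_card] at this

lemma bddAbove_sumRules (a : FinSeq (Fin r) (Fin r)) :
    BddAbove {n : ℕ | ∃ v : FinSeq (Fin 1) (Fin r), HasSumRules a n v} := by
  obtain ⟨N, ha⟩ := exists_supportedIn a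
  exact ⟨_, fun n ⟨v, hv⟩ => hv.le_finrank ha⟩

/-! ### Decay and vanishing orders -/

/-- By the moment identity the coefficient equals, for every n, a fixed combination of 2^{dn} times
moments of A_n * u. The moments average over O(2^n) points with weight 2^{-n}, so 2^{dn} times them
tends to zero with 2^{dn} A_n * u. -/
lemma Decays.coeff_eq_zero {a : FinSeq (Fin r) (Fin r)} {N d : ℕ} {v : FinSeq (Fin 1) (Fin r)}
    (hv : IsMatchingFilter a N v) (hd : d < N) {u : FinSeq (Fin r) (Fin 1)}
    (hu : Decays a ((2 : ℝ) ^ d) u) : coeff d ((symbolSeries v * symbolSeries u) 0 0) = 0 := by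
  obtain ⟨Na, hNa⟩ := exists_supportedIn a
  obtain ⟨Nu, hNu⟩ := exists_supportedIn u
  have hbox := fun n k => fconv_iterMask_eq_zero hNa hNu n k
  set L := Na + Nu + 1
  have hmom : ∀ (q : ℕ) (j : Fin r), Tendsto (fun n : ℕ => ((2 : ℂ) ^ n) ^ d *
      moment n q (fconv (iterMask a n) u) j 0) atTop (𝓝 0) := by
    intro q j
    rw [Metric.tendsto_atTop']
    intro ε hε
    obtain ⟨n₀, hn₀⟩ := (hu (ε / (2 * (2 * L * L ^ q + 1))) (by positivity)).exists_forall_of_atTop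
    refine ⟨n₀, fun n hn => ?_⟩
    have h2 : (0 : ℝ) < (2 ^ n) ^ d := by positivity
    have h1 := norm_moment_le (hbox n) q j 0
      (B := ε / (2 * (2 * L * L ^ q + 1)) / (2 ^ n) ^ d) fun k => by
        rw [le_div_iff₀ h2, mul_comm, ← pow_mul, mul_comm n d, pow_mul]
        exact hn₀ n hn.le k j
    rw [dist_zero_right, norm_mul, norm_pow, norm_pow, Complex.norm_ofNat]
    calc _ ≤ ((2 : ℝ) ^ n) ^ d * (2 * L * L ^ q * (ε / (2 * (2 * L * L ^ q + 1)) / (2 ^ n) ^ d)) := by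
          gcongr
      _ = ε / 2 * ((2 * L * L ^ q) / (2 * L * L ^ q + 1)) := by field_simp
      _ ≤ ε / 2 * 1 := by
        gcongr
        rw [div_le_one (by positivity)]; linarith
      _ < ε := by linarith
  have hsum : Tendsto (fun n : ℕ => ∑ p ∈ Finset.HasAntidiagonal.antidiagonal d, ∑ l,
      coeff p.1 (symbolSeries v 0 l) * (((2 : ℂ) ^ n) ^ d *
        moment n p.2 (fconv (iterMask a n) u) l 0)) atTop (𝓝 0) := by
    have := tendsto_finsetSum (Finset.HasAntidiagonal.antidiagonal d) fun p _ =>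
      tendsto_finsetSum Finset.univ fun l _ =>
        (hmom p.2 l).const_mul (coeff p.1 (symbolSeries v 0 l))
    simpa using this
  refine tendsto_nhds_unique ?_ hsum
  refine tendsto_const_nhds.congr fun n => ?_
  have h2 : ((2 : ℂ) ^ n) ^ d ≠ 0 := pow_ne_zero _ (pow_ne_zero _ two_ne_zero)
  rw [← mul_inv_cancel_left₀ h2 (coeff d ((symbolSeries v * symbolSeries u) 0 0)),
    ← hv.sum_moment u n hd, Finset.mul_sum]
  refine Finset.sum_congr rfl fun p _ => ?_
  rw [Finset.mul_sum]
  exact Finset.sum_congr rfl fun l _ => by ring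

/-- Geometric decay at rate `q`. -/
def GeometricDecay (a : FinSeq (Fin r) (Fin r)) (q : ℝ) (u : FinSeq (Fin r) (Fin 1)) : Prop :=
  ∃ C ≥ 0, ∀ n k i, ‖fconv (iterMask a n) u k i 0‖ ≤ C * q ^ n

lemma GeometricDecay.decays {a : FinSeq (Fin r) (Fin r)} {q l : ℝ} {u : FinSeq (Fin r) (Fin 1)}
    (h : GeometricDecay a q u) (hq : 0 ≤ q) (hl : 0 < l) (hlq : l * q < 1) : Decays a l u := by
  obtain ⟨C, hC, h⟩ := h
  intro ε hε
  have h1 : Tendsto (fun n : ℕ => C * (l * q) ^ n) atTop (𝓝 (C * 0)) :=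
    (tendsto_pow_atTop_nhds_zero_of_lt_one (by positivity) hlq).const_mul C
  rw [mul_zero] at h1
  filter_upwards [h1.eventually (ge_mem_nhds hε)] with n hn k i
  calc _ ≤ l ^ n * (C * q ^ n) := by gcongr; exact h n k i
    _ = C * (l * q) ^ n := by rw [mul_pow]; ring
    _ ≤ ε := hn

lemma GeometricDecay.mono {a : FinSeq (Fin r) (Fin r)} {q q' : ℝ} {u : FinSeq (Fin r) (Fin 1)}
    (h : GeometricDecay a q u) (hq : 0 ≤ q) (hqq' : q ≤ q') : GeometricDecay a q' u := by
  obtain ⟨C, hC, h⟩ := h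
  exact ⟨C, hC, fun n k i => (h n k i).trans (by gcongr)⟩

/-- On `𝒱_{j-1,w}` the transition operators act as `2⁻ʲ` modulo `𝒱_{j,w}`. -/
lemma HasSumRules.transition_sub_mem {a : FinSeq (Fin r) (Fin r)} {J j : ℕ}
    {w : FinSeq (Fin 1) (Fin r)} (h : HasSumRules a J w) (hj : j < J)
    {u : FinSeq (Fin r) (Fin 1)} (hu : u ∈ vanishingSpace j w) (γ : ℤ) :
    transition a γ u - ((2 : ℂ) ^ j)⁻¹ • u ∈ vanishingSpace (j + 1) w := by
  obtain ⟨R, hR⟩ := h.exists_series_transition γ u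
  rw [mem_vanishingSpace_iff] at hu ⊢
  obtain ⟨S, hS⟩ := hu
  rw [symbolSeries_sub, symbolSeries_smul, Matrix.mul_sub, Matrix.sub_apply, Matrix.mul_smul,
    Matrix.smul_apply, X_pow_dvd_iff]
  intro d hd
  have h2 : ∀ d, ((2 : ℂ) ^ d) ≠ 0 := fun d => pow_ne_zero _ two_ne_zero
  have h1 := congrArg (coeff d) hR
  rw [coeff_rescale, hS, mul_left_comm, map_add, coeff_X_pow_mul',
    coeff_X_pow_mul' _ J, if_neg (by omega : ¬ J ≤ d), add_zero] at h1
  rw [map_sub, coeff_smul, hS, coeff_X_pow_mul']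
  rcases Nat.lt_succ_iff_lt_or_eq.mp hd with hd' | rfl
  · rw [if_neg (not_le.mpr hd')] at h1 ⊢
    rw [smul_zero, sub_zero]
    exact (mul_eq_zero.mp h1).resolve_left (h2 d)
  · rw [if_pos le_rfl] at h1 ⊢
    rw [Nat.sub_self, coeff_zero_eq_constantCoeff_apply, map_mul, constantCoeff_taylor,
      expChar_zero_right, one_mul] at h1
    rw [Nat.sub_self, coeff_zero_eq_constantCoeff_apply, ← h1, smul_eq_mul,
      inv_mul_cancel_left₀ (h2 d), sub_self]

/-- Decay on the smallest space spreads to lower vanishing orders. -/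
lemma HasSumRules.geometricDecay {a : FinSeq (Fin r) (Fin r)} {J ν : ℕ}
    {w : FinSeq (Fin 1) (Fin r)} (h : HasSumRules a J w) {Q : ℝ} (hQ : ((2 : ℝ) ^ (ν + 1))⁻¹ < Q)
    (hJ : ∀ u ∈ vanishingSpace J w, GeometricDecay a Q u) (hν : ν + 1 ≤ J)
    {u : FinSeq (Fin r) (Fin 1)} (hu : u ∈ vanishingSpace (ν + 1) w) : GeometricDecay a Q u := by
  -- Downward induction on the vanishing order j. On the space of order j the transitions are 2^{-j}
  -- plus a term of order j + 1, so the norms satisfy b_{n+1} ≤ 2^{-j} b_n + O(Q^n), which stays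
  -- O(Q^n) because 2^{-j} < Q.
  have key : ∀ t j, j + t = J → ν + 1 ≤ j → ∀ u ∈ vanishingSpace j w, GeometricDecay a Q u := by
    intro t
    induction t with
    | zero =>
      intro j hj _ u hu
      rw [add_zero] at hj
      exact hJ u (hj ▸ hu)
    | succ t ih =>
      intro j hj hνj u hu
      have hmem := fun γ => ih (j + 1) (by omega) (by omega) _
        (h.transition_sub_mem (by omega) hu γ)
      obtain ⟨C0, hC0, h0⟩ := hmem 0
      obtain ⟨C1, hC1, h1⟩ := hmem 1
      choose B hB0 hB using fun i => exists_bound_apply u i 0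
      have hB' : 0 ≤ ∑ i, B i := Finset.sum_nonneg fun i _ => hB0 i
      have hjQ : ((2 : ℝ) ^ j)⁻¹ < Q := by
        refine lt_of_le_of_lt ?_ hQ
        gcongr
        norm_num
      have hQ0 : 0 < Q := lt_trans (by positivity) hjQ
      have hgap : 0 < Q - ((2 : ℝ) ^ j)⁻¹ := by linarith
      -- Chosen so that C dominates the initial values and `C0 + C1 ≤ C * (Q - 2⁻ʲ)`; the bound C
      -- Q^n then reproduces itself.
      set C := ∑ i, B i + (C0 + C1) / (Q - ((2 : ℝ) ^ j)⁻¹) with hC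
      have hCge : C0 + C1 ≤ C * (Q - ((2 : ℝ) ^ j)⁻¹) := by
        rw [← div_le_iff₀ hgap, hC]; linarith
      refine ⟨C, by positivity, fun n => ?_⟩
      induction n with
      | zero =>
        intro k i
        rw [fconv_iterMask_zero, pow_zero, mul_one]
        have h3 : ‖u k i 0‖ ≤ ∑ i, B i := (hB i k).trans
          (Finset.single_le_sum (f := B) (fun q _ => hB0 q) (Finset.mem_univ _))
        have h4 : 0 ≤ (C0 + C1) / (Q - ((2 : ℝ) ^ j)⁻¹) := by positivity
        linarith
      | succ n ihn =>
        intro k i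
        obtain ⟨γ, q, hγ, rfl⟩ := exists_eq_bit_add_two_mul k
        have hsplit : fconv (iterMask a n) (transition a γ u) =
            ((2 : ℂ) ^ j)⁻¹ • fconv (iterMask a n) u +
              fconv (iterMask a n) (transition a γ u - ((2 : ℂ) ^ j)⁻¹ • u) := by
          rw [fconv_sub, fconv_smul]; abel
        have hsmall : ‖fconv (iterMask a n) (transition a γ u - ((2 : ℂ) ^ j)⁻¹ • u) q i 0‖ ≤
            (C0 + C1) * Q ^ n := by
          rcases hγ with rfl | rfl
          · refine (h0 n q i).trans ?_
            gcongr; linarith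
          · refine (h1 n q i).trans ?_
            gcongr; linarith
        rw [fconv_iterMask_succ, hsplit, Finsupp.add_apply, Matrix.add_apply, Finsupp.smul_apply,
          Matrix.smul_apply]
        calc _ ≤ ((2 : ℝ) ^ j)⁻¹ * (C * Q ^ n) + (C0 + C1) * Q ^ n := by
              refine (norm_add_le _ _).trans (add_le_add ?_ hsmall)
              rw [norm_smul, norm_inv, norm_pow, Complex.norm_ofNat]
              exact mul_le_mul_of_nonneg_left (ihn q i) (by positivity)
          _ ≤ ((2 : ℝ) ^ j)⁻¹ * (C * Q ^ n) + C * (Q - ((2 : ℝ) ^ j)⁻¹) * Q ^ n := by gcongr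
          _ = C * Q ^ (n + 1) := by ring
  obtain ⟨t, ht⟩ := Nat.exists_eq_add_of_le hν
  exact key t (ν + 1) ht.symm le_rfl u hu

/-! ### Fourier transforms of continuous functions with compact support -/

/-- The Fourier transform `∫ f(x) exp (-i x ξ) dx`. -/
def fourierHat (f : ℝ → ℂ) (ξ : ℝ) : ℂ := ∫ x : ℝ, f x * Complex.exp (-(Complex.I * (ξ : ℂ) * x))

lemma fourier_eq_fourierHat (f : ℝ → ℂ) (x : ℝ) : 𝓕 f x = fourierHat f (2 * Real.pi * x) := by
  rw [Real.fourier_eq', fourierHat]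
  congr 1
  ext y
  rw [smul_eq_mul, mul_comm]
  congr 2
  simp only [RCLike.inner_apply, conj_trivial]
  push_cast; ring

lemma continuous_fourier_of_integrable {f : ℝ → ℂ} (hf : Integrable f) : Continuous (𝓕 f) :=
  VectorFourier.fourierIntegral_continuous Real.continuous_fourierChar continuous_inner hf

lemma integral_fourier_mul {f g : ℝ → ℂ} (hf : Integrable f) (hg : Integrable g) :
    ∫ x, 𝓕 f x * g x = ∫ x, f x * 𝓕 g x := by
  simpa using! VectorFourier.integral_bilin_fourierIntegral_eq_flip (ContinuousLinearMap.mul ℂ ℂ)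
    (L := innerₗ ℝ) Real.continuous_fourierChar continuous_inner hf hg

lemma eq_integral_of_isFourierTransform {T : 𝓢'(ℝ, ℂ)} {F f : ℝ → ℂ} (hT : IsFourierTransform T F)
    (hf : Integrable f) (hF : ∀ ξ, F ξ = fourierHat f ξ) (g : 𝓢(ℝ, ℂ)) :
    T g = ∫ x, g x * f x := by
  obtain ⟨h, hT⟩ := hT
  have h1 : (𝓕 T) (𝓕⁻ g) = T g := by
    rw [TemperedDistribution.fourier_apply, FourierTransform.fourier_fourierInv_eq]
  have h3 : Function.HasTemperateGrowth.toTemperedDistribution volume h (𝓕⁻ g) =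
      ∫ x, (𝓕⁻ g) x * F (2 * Real.pi * x) := rfl
  rw [← h1, hT, h3]
  simp only [hF, ← fourier_eq_fourierHat]
  have h2 := integral_fourier_mul (f := (𝓕⁻ g : 𝓢(ℝ, ℂ))) (g := f) (SchwartzMap.integrable _) hf
  rw [← h2, ← SchwartzMap.fourier_coe, FourierTransform.fourier_fourierInv_eq]

/-- Both sides define the same distribution, hence agree almost everywhere, and everywhere by
continuity. Pointwise equality matters because the normalization of φ̂ is a condition at the single
point 0. -/
lemma isFourierTransform_eq_fourierHat {T : 𝓢'(ℝ, ℂ)} {F f : ℝ → ℂ} (hT : IsFourierTransform T F)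
    (hf : Integrable f) (hTf : ∀ g : 𝓢(ℝ, ℂ), T g = ∫ x, g x * f x) (ξ : ℝ) :
    F ξ = fourierHat f ξ := by
  obtain ⟨h, hT⟩ := hT
  have hc1 : Continuous fun x : ℝ => F (2 * Real.pi * x) := h.1.continuous
  have hc2 := continuous_fourier_of_integrable hf
  have hae : ∀ᵐ x : ℝ, F (2 * Real.pi * x) = 𝓕 f x := by
    refine ae_eq_of_integral_contDiff_smul_eq hc1.locallyIntegrable hc2.locallyIntegrable ?_
    intro g hg hgc
    have hg₁ : HasCompactSupport (Complex.ofRealCLM ∘ g) := hgc.comp_left rfl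
    have hg₂ : ContDiff ℝ ∞ (Complex.ofRealCLM ∘ g) := Complex.ofRealCLM.contDiff.comp hg
    have h1 := congrArg (fun S : 𝓢'(ℝ, ℂ) => S (hg₁.toSchwartzMap hg₂)) hT
    simp only [TemperedDistribution.fourier_apply,
      Function.HasTemperateGrowth.toTemperedDistribution_apply, hTf] at h1
    have h2 := integral_fourier_mul (f := (hg₁.toSchwartzMap hg₂ : 𝓢(ℝ, ℂ))) (g := f)
      (SchwartzMap.integrable _) hf
    rw [← SchwartzMap.fourier_coe, h1] at h2
    simpa using h2
  have heq := Continuous.ae_eq_iff_eq volume hc1 hc2 |>.mp hae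
  have h3 := congrFun heq (ξ / (2 * Real.pi))
  rw [fourier_eq_fourierHat, mul_div_cancel₀ _ (by positivity)] at h3
  exact h3

lemma eq_zero_of_fourierHat_eq_zero {f : ℝ → ℂ} (hfc : Continuous f) (hf : Integrable f)
    (h : ∀ ξ, fourierHat f ξ = 0) (x : ℝ) : f x = 0 := by
  have h0 : 𝓕 f = 0 := by ext x; rw [fourier_eq_fourierHat, h]; rfl
  have h1 := hfc.fourierInv_fourier_eq hf (by rw [h0]; exact integrable_zero _ _ _)
  rw [h0] at h1
  rw [← h1, Real.fourierInv_eq]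
  simp

lemma integrable_mul_exp {f : ℝ → ℂ} (hf : Integrable f) (ξ : ℝ) :
    Integrable fun x : ℝ => f x * Complex.exp (-(Complex.I * (ξ : ℂ) * x)) := by
  refine hf.mul_bdd (c := 1) (by fun_prop) (Eventually.of_forall fun x => ?_)
  rw [show -(Complex.I * (ξ : ℂ) * x) = ((-(ξ * x) : ℝ) : ℂ) * Complex.I by push_cast; ring,
    Complex.norm_exp_ofReal_mul_I]

lemma fourierHat_sub {f g : ℝ → ℂ} (hf : Integrable f) (hg : Integrable g) (ξ : ℝ) :
    fourierHat (fun x => f x - g x) ξ = fourierHat f ξ - fourierHat g ξ := by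
  rw [fourierHat, fourierHat, fourierHat,
    ← integral_sub (integrable_mul_exp hf ξ) (integrable_mul_exp hg ξ)]
  simp only [sub_mul]

lemma fourierHat_sum {ι : Type*} (s : Finset ι) {f : ι → ℝ → ℂ} (hf : ∀ i ∈ s, Integrable (f i))
    (ξ : ℝ) : fourierHat (fun x => ∑ i ∈ s, f i x) ξ = ∑ i ∈ s, fourierHat (f i) ξ := by
  simp only [fourierHat, Finset.sum_mul]
  exact integral_finsetSum s fun i hi => integrable_mul_exp (hf i hi) ξ

lemma fourierHat_const_mul (c : ℂ) (f : ℝ → ℂ) (ξ : ℝ) :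
    fourierHat (fun x => c * f x) ξ = c * fourierHat f ξ := by
  simp only [fourierHat, mul_assoc]
  exact integral_const_mul _ _

lemma fourierHat_comp_two_mul_sub (f : ℝ → ℂ) (k : ℤ) (ξ : ℝ) :
    fourierHat (fun x => f (2 * x - k)) (2 * ξ) = 2⁻¹ * (expChar k ξ * fourierHat f ξ) := by
  have h1 : (fun x : ℝ => f (2 * x - k) * Complex.exp (-(Complex.I * ((2 * ξ : ℝ) : ℂ) * x))) =
      fun x : ℝ => (fun y : ℝ => f (y - k) * Complex.exp (-(Complex.I * (ξ : ℂ) * y))) (2 * x) := by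
    ext x
    push_cast
    congr 2
    ring
  rw [fourierHat, h1, Measure.integral_comp_mul_left
    (fun y : ℝ => f (y - k) * Complex.exp (-(Complex.I * (ξ : ℂ) * y))), abs_inv, abs_two]
  have h2 : ∫ y : ℝ, f (y - k) * Complex.exp (-(Complex.I * (ξ : ℂ) * y)) =
      ∫ y : ℝ, f y * Complex.exp (-(Complex.I * (ξ : ℂ) * ((y + k : ℝ) : ℂ))) := by
    rw [← integral_add_right_eq_self _ (k : ℝ)]
    congr 1
    ext y
    rw [add_sub_cancel_right]
  rw [h2, fourierHat, ← integral_const_mul, ← integral_const_mul, Complex.real_smul,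
    ← integral_const_mul]
  congr 1
  ext y
  rw [expChar, mul_left_comm (Complex.exp _), ← Complex.exp_add]
  push_cast
  congr 3
  ring

lemma fourierHat_zero (f : ℝ → ℂ) : fourierHat f 0 = ∫ x, f x := by
  simp [fourierHat]

/-! ### Refinement in the time domain -/

/-- The combination `∑ c(p) f(y - p)`. -/
def synthesis (c : FinSeq (Fin r) (Fin r)) (f : Fin r → ℝ → ℂ) (y : ℝ) (j : Fin r) : ℂ :=
  ∑ p ∈ c.support, ∑ l, c p j l * f l (y - p)

/-- Time domain form of the refinement equation. -/
def Refinable (a : FinSeq (Fin r) (Fin r)) (f : Fin r → ℝ → ℂ) : Prop :=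
  ∀ x j, f j x = 2 * synthesis a f (2 * x) j

/-- Injectivity of the Fourier transform; continuity of f turns the refinement equation into an
identity at every point, so that it can be sampled and differentiated. -/
lemma refinable_of_fourierHat {a : FinSeq (Fin r) (Fin r)} {f : Fin r → ℝ → ℂ}
    (hfc : ∀ j, Continuous (f j)) {M : ℕ} (hM : ∀ j x, (M : ℝ) ≤ |x| → f j x = 0)
    (h : ∀ ξ j, fourierHat (f j) (2 * ξ) = ((symbol a ξ).mulVec fun l => fourierHat (f l) ξ) j) :
    Refinable a f := by
  intro x j
  have hint : ∀ l, Integrable (f l) := fun l => integrable_of_le_abs (hfc l) (hM l)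
  have hint' : ∀ l (p : ℤ), Integrable fun x : ℝ => f l (2 * x - p) := fun l p =>
    ((hint l).comp_sub_right (p : ℝ)).comp_mul_left' two_ne_zero
  have hsum : ∀ p : ℤ, Integrable fun x : ℝ => ∑ l, a p j l * f l (2 * x - p) := fun p =>
    integrable_finsetSum _ fun l _ => (hint' l p).const_mul _
  have hI : Integrable fun x : ℝ => 2 * synthesis a f (2 * x) j :=
    (integrable_finsetSum _ fun p _ => hsum p).const_mul 2
  refine sub_eq_zero.mp (eq_zero_of_fourierHat_eq_zero
    (f := fun x => f j x - 2 * synthesis a f (2 * x) j) ?_ ((hint j).sub hI) (fun ξ => ?_) x)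
  · refine (hfc j).sub (continuous_const.mul ?_)
    unfold synthesis
    refine continuous_finsetSum _ fun p _ => continuous_finsetSum _ fun l _ =>
      continuous_const.mul ((hfc l).comp (by fun_prop))
  · obtain ⟨ζ, rfl⟩ : ∃ ζ, ξ = 2 * ζ := ⟨ξ / 2, by ring⟩
    rw [fourierHat_sub (hint j) hI, h, fourierHat_const_mul, sub_eq_zero]
    unfold synthesis
    rw [fourierHat_sum _ fun p _ => hsum p]
    have h1 : ∀ p : ℤ, fourierHat (fun x : ℝ => ∑ l, a p j l * f l (2 * x - p)) (2 * ζ) =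
        ∑ l, a p j l * (2⁻¹ * (expChar p ζ * fourierHat (f l) ζ)) := fun p => by
      rw [fourierHat_sum _ fun l _ => (hint' l p).const_mul _]
      simp only [fourierHat_const_mul, fourierHat_comp_two_mul_sub]
    simp only [h1, Matrix.mulVec, dotProduct, symbol_apply, Finset.sum_mul]
    rw [Finset.sum_comm, Finset.mul_sum]
    refine Finset.sum_congr rfl fun p _ => ?_
    rw [Finset.mul_sum]
    exact Finset.sum_congr rfl fun l _ => by ring

lemma synthesis_eq_sum (c : FinSeq (Fin r) (Fin r)) (f : Fin r → ℝ → ℂ) (y : ℝ) (j : Fin r) :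
    synthesis c f y j = c.sum fun p A => ∑ l, A j l * f l (y - p) := rfl

lemma Refinable.synthesis_fsub {a : FinSeq (Fin r) (Fin r)} {f : Fin r → ℝ → ℂ}
    (h : Refinable a f) (x : FinSeq (Fin r) (Fin r)) (y : ℝ) (j : Fin r) :
    synthesis (fsub a x) f (2 * y) j = synthesis x f y j := by
  classical
  have hadd : ∀ (k : ℤ) (A B : Matrix (Fin r) (Fin r) ℂ),
      ∑ l, (A + B) j l * f l (2 * y - k) =
        ∑ l, A j l * f l (2 * y - k) + ∑ l, B j l * f l (2 * y - k) := fun k A B => by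
    simp only [Matrix.add_apply, add_mul, Finset.sum_add_distrib]
  rw [synthesis_eq_sum, fsub, Finsupp.sum_sum_index (by simp) hadd, synthesis, Finsupp.sum]
  refine Finset.sum_congr rfl fun p _ => ?_
  rw [Finsupp.sum_sum_index (by simp) hadd, Finsupp.sum]
  simp only [h (y - p), synthesis]
  simp only [Finset.mul_sum]
  rw [Finset.sum_comm]
  refine Finset.sum_congr rfl fun i _ => ?_
  rw [Finsupp.sum_single_index (by simp)]
  simp only [Matrix.smul_apply, Matrix.mul_apply, smul_eq_mul, Finset.sum_mul, Finset.mul_sum]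
  rw [Finset.sum_comm]
  refine Finset.sum_congr rfl fun l _ => Finset.sum_congr rfl fun q _ => ?_
  rw [show (2 * y - ((2 * p + i : ℤ) : ℝ)) = 2 * (y - p) - i by push_cast; ring]
  ring

lemma Refinable.eq_synthesis_iterMask {a : FinSeq (Fin r) (Fin r)} {f : Fin r → ℝ → ℂ}
    (h : Refinable a f) (n : ℕ) (x : ℝ) (j : Fin r) :
    f j x = synthesis (iterMask a n) f (2 ^ n * x) j := by
  induction n with
  | zero =>
    rw [synthesis_eq_sum, iterMask, Finsupp.sum_single_index (by simp)]
    simp [Matrix.one_apply]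
  | succ n ih => rw [iterMask, pow_succ', mul_assoc, h.synthesis_fsub, ih]

/-- The samples `k ↦ g(k + s)` of a vector of functions vanishing outside `(-M, M)`. -/
def sampleSeq (M : ℕ) (g : Fin r → ℝ → ℂ) (s : ℝ) : FinSeq (Fin r) (Fin 1) :=
  Finsupp.onFinset (Finset.Icc ⌊-(M : ℝ) - s⌋ ⌈(M : ℝ) - s⌉)
    (fun k => Matrix.of fun l _ => if |(k : ℝ) + s| < M then g l (k + s) else 0) fun k hk => by
      by_contra hk'
      apply hk
      ext l i
      rw [Matrix.of_apply, if_neg]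
      · rfl
      · intro h
        rw [abs_lt] at h
        apply hk'
        rw [Finset.mem_Icc]
        constructor
        · have : ((⌊-(M : ℝ) - s⌋ : ℤ) : ℝ) < k := (Int.floor_le _).trans_lt (by linarith [h.1])
          exact_mod_cast this.le
        · have : (k : ℝ) < ((⌈(M : ℝ) - s⌉ : ℤ) : ℝ) :=
            lt_of_lt_of_le (by linarith [h.2]) (Int.le_ceil _)
          exact_mod_cast this.le

lemma sampleSeq_apply {M : ℕ} {g : Fin r → ℝ → ℂ} (hg : ∀ l x, (M : ℝ) ≤ |x| → g l x = 0) (s : ℝ)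
    (k : ℤ) (l : Fin r) (i : Fin 1) : sampleSeq M g s k l i = g l (k + s) := by
  rw [sampleSeq, Finsupp.onFinset_apply, Matrix.of_apply]
  split_ifs with h
  · rfl
  · rw [hg _ _ (not_lt.mp h)]

lemma iteratedDeriv_comp_mul_sub {f : ℝ → ℂ} {ν : ℕ} (hf : ContDiff ℝ ν f) (c b x : ℝ) :
    iteratedDeriv ν (fun x => f (c * x - b)) x = (c : ℂ) ^ ν * iteratedDeriv ν f (c * x - b) := by
  have h1 : ContDiff ℝ ν fun x => f (x - b) := hf.comp (contDiff_id.sub contDiff_const)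
  have h2 := congrFun (iteratedDeriv_comp_const_smul h1 c) x
  have h3 : iteratedDeriv ν (fun x => f (x - b)) = fun x => iteratedDeriv ν f (x - b) := by
    simpa only [sub_eq_add_neg] using iteratedDeriv_comp_add_const ν f (-b)
  rw [h3] at h2
  rw [h2, Complex.real_smul]
  push_cast
  rfl

/-- Samples of derivatives of a refinable vector function, in terms of the iterated masks. -/
lemma Refinable.iteratedDeriv_eq {a : FinSeq (Fin r) (Fin r)} {f : Fin r → ℝ → ℂ}
    (h : Refinable a f) {ν : ℕ} (hf : ∀ j, ContDiff ℝ ν (f j)) {M : ℕ}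
    (hM : ∀ l x, (M : ℝ) ≤ |x| → iteratedDeriv ν (f l) x = 0) (n : ℕ) (k : ℤ) (s : ℝ)
    (j : Fin r) : iteratedDeriv ν (f j) (((k : ℝ) + s) / 2 ^ n) = (2 : ℂ) ^ (ν * n) *
      fconv (iterMask a n) (sampleSeq M (fun l => iteratedDeriv ν (f l)) s) k j 0 := by
  have h1 : f j = fun x => synthesis (iterMask a n) f (2 ^ n * x) j :=
    funext fun x => h.eq_synthesis_iterMask n x j
  have hcd : ∀ (p : ℤ) (l : Fin r), ContDiff ℝ ν fun x : ℝ =>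
      (iterMask a n) p j l * f l (2 ^ n * x - p) := fun p l =>
    contDiff_const.mul ((hf l).comp ((contDiff_const.mul contDiff_id).sub contDiff_const))
  rw [h1]
  unfold synthesis
  rw [iteratedDeriv_fun_sum fun p _ => (ContDiff.sum fun l _ => hcd p l).contDiffAt,
    fconv_apply_left, Matrix.sum_apply, Finset.mul_sum]
  refine Finset.sum_congr rfl fun p _ => ?_
  rw [iteratedDeriv_fun_sum fun l _ => (hcd p l).contDiffAt, Matrix.mul_apply, Finset.mul_sum]
  refine Finset.sum_congr rfl fun l _ => ?_
  rw [iteratedDeriv_const_mul_field, iteratedDeriv_comp_mul_sub (hf l), sampleSeq_apply hM,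
    mul_div_cancel₀ _ (by positivity)]
  push_cast
  rw [show ((k : ℝ) + s - p) = (k : ℝ) - p + s by ring, mul_comm ν n, pow_mul]
  ring

/-! ### Supports of distributions given by continuous functions -/

lemma eq_zero_of_notMem_dsupport {T : 𝓢'(ℝ, ℂ)} {f : ℝ → ℂ} (hfc : Continuous f)
    (hTf : ∀ g : 𝓢(ℝ, ℂ), T g = ∫ x, g x * f x) {x : ℝ} (hx : x ∉ Distribution.dsupport T) :
    f x = 0 := by
  obtain ⟨U, hU, hUo, hxU⟩ := Distribution.notMem_dsupport_iff x |>.mp hx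
  have hae : ∀ᵐ y : ℝ, y ∈ U → f y = 0 := by
    refine hUo.ae_eq_zero_of_integral_contDiff_smul_eq_zero
      (hfc.locallyIntegrable.locallyIntegrableOn U) ?_
    intro g hg hgc hgU
    have hg₁ : HasCompactSupport (Complex.ofRealCLM ∘ g) := hgc.comp_left rfl
    have hg₂ : ContDiff ℝ ∞ (Complex.ofRealCLM ∘ g) := Complex.ofRealCLM.contDiff.comp hg
    have h1 := hU (hg₁.toSchwartzMap hg₂) (by
      refine (closure_mono ?_).trans hgU
      intro y hy h0
      apply hy
      change ((g y : ℝ) : ℂ) = 0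
      rw [h0, Complex.ofReal_zero])
    rw [hTf] at h1
    simpa using h1
  have hmem : U ∩ {y | f y ≠ 0} = ∅ := by
    refine IsOpen.eq_empty_of_measure_zero (μ := volume)
      (hUo.inter (isOpen_ne.preimage hfc)) ?_
    refine measure_mono_null (fun y hy => ?_) (ae_iff.mp hae)
    intro h
    exact hy.2 (h hy.1)
  by_contra h0
  exact (Set.mem_empty_iff_false x).mp (hmem ▸ ⟨hxU, h0⟩)

/-! ### Iterated subdivision of arbitrary sequences -/

lemma injective_sub_two_pow_mul (n : ℕ) (k : ℤ) :
    Function.Injective fun p : ℤ => k - 2 ^ n * p := fun p q h => by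
  have h1 : (2 : ℤ) ^ n * p = 2 ^ n * q := by simpa using h
  exact mul_left_cancel₀ (pow_ne_zero n two_ne_zero) h1

/-- The finite set of all `p` with `c (k - 2 ^ n p) ≠ 0`. -/
def dilatedSupport (c : FinSeq σ τ) (n : ℕ) (k : ℤ) : Finset ℤ :=
  c.support.preimage (fun p : ℤ => k - 2 ^ n * p) (injective_sub_two_pow_mul n k).injOn

lemma notMem_dilatedSupport {c : FinSeq σ τ} {n : ℕ} {k p : ℤ} :
    p ∉ dilatedSupport c n k ↔ c (k - 2 ^ n * p) = 0 := by
  simp [dilatedSupport]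

lemma finsum_mul_eq_sum [Fintype κ] {w : ℤ → Matrix σ κ ℂ} {c : FinSeq κ τ} {n : ℕ} {k : ℤ}
    {s : Finset ℤ} (hs : dilatedSupport c n k ⊆ s) :
    ∑ᶠ p : ℤ, w p * c (k - 2 ^ n * p) = ∑ p ∈ s, w p * c (k - 2 ^ n * p) := by
  refine finsum_eq_sum_of_support_subset _ fun p hp => hs ?_
  by_contra h
  exact hp (by simp only [notMem_dilatedSupport.mp h, Matrix.mul_zero])

lemma iterMask_succ_sub (a : FinSeq (Fin r) (Fin r)) (n : ℕ) (k p : ℤ) :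
    iterMask a (n + 1) (k - 2 ^ (n + 1) * p) =
      (2 : ℂ) • ∑ q ∈ dilatedSupport a 1 k, iterMask a n (q - 2 ^ n * p) * a (k - 2 * q) := by
  rw [iterMask, coe_fsub, subdivision, ← finsum_comp_equiv (Equiv.subRight (2 ^ n * p))]
  have h1 : ∀ q : ℤ, k - 2 ^ (n + 1) * p - 2 * (q - 2 ^ n * p) = k - 2 ^ 1 * q := fun q => by ring
  simp only [Equiv.subRight_apply, h1]
  rw [finsum_mul_eq_sum (w := fun q => iterMask a n (q - 2 ^ n * p)) subset_rfl]
  simp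

/-- Reduces arbitrary, possibly unbounded, initial data to the iterated masks: for each k only
finitely many terms are nonzero. -/
lemma iterate_subdivision_apply (a : FinSeq (Fin r) (Fin r)) (w : ℤ → Matrix σ (Fin r) ℂ) (n : ℕ)
    (k : ℤ) : (subdivision a)^[n] w k = ∑ᶠ p : ℤ, w p * iterMask a n (k - 2 ^ n * p) := by
  classical
  induction n generalizing k with
  | zero =>
    rw [finsum_eq_single _ k]
    · simp [iterMask]
    · intro p hp
      rw [iterMask, Finsupp.single_apply, if_neg, Matrix.mul_zero]
      intro h
      apply hp
      linarith
  | succ n ih =>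
    set Q := dilatedSupport a 1 k
    -- Collects every index that occurs on either side, so that all finite sums run over one set and
    -- can be interchanged.
    set S := dilatedSupport (iterMask a (n + 1)) (n + 1) k ∪
      Q.biUnion (fun q => dilatedSupport (iterMask a n) n q)
    rw [Function.iterate_succ_apply', finsum_mul_eq_sum (s := S) Finset.subset_union_left,
      subdivision]
    have h1 := finsum_mul_eq_sum (w := (subdivision a)^[n] w) (c := a) (n := 1) (k := k)
      (s := Q) subset_rfl
    rw [pow_one] at h1
    rw [h1]
    have h2 : ∀ q ∈ Q, (subdivision a)^[n] w q = ∑ p ∈ S, w p * iterMask a n (q - 2 ^ n * p) :=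
      fun q hq => by
        rw [ih, finsum_mul_eq_sum]
        exact (Finset.subset_biUnion_of_mem (fun q => dilatedSupport (iterMask a n) n q) hq).trans
          Finset.subset_union_right
    rw [Finset.sum_congr rfl fun q hq => by rw [h2 q hq]]
    simp only [iterMask_succ_sub, Matrix.mul_smul, ← Finset.smul_sum, Matrix.mul_sum,
      Matrix.sum_mul, Matrix.mul_assoc]
    rw [Finset.sum_comm]

lemma tendsto_iSup_enorm_iff {x : ℕ → ℤ → ℂ} {P : ℕ → ℤ → Prop} :
    Tendsto (fun n => ⨆ (k : ℤ) (_ : P n k), ‖x n k‖ₑ) atTop (𝓝 0) ↔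
      ∀ ε > 0, ∀ᶠ n in atTop, ∀ k, P n k → ‖x n k‖ ≤ ε := by
  rw [ENNReal.tendsto_nhds_zero]
  constructor
  · intro h ε hε
    filter_upwards [h (ENNReal.ofReal ε) (ENNReal.ofReal_pos.mpr hε)] with n hn k hk
    have h1 := (le_iSup₂ (f := fun k (_ : P n k) => ‖x n k‖ₑ) k hk).trans hn
    rwa [← ofReal_norm, ENNReal.ofReal_le_ofReal_iff hε.le] at h1
  · intro h ε hε
    obtain rfl | hε' := eq_or_ne ε ∞
    · simp
    filter_upwards [h ε.toReal (ENNReal.toReal_pos hε.ne' hε')] with n hn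
    refine iSup₂_le fun k hk => ?_
    rw [← ofReal_norm]
    exact ENNReal.ofReal_le_of_le_toReal (hn k hk)

/-! ### Limit functions of the rows of the iterated masks -/

/-- The functions `η j ∈ C^m`, vanishing outside `(-M, M)`, are the limits of the generalized
Hermite subdivision scheme for the unit row vectors at `0`. -/
structure IsBasicLimit (m : ℕ) (ν : Fin r → ℕ) (a : FinSeq (Fin r) (Fin r)) (M : ℕ)
    (η : Fin r → ℝ → ℂ) : Prop where
  contDiff : ∀ j, ContDiff ℝ m (η j)
  eq_zero : ∀ j x, (M : ℝ) ≤ |x| → η j x = 0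
  iterMask_eq_zero : ∀ n, ∀ k ∉ dyadicBox n M, iterMask a n k = 0
  sampleLimit : ∀ j l, SampleLimit (fun n k => (2 : ℂ) ^ (ν l * n) * iterMask a n k j l)
    (iteratedDeriv (ν l) (η j))

lemma tendsto_floor_div_two_pow (x : ℝ) :
    Tendsto (fun n : ℕ => ((⌊2 ^ n * x⌋ : ℤ) : ℝ) / 2 ^ n) atTop (𝓝 x) := by
  have h1 : Tendsto (fun n : ℕ => x - (1 / 2 : ℝ) ^ n) atTop (𝓝 x) := by
    simpa using tendsto_const_nhds.sub
      (tendsto_pow_atTop_nhds_zero_of_lt_one (r := (1 / 2 : ℝ)) (by norm_num) (by norm_num))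
  refine tendsto_of_tendsto_of_tendsto_of_le_of_le h1 tendsto_const_nhds (fun n => ?_) fun n => ?_
  · have := Int.lt_floor_add_one ((2 : ℝ) ^ n * x)
    rw [le_div_iff₀ (by positivity), sub_mul, ← mul_pow]
    norm_num
    linarith
  · rw [div_le_iff₀ (by positivity), mul_comm]
    exact Int.floor_le _

lemma fconv_diracCol (x : FinSeq σ (Fin r)) (y : Fin r) (k : ℤ) (i : σ) :
    fconv x (diracCol y) k i 0 = x k i y := by
  have h : (diracCol y).support ⊆ {0} := Finsupp.support_single_subset
  rw [fconv_apply_of_subset x _ k {0} h, Finset.sum_singleton,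
    diracCol, Finsupp.single_eq_same, sub_zero]
  simp [Matrix.mul_apply]

/-- Starting from the unit row at 0 the scheme produces the rows of A_n. These are supported in 2^n
[-N, N], and the undifferentiated column (ν_1 = 0) forces the limits to vanish outside [-N, N].
Local uniform convergence thereby becomes uniform over ℤ. -/
theorem HermiteConvergent.exists_isBasicLimit [NeZero r] {m : ℕ} {ν : Fin r → ℕ}
    {a : FinSeq (Fin r) (Fin r)} (h : HermiteConvergent m ν a)
    (hν₀ : ν 0 = 0) : ∃ M η, IsBasicLimit m ν a M η := by
  obtain ⟨N, hN⟩ := exists_supportedIn a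
  have hrow : ∀ (j : Fin r) (n : ℕ) (k : ℤ) (l : Fin r),
      ((subdivision a)^[n] (fun k => if k = 0 then Matrix.of fun (_ : Fin 1) i =>
        if i = j then (1 : ℂ) else 0 else 0)) k 0 l = iterMask a n k j l := fun j n k l => by
    rw [iterate_subdivision_apply, finsum_eq_single _ 0]
    · simp [Matrix.mul_apply]
    · intro p hp
      rw [if_neg hp, Matrix.zero_mul]
  have hlim : ∀ j : Fin r, ∃ η : ℝ → ℂ, ContDiff ℝ m η ∧ ∀ K : ℝ, 0 < K → ∀ l : Fin r, ∀ ε > 0,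
      ∀ᶠ n : ℕ in atTop, ∀ k : ℤ, |(k : ℝ)| ≤ 2 ^ n * K →
        ‖(2 : ℂ) ^ (ν l * n) * iterMask a n k j l -
          iteratedDeriv (ν l) η ((k : ℝ) / 2 ^ n)‖ ≤ ε := fun j => by
    obtain ⟨η, hη, h1⟩ := h (fun k => if k = 0 then Matrix.of fun (_ : Fin 1) i =>
        if i = j then (1 : ℂ) else 0 else 0)
    refine ⟨η, hη, fun K hK l => ?_⟩
    have h2 := tendsto_iSup_enorm_iff.mp (h1 K hK l)
    simp only [hrow] at h2
    simpa only [mul_comm] using h2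
  choose η hη hlim using hlim
  have hmask : ∀ n, ∀ k ∉ dyadicBox n (N + 1), iterMask a n k = 0 := fun n k hk => by
    refine hN.iterMask n k ?_
    have := notMem_dyadicBox hk
    push_cast at this
    have h2 : (0 : ℤ) < 2 ^ n := by positivity
    nlinarith
  have hsupp : ∀ j x, ((N + 1 : ℕ) : ℝ) ≤ |x| → η j x = 0 := fun j x hx => by
    have hx1 : (N : ℝ) < |x| := by push_cast at hx; linarith
    have ht := tendsto_floor_div_two_pow x
    have h1 : Tendsto (fun n : ℕ => η j (((⌊2 ^ n * x⌋ : ℤ) : ℝ) / 2 ^ n)) atTop (𝓝 (η j x)) :=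
      ((hη j).continuous.tendsto x).comp ht
    refine tendsto_nhds_unique h1 (Metric.tendsto_nhds.mpr fun ε hε => ?_)
    filter_upwards [hlim j (|x| + 1) (by positivity) 0 (ε / 2) (by positivity),
      ht.abs.eventually (lt_mem_nhds hx1),
      ht.abs.eventually (gt_mem_nhds (lt_add_one |x|))] with n h3 h4 h5
    have hp : (0 : ℝ) < 2 ^ n := by positivity
    have hk := h3 ⌊2 ^ n * x⌋ (by
      rw [abs_div, abs_of_pos hp, div_lt_iff₀ hp] at h5
      linarith)
    have h0 : iterMask a n ⌊2 ^ n * x⌋ = 0 := by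
      refine hN.iterMask n _ ?_
      rw [abs_div, abs_of_pos hp, lt_div_iff₀ hp] at h4
      have h6 : ((N * 2 ^ n : ℤ) : ℝ) < ((|⌊2 ^ n * x⌋| : ℤ) : ℝ) := by
        push_cast; exact h4
      have h7 := Int.cast_lt.mp h6
      nlinarith [Int.natCast_nonneg N]
    rw [hν₀, h0] at hk
    simp only [Matrix.zero_apply, mul_zero, zero_sub, norm_neg, iteratedDeriv_zero] at hk
    rw [dist_zero_right]
    linarith
  refine ⟨N + 1, η, hη, hsupp, hmask, fun j l ε hε => ?_⟩
  -- The vanishing of η j is recorded from N + 1 on and passing to derivatives loses one more unit;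
  -- beyond N + 2 both terms are zero.
  filter_upwards [hlim j (N + 2) (by positivity) l ε hε] with n hn k
  by_cases hk : |(k : ℝ)| ≤ 2 ^ n * (N + 2)
  · exact hn k hk
  · have hp : (0 : ℝ) < 2 ^ n := by positivity
    rw [not_le] at hk
    rw [iteratedDeriv_eq_zero_of_le_abs (hsupp j), hN.iterMask n k]
    · simpa using hε.le
    · have h6 : ((2 ^ n * (N + 2) : ℤ) : ℝ) < ((|k| : ℤ) : ℝ) := by push_cast; exact hk
      have h7 := Int.cast_lt.mp h6
      have h8 : (0 : ℤ) < 2 ^ n := by positivity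
      nlinarith [Int.natCast_nonneg N]
    · rw [abs_div, abs_of_pos hp, le_div_iff₀ hp]
      push_cast
      linarith

/-! ### The shape of the matching filter -/

lemma hermiteFilterCondition_iff {ν : Fin r → ℕ} {v : FinSeq (Fin 1) (Fin r)} :
    HermiteFilterCondition ν v ↔ ∀ l, (∀ d < ν l, coeff d (symbolSeries v 0 l) = 0) ∧
      coeff (ν l) (symbolSeries v 0 l) = Complex.I ^ ν l := by
  have hpow : ∀ n d : ℕ, coeff d (taylor fun ξ : ℝ => (Complex.I * (ξ : ℂ)) ^ n) =
      if d = n then Complex.I ^ n else 0 := fun n d => by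
    have h1 : (fun ξ : ℝ => (Complex.I * (ξ : ℂ)) ^ n) =
        fun ξ : ℝ => Complex.I ^ n * (fun ξ : ℝ => (ξ : ℂ) ^ n) ξ := by
      ext ξ; rw [mul_pow]
    have h2 : ∀ d : ℕ, iteratedDeriv d (fun ξ : ℝ => (ξ : ℂ) ^ n) =
        fun ξ : ℝ => (n.descFactorial d : ℂ) * (ξ : ℂ) ^ (n - d) := fun d => by
      induction d with
      | zero => simp
      | succ d ih =>
        rw [iteratedDeriv_succ, ih]
        ext ξ
        have h3 : HasDerivAt (fun ξ : ℝ => (ξ : ℂ) ^ (n - d))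
            (((n - d : ℕ) : ℂ) * (ξ : ℂ) ^ (n - d - 1)) ξ := by
          simpa using! (hasDerivAt_id ξ).ofReal_comp.pow (n - d)
        rw [(h3.const_mul _).deriv, Nat.descFactorial_succ, ← Nat.sub_sub]
        push_cast
        ring
    rw [h1, taylor_const_mul, coeff_smul, coeff_taylor, h2, smul_eq_mul]
    split_ifs with hd
    · subst hd
      beta_reduce
      rw [Nat.descFactorial_self, Nat.sub_self, pow_zero, mul_one, div_self, mul_one]
      exact_mod_cast d.factorial_ne_zero
    · rcases lt_or_gt_of_ne hd with h | h
      · simp [zero_pow (Nat.sub_ne_zero_of_lt h)]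
      · simp [Nat.descFactorial_of_lt h]
  refine forall_congr' fun l => ?_
  rw [eqUpToOrder_iff_dvd, X_pow_dvd_iff]
  simp only [map_sub, hpow, sub_eq_zero]
  change (∀ d < ν l + 1, coeff d (symbolSeries v 0 l) = _) ↔ _
  constructor
  · intro h
    exact ⟨fun d hd => by rw [h d (by omega), if_neg hd.ne], by rw [h _ (by omega), if_pos rfl]⟩
  · rintro ⟨h1, h2⟩ d hd
    split_ifs with h
    · rw [h, h2]
    · exact h1 d (by omega)

lemma HermiteFilterCondition.symbol_zero_apply {ν : Fin r → ℕ} {v : FinSeq (Fin 1) (Fin r)}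
    (h : HermiteFilterCondition ν v) (l : Fin r) :
    symbol v 0 0 l = if ν l = 0 then 1 else 0 := by
  obtain ⟨h1, h2⟩ := hermiteFilterCondition_iff.mp h l
  rw [← constantCoeff_symbolSeries, ← coeff_zero_eq_constantCoeff_apply]
  split_ifs with h0
  · rw [h0] at h2
    simpa using h2
  · exact h1 0 (Nat.pos_of_ne_zero h0)

/-- Column l of A_n is A_n * δ e_l, so the moment argument gives v̂_l = c (iξ)^{ν_l} +
O(|ξ|^{ν_l+1}) with the same c for all l. An entry with v̂_l(0) = 1 must have ν_l = 0, and then c =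
1. -/
theorem IsBasicLimit.hermiteFilterCondition {m : ℕ} {ν : Fin r → ℕ}
    {a : FinSeq (Fin r) (Fin r)} {M : ℕ} {η : Fin r → ℝ → ℂ} (h : IsBasicLimit m ν a M η)
    (hν : ∀ l, ν l ≤ m) {N : ℕ} {v : FinSeq (Fin 1) (Fin r)} (hv : IsMatchingFilter a N v)
    (hN : ∀ l, ν l < N)
    (hv₁ : ∃ l : Fin r, symbol v 0 0 l = 1 ∧ ∀ j < l, symbol v 0 0 j = 0) :
    HermiteFilterCondition ν v := by
  have h1 := fun l => hv.coeff_of_sampleLimit (hN l) (diracCol l) (η := η)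
    (fun j => (h.contDiff j).of_le (by exact_mod_cast hν l)) h.eq_zero
    (fun j => by simpa only [fconv_diracCol] using h.sampleLimit j l)
  simp only [symbolSeries_mul_diracCol] at h1
  obtain ⟨l₀, hl₀, -⟩ := hv₁
  have h0 : coeff 0 (symbolSeries v 0 l₀) = 1 := by
    rw [coeff_zero_eq_constantCoeff_apply, constantCoeff_symbolSeries, hl₀]
  have hc : ∑ j, symbol v 0 0 j * ∫ x, η j x = 1 := by
    rcases Nat.eq_zero_or_pos (ν l₀) with h2 | h2
    · have h3 := (h1 l₀).2
      rw [h2, h0, pow_zero, one_mul] at h3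
      exact h3.symm
    · exact absurd ((h1 l₀).1 0 h2) (by rw [h0]; exact one_ne_zero)
  refine hermiteFilterCondition_iff.mpr fun l => ⟨(h1 l).1, ?_⟩
  rw [(h1 l).2, hc, mul_one]

/-! ### Operations on sampled limits -/

lemma SampleLimit.congr {b b' : ℕ → ℤ → ℂ} {f f' : ℝ → ℂ} (h : SampleLimit b f)
    (hb : ∀ n k, b' n k = b n k) (hf : ∀ x, f' x = f x) : SampleLimit b' f' := by
  intro ε hε
  simpa only [hb, hf] using h ε hε

lemma SampleLimit.const_mul {b : ℕ → ℤ → ℂ} {f : ℝ → ℂ} (h : SampleLimit b f) (c : ℂ) :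
    SampleLimit (fun n k => c * b n k) fun x => c * f x := by
  intro ε hε
  filter_upwards [h (ε / (‖c‖ + 1)) (by positivity)] with n hn k
  rw [← mul_sub, norm_mul]
  have h1 := hn k
  rw [le_div_iff₀ (by positivity)] at h1
  nlinarith [norm_nonneg (b n k - f ((k : ℝ) / 2 ^ n))]

lemma SampleLimit.zero : SampleLimit (fun _ _ => 0) fun _ => 0 := fun ε hε =>
  Eventually.of_forall fun n k => by simpa using hε.le

lemma SampleLimit.add {b b' : ℕ → ℤ → ℂ} {f f' : ℝ → ℂ} (h : SampleLimit b f)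
    (h' : SampleLimit b' f') : SampleLimit (fun n k => b n k + b' n k) fun x => f x + f' x := by
  intro ε hε
  filter_upwards [h (ε / 2) (by positivity), h' (ε / 2) (by positivity)] with n h1 h2 k
  rw [add_sub_add_comm]
  exact (norm_add_le _ _).trans (by linarith [h1 k, h2 k])

lemma SampleLimit.sum {ι : Type*} (s : Finset ι) {b : ι → ℕ → ℤ → ℂ} {f : ι → ℝ → ℂ}
    (h : ∀ i ∈ s, SampleLimit (b i) (f i)) :
    SampleLimit (fun n k => ∑ i ∈ s, b i n k) fun x => ∑ i ∈ s, f i x := by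
  classical
  induction s using Finset.induction_on with
  | empty => simpa using SampleLimit.zero
  | insert i s hi ih =>
    simp only [Finset.sum_insert hi]
    exact (h i (Finset.mem_insert_self _ _)).add (ih fun j hj => h j (Finset.mem_insert_of_mem hj))

lemma tendsto_inv_two_pow : Tendsto (fun n : ℕ => ((2 : ℝ) ^ n)⁻¹) atTop (𝓝 0) := by
  simpa [inv_pow] using
    tendsto_pow_atTop_nhds_zero_of_lt_one (r := (2 : ℝ)⁻¹) (by norm_num) (by norm_num)

lemma SampleLimit.comp_sub {b : ℕ → ℤ → ℂ} {f : ℝ → ℂ} (h : SampleLimit b f)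
    (hf : UniformContinuous f) (p : ℤ) : SampleLimit (fun n k => b n (k - p)) f := by
  intro ε hε
  obtain ⟨δ, hδ, h1⟩ := Metric.uniformContinuous_iff.mp hf (ε / 2) (by positivity)
  have h2 : Tendsto (fun n : ℕ => |(p : ℝ)| * ((2 : ℝ) ^ n)⁻¹) atTop (𝓝 0) := by
    simpa using tendsto_inv_two_pow.const_mul |(p : ℝ)|
  filter_upwards [h (ε / 2) (by positivity), h2.eventually (gt_mem_nhds hδ)] with n h3 h4 k
  have h5 : dist (f (((k - p : ℤ) : ℝ) / 2 ^ n)) (f ((k : ℝ) / 2 ^ n)) < ε / 2 := h1 (by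
    rw [Real.dist_eq, ← sub_div, Int.cast_sub, sub_sub_cancel_left, abs_div, abs_neg,
      abs_of_pos (show (0 : ℝ) < 2 ^ n by positivity)]
    exact h4)
  rw [← dist_eq_norm]
  have h6 := h3 (k - p)
  rw [← dist_eq_norm] at h6
  exact (dist_triangle _ _ _).trans (by linarith)

lemma SampleLimit.of_pos {b : ℕ → ℤ → ℂ} {f : ℝ → ℂ} {ν : ℕ} (hν : ν ≠ 0) {B : ℝ}
    (hB : ∀ x, ‖f x‖ ≤ B) (h : SampleLimit (fun n k => (2 : ℂ) ^ (ν * n) * b n k) f) :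
    SampleLimit b fun _ => 0 := by
  intro ε hε
  have h2 : Tendsto (fun n : ℕ => (B + 1) * ((2 : ℝ) ^ n)⁻¹) atTop (𝓝 0) := by
    simpa using tendsto_inv_two_pow.const_mul (B + 1)
  filter_upwards [h 1 one_pos, h2.eventually (gt_mem_nhds hε)] with n h3 h4 k
  have h5 : ‖(2 : ℂ) ^ (ν * n) * b n k‖ ≤ B + 1 := by
    have := norm_sub_norm_le ((2 : ℂ) ^ (ν * n) * b n k) (f ((k : ℝ) / 2 ^ n))
    linarith [h3 k, hB ((k : ℝ) / 2 ^ n)]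
  rw [norm_mul, norm_pow, Complex.norm_ofNat] at h5
  have h6 : (2 : ℝ) ^ n ≤ 2 ^ (ν * n) :=
    pow_le_pow_right₀ one_le_two (Nat.le_mul_of_pos_left n (Nat.pos_of_ne_zero hν))
  rw [sub_zero]
  have h7 : (2 : ℝ) ^ n * ‖b n k‖ ≤ B + 1 :=
    (mul_le_mul_of_nonneg_right h6 (norm_nonneg _)).trans h5
  have h8 : ‖b n k‖ ≤ (B + 1) * ((2 : ℝ) ^ n)⁻¹ := by
    rw [← div_eq_mul_inv, le_div_iff₀ (by positivity)]
    linarith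
  linarith

lemma exists_bound_of_le_abs {f : ℝ → ℂ} {M : ℕ} (hfc : Continuous f)
    (hf : ∀ x, (M : ℝ) ≤ |x| → f x = 0) : ∃ B, 0 ≤ B ∧ ∀ x, ‖f x‖ ≤ B := by
  obtain ⟨B, hB⟩ := (hasCompactSupport_of_le_abs hf).exists_bound_of_continuous hfc
  exact ⟨B, (norm_nonneg _).trans (hB 0), hB⟩

/-! ### Consequences of convergence -/

namespace IsBasicLimit

variable {m : ℕ} {ν : Fin r → ℕ} {a : FinSeq (Fin r) (Fin r)} {M : ℕ} {η : Fin r → ℝ → ℂ}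

lemma iteratedDeriv_eq_zero (h : IsBasicLimit m ν a M η) (n : ℕ) (j : Fin r) (x : ℝ)
    (hx : ((M + 1 : ℕ) : ℝ) ≤ |x|) : iteratedDeriv n (η j) x = 0 :=
  iteratedDeriv_eq_zero_of_le_abs (h.eq_zero j) n x (by exact_mod_cast hx)

/-- Columns with ν_l > 0 are O(2^{-ν_l n}) and disappear without the Hermite scaling; all others in
row j share the limit η j. -/
lemma sampleLimit_zero (h : IsBasicLimit m ν a M η) (hν : ∀ l, ν l ≤ m) (j l : Fin r) :
    SampleLimit (fun n k => iterMask a n k j l) fun x => if ν l = 0 then η j x else 0 := by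
  have h1 := h.sampleLimit j l
  split_ifs with h0
  · simpa [h0] using h1
  · obtain ⟨B, -, hB⟩ := exists_bound_of_le_abs
      ((h.contDiff j).continuous_iteratedDeriv (ν l) (by exact_mod_cast hν l))
      (h.iteratedDeriv_eq_zero (ν l) j)
    exact h1.of_pos h0 hB

/-- Convolutions with the iterated masks converge as well. -/
lemma sampleLimit_fconv (h : IsBasicLimit m ν a M η) (hν : ∀ l, ν l ≤ m)
    (u : FinSeq (Fin r) (Fin 1)) (j : Fin r) :
    SampleLimit (fun n k => fconv (iterMask a n) u k j 0)
      fun x => (∑ l, if ν l = 0 then symbol u 0 l 0 else 0) * η j x := by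
  have h1 : SampleLimit (fun n k => ∑ p ∈ u.support, ∑ l, u p l 0 * iterMask a n (k - p) j l)
      fun x => ∑ p ∈ u.support, ∑ l, u p l 0 * if ν l = 0 then η j x else 0 := by
    refine SampleLimit.sum _ fun p _ => SampleLimit.sum _ fun l _ => SampleLimit.const_mul ?_ _
    refine (h.sampleLimit_zero hν j l).comp_sub ?_ p
    split_ifs
    · exact uniformContinuous_of_le_abs (h.contDiff j).continuous (h.eq_zero j)
    · exact uniformContinuous_const
  refine h1.congr (fun n k => ?_) fun x => ?_
  · simp only [fconv_apply, Matrix.sum_apply, Matrix.mul_apply, mul_comm]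
  · simp only [symbol_apply, expChar_zero_right, one_mul]
    rw [Finset.sum_comm, Finset.sum_mul]
    refine Finset.sum_congr rfl fun l _ => ?_
    split_ifs
    · rw [Finset.sum_mul]
    · simp

lemma decays (h : IsBasicLimit m ν a M η) (hν : ∀ l, ν l ≤ m) {u : FinSeq (Fin r) (Fin 1)}
    (hu : ∑ l, (if ν l = 0 then symbol u 0 l 0 else 0) = 0) : Decays a 1 u := by
  intro ε hε
  have h1 : ∀ᶠ n : ℕ in atTop, ∀ i k, ‖fconv (iterMask a n) u k i 0‖ ≤ ε := by
    refine eventually_all.mpr fun i => ?_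
    filter_upwards [h.sampleLimit_fconv hν u i ε hε] with n hn k
    simpa [hu] using hn k
  filter_upwards [h1] with n hn k i
  simpa using hn i k

/-- The limit functions are the refinable functions. -/
lemma fourierHat_eq (h : IsBasicLimit m ν a M η) (hν : ∀ l, ν l ≤ m) {F : ℝ → Fin r → ℂ}
    (hFc : ∀ l, Continuous fun ξ => F ξ l)
    (hF : ∀ ξ : ℝ, F (2 * ξ) = (symbol a ξ).mulVec (F ξ))
    (hF₀ : ∑ l, (if ν l = 0 then F 0 l else 0) = 1) (ξ : ℝ) (j : Fin r) :
    F ξ j = fourierHat (η j) ξ := by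
  -- The iterated refinement equation, to be used at ξ / 2^n. There 2^{-n} Â_n(ξ / 2^n) is a Riemann
  -- sum for the Fourier transform of the limits, F(ξ / 2^n) tends to F(0), and `hF₀` sums the
  -- surviving columns to 1.
  have hiter : ∀ (n : ℕ) (ξ : ℝ),
      (2 : ℂ) ^ n • F (2 ^ n * ξ) = (symbol (iterMask a n) ξ).mulVec (F ξ) := fun n => by
    induction n with
    | zero =>
      intro ξ
      rw [iterMask, symbol_single]
      simp
    | succ n ih =>
      intro ξ
      rw [iterMask, symbol_fsub, Matrix.smul_mulVec, ← Matrix.mulVec_mulVec, ← hF, ← ih,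
        smul_smul, pow_succ' (2 : ℂ), pow_succ (2 : ℝ), mul_assoc]
  have hlim : ∀ l, Tendsto (fun n : ℕ => ((2 : ℂ) ^ n)⁻¹ * symbol (iterMask a n) (ξ / 2 ^ n) j l)
      atTop (𝓝 (if ν l = 0 then fourierHat (η j) ξ else 0)) := fun l => by
    have h1 := (h.sampleLimit_zero hν j l).tendsto_sum (M := M)
      (h := fun x : ℝ => Complex.exp (-(Complex.I * (ξ : ℂ) * x)))
      (by split_ifs; exacts [(h.contDiff j).continuous, continuous_const])
      (fun x hx => by split_ifs; exacts [h.eq_zero j x hx, rfl]) (by fun_prop)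
    have h2 : ∫ x : ℝ, (if ν l = 0 then η j x else 0) * Complex.exp (-(Complex.I * (ξ : ℂ) * x)) =
        if ν l = 0 then fourierHat (η j) ξ else 0 := by
      split_ifs
      · rfl
      · simp
    rw [h2] at h1
    refine h1.congr fun n => ?_
    rw [symbol_apply, ← Finset.sum_subset (s₁ := (iterMask a n).support) (s₂ := dyadicBox n M)]
    · congr 1
      refine Finset.sum_congr rfl fun k _ => ?_
      rw [mul_comm, expChar]
      push_cast
      congr 3
      ring
    · intro k hk
      by_contra hk'
      exact Finsupp.mem_support_iff.mp hk (h.iterMask_eq_zero n k hk')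
    · intro k _ hk
      rw [Finsupp.notMem_support_iff.mp hk, Matrix.zero_apply, zero_mul]
  have hdil : Tendsto (fun n : ℕ => ξ / 2 ^ n) atTop (𝓝 0) := by
    simpa [div_eq_mul_inv] using tendsto_inv_two_pow.const_mul ξ
  have h1 : Tendsto (fun n : ℕ => ∑ l, ((2 : ℂ) ^ n)⁻¹ * symbol (iterMask a n) (ξ / 2 ^ n) j l *
      F (ξ / 2 ^ n) l) atTop
      (𝓝 (∑ l, (if ν l = 0 then fourierHat (η j) ξ else 0) * F 0 l)) :=
    tendsto_finsetSum _ fun l _ => (hlim l).mul (((hFc l).tendsto 0).comp hdil)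
  have h2 : ∑ l, (if ν l = 0 then fourierHat (η j) ξ else 0) * F 0 l = fourierHat (η j) ξ := by
    refine Eq.trans ?_ ((congrArg (fourierHat (η j) ξ * ·) hF₀).trans (mul_one _))
    rw [Finset.mul_sum]
    refine Finset.sum_congr rfl fun l _ => ?_
    split_ifs <;> simp
  rw [h2] at h1
  refine tendsto_nhds_unique (tendsto_const_nhds.congr fun n => ?_) h1
  have h3 := congrFun (hiter n (ξ / 2 ^ n)) j
  rw [mul_div_cancel₀ _ (by positivity)] at h3
  simp only [Pi.smul_apply, smul_eq_mul, Matrix.mulVec, dotProduct] at h3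
  simp only [mul_assoc]
  rw [← Finset.mul_sum, ← h3, inv_mul_cancel_left₀ (pow_ne_zero _ two_ne_zero)]

/-- The test sequence u = (δ - δ(· - 1)) e_l has û(0) = 0 and û(π) = 2 e_l. It decays, hence so does
T_0 u, and v̂(0) annihilates the symbol of T_0 u at 0, which is â(π) û(π). This is the first-order
sum rule. -/
lemma symbol_mul_symbol_pi (h : IsBasicLimit m ν a M η) (hν : ∀ l, ν l ≤ m) {N : ℕ}
    {v : FinSeq (Fin 1) (Fin r)} (hv : IsMatchingFilter a N v) (hN : 0 < N) (l : Fin r) :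
    (symbol v 0 * symbol a Real.pi) 0 l = 0 := by
  obtain ⟨e, he⟩ : ∃ e : Matrix (Fin r) (Fin 1) ℂ,
    e = Matrix.of fun i _ => if i = l then 1 else 0 := ⟨_, rfl⟩
  obtain ⟨u, hu⟩ : ∃ u : FinSeq (Fin r) (Fin 1), u = Finsupp.single 0 e - Finsupp.single 1 e :=
    ⟨_, rfl⟩
  have hu0 : symbol u 0 = 0 := by
    rw [hu, symbol_sub, symbol_single, symbol_single]
    simp
  have hupi : symbol u Real.pi = (2 : ℂ) • e := by
    have h1 : expChar 1 Real.pi = -1 := by simpa using expChar_int_mul_pi 1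
    rw [hu, symbol_sub, symbol_single, symbol_single, h1, two_smul]
    simp
  have hdec : Decays a 1 u := h.decays hν (by simp [hu0])
  have h0 := hv.1
  have key : ∀ γ : ℤ, (symbol v 0 * symbol (transition a γ u) 0) 0 0 = 0 := fun γ => by
    have h1 := Decays.coeff_eq_zero hv hN
      (u := transition a γ u) (by simpa using hdec.transition one_pos γ)
    rw [coeff_zero_eq_constantCoeff_apply, ← symbolSeries_fconv, constantCoeff_symbolSeries,
      symbol_fconv] at h1
    exact h1
  have h2 := key 0
  have h3 := symbol_transition a 0 u 0
  rw [mul_zero, hu0, zero_add, hupi] at h3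
  rw [h3] at h2
  simp only [neg_zero, expChar_zero_left, one_smul, zpow_zero, Matrix.mul_zero, zero_add,
    Matrix.mul_smul, Matrix.smul_apply, smul_eq_mul] at h2
  have h4 : (symbol v 0 * (symbol a Real.pi * e)) 0 0 = (symbol v 0 * symbol a Real.pi) 0 l := by
    rw [← Matrix.mul_assoc, Matrix.mul_apply]
    simp [he]
  rw [← h4]
  simpa using h2

lemma one_le_sr (h : IsBasicLimit m ν a M η) (hν : ∀ l, ν l ≤ m) {N : ℕ}
    {v : FinSeq (Fin 1) (Fin r)} (hv : IsMatchingFilter a N v) (hN : 0 < N) : 1 ≤ sr a := by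
  refine le_csSup (bddAbove_sumRules a) ⟨v, ⟨hv.1, fun l j hj => hv.2 l j (by omega)⟩, ?_⟩
  intro l j hj
  obtain rfl : j = 0 := by omega
  simpa using h.symbol_mul_symbol_pi hν hv hN l

/-- The filter w is arbitrary, but ŵ(0) annihilates û(0) for every decaying u. Testing with δ e_l
for ν_l > 0 and with δ e_l - δ e_0 for ν_l = 0 shows that ŵ(0) is a nonzero multiple of the
indicator of ν_l = 0, so vanishing against w implies the decay criterion. -/
lemma decays_of_mem_vanishingSpace [NeZero r] (h : IsBasicLimit m ν a M η) (hν : ∀ l, ν l ≤ m)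
    (hν₀ : ν 0 = 0) {J : ℕ} {w : FinSeq (Fin 1) (Fin r)} (hw : IsMatchingFilter a J w)
    (hJ : 0 < J) {u : FinSeq (Fin r) (Fin 1)} (hu : u ∈ vanishingSpace J w) : Decays a 1 u := by
  have hdiracCol : ∀ l i, symbol (diracCol l : FinSeq (Fin r) (Fin 1)) 0 i 0 =
      if i = l then 1 else 0 := fun l i => by
    rw [diracCol, symbol_single]; simp
  have hw0 : ∀ u : FinSeq (Fin r) (Fin 1), ∑ l, (if ν l = 0 then symbol u 0 l 0 else 0) = 0 →
      ∑ l, symbol w 0 0 l * symbol u 0 l 0 = 0 := fun u hu => by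
    have h1 := Decays.coeff_eq_zero hw hJ (u := u) (by simpa using h.decays hν hu)
    rw [coeff_zero_eq_constantCoeff_apply, ← symbolSeries_fconv, constantCoeff_symbolSeries,
      symbol_fconv, Matrix.mul_apply] at h1
    exact h1
  have hwl : ∀ l, symbol w 0 0 l = if ν l = 0 then symbol w 0 0 0 else 0 := fun l => by
    split_ifs with hl
    · have h1 := hw0 (diracCol l - diracCol 0) (by
        simp only [symbol_sub, Matrix.sub_apply, hdiracCol]
        have h2 : ∀ x : Fin r, (if ν x = 0 then ((if x = l then (1 : ℂ) else 0) -
            if x = 0 then 1 else 0) else 0) =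
            (if x = l then (1 : ℂ) else 0) - if x = 0 then 1 else 0 := fun x => by
          split_ifs <;> simp_all
        simp [h2])
      simpa [symbol_sub, Matrix.sub_apply, hdiracCol, mul_sub, sub_eq_zero] using h1
    · have h1 := hw0 (diracCol l) (by
        simp only [hdiracCol]
        refine Finset.sum_eq_zero fun x _ => ?_
        split_ifs <;> simp_all)
      simpa [hdiracCol] using h1
  have hw00 : symbol w 0 0 0 ≠ 0 := fun h0 => by
    obtain ⟨l, hl⟩ := exists_symbol_ne_zero hw.1
    rw [hwl l, h0] at hl
    simp at hl
  refine h.decays hν ?_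
  have h1 : (symbol w 0 * symbol u 0) 0 0 = 0 := by simpa using hu 0 hJ
  rw [Matrix.mul_apply] at h1
  refine (mul_eq_zero_iff_left hw00).mp ?_
  rw [Finset.mul_sum]
  refine Eq.trans ?_ h1
  refine Finset.sum_congr rfl fun l _ => ?_
  rw [hwl l]
  split_ifs <;> simp

end IsBasicLimit

/-! ### The exponent of the mask -/

lemma rho_le_of_geometricDecay {a : FinSeq (Fin r) (Fin r)} {J : ℕ} {w : FinSeq (Fin 1) (Fin r)}
    {q : ℝ} (hq : 0 < q) (h : ∀ u ∈ vanishingSpace J w, GeometricDecay a q u) :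
    rho a J w ≤ ENNReal.ofReal q := by
  refine iSup₂_le fun u hu => ?_
  obtain ⟨C, hC, h1⟩ := h u hu
  have h2 : ∀ᶠ n : ℕ in atTop,
      supNorm (convolution ((subdivision a)^[n] (diracId r)) u) ^ (1 / (n : ℝ)) ≤
        ENNReal.ofReal ((C + 1) ^ (1 / (n : ℝ)) * q) := by
    filter_upwards [eventually_gt_atTop 0] with n hn
    have hn' : (n : ℝ) ≠ 0 := by exact_mod_cast hn.ne'
    have h3 : supNorm (convolution ((subdivision a)^[n] (diracId r)) u) ≤
        ENNReal.ofReal ((C + 1) * q ^ n) := by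
      refine iSup_le fun k => iSup_le fun i => iSup_le fun j => ?_
      rw [← coe_iterMask, ← coe_fconv, Subsingleton.elim j 0, ← ofReal_norm]
      refine ENNReal.ofReal_le_ofReal ((h1 n k i).trans ?_)
      gcongr
      linarith
    refine (ENNReal.rpow_le_rpow h3 (by positivity)).trans_eq ?_
    rw [ENNReal.ofReal_rpow_of_pos (by positivity), Real.mul_rpow (by positivity) (by positivity),
      ← Real.rpow_natCast q n, ← Real.rpow_mul hq.le, mul_one_div_cancel hn', Real.rpow_one]
  have h4 : Tendsto (fun n : ℕ => ENNReal.ofReal ((C + 1) ^ (1 / (n : ℝ)) * q)) atTop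
      (𝓝 (ENNReal.ofReal q)) := by
    refine ENNReal.tendsto_ofReal ?_
    have h5 : Tendsto (fun n : ℕ => (C + 1) ^ (1 / (n : ℝ))) atTop (𝓝 ((C + 1) ^ (0 : ℝ))) :=
      tendsto_const_nhds.rpow tendsto_one_div_atTop_nhds_zero_nat (Or.inl (by positivity))
    simpa using h5.mul_const q
  exact (limsup_le_limsup h2).trans_eq h4.limsup_eq

lemma lt_smMask_iff {a : FinSeq (Fin r) (Fin r)} {w : FinSeq (Fin 1) (Fin r)} {c : ℝ} :
    (c : EReal) < smMask a w ↔ rho a (sr a) w < ENNReal.ofReal ((2 : ℝ) ^ (-c)) := by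
  have h2 : 0 < Real.log 2 := Real.log_pos one_lt_two
  rw [smMask, EReal.lt_neg_comm, EReal.div_lt_iff (by exact_mod_cast h2) (EReal.coe_ne_top _),
    ← EReal.coe_neg, ← EReal.coe_mul, ← ENNReal.log_lt_log_iff,
    ENNReal.log_ofReal_of_pos (by positivity), Real.log_rpow two_pos]

/-- Convergence gives decay without a rate on the space that defines ρ. Since ρ is a supremum over
all u, a rate below 1 common to all of them is needed, and `exists_decay_rate` supplies it. -/
theorem IsBasicLimit.smMask_pos [NeZero r] {m : ℕ} {ν : Fin r → ℕ} {a : FinSeq (Fin r) (Fin r)}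
    {M : ℕ} {η : Fin r → ℝ → ℂ} (h : IsBasicLimit m ν a M η) (hν : ∀ l, ν l ≤ m) (hν₀ : ν 0 = 0)
    {N : ℕ} {v : FinSeq (Fin 1) (Fin r)} (hv : IsMatchingFilter a N v) (hN : 0 < N)
    {w : FinSeq (Fin 1) (Fin r)} (hw : HasSumRules a (sr a) w) : 0 < smMask a w := by
  have hsr := h.one_le_sr hν hv hN
  obtain ⟨τ, hτ, h1⟩ := exists_decay_rate a one_pos
  rw [← EReal.coe_zero, lt_smMask_iff, neg_zero, Real.rpow_zero]
  refine (rho_le_of_geometricDecay (q := (2 : ℝ) ^ (-τ)) (by positivity) fun u hu => ?_).trans_lt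
    ((ENNReal.ofReal_lt_ofReal_iff one_pos).mpr
      (Real.rpow_lt_one_of_one_lt_of_neg one_lt_two (neg_neg_of_pos hτ)))
  obtain ⟨C, hC, h2⟩ := h1 u (h.decays_of_mem_vanishingSpace hν hν₀ hw.1 hsr hu)
  refine ⟨C, hC, fun n k i => ?_⟩
  have h3 := h2 n k i
  rwa [one_pow, one_mul, ← neg_mul, Real.rpow_mul two_pos.le, Real.rpow_natCast] at h3

/-! ### Hölder continuity of refinable functions -/

lemma SupportedIn.sampleSeq (M : ℕ) (g : Fin r → ℝ → ℂ) {s : ℝ} (hs : s ∈ Set.Icc (0 : ℝ) 2) :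
    SupportedIn (M + 2) (sampleSeq M g s) := by
  intro k hk
  ext l i
  rw [VectorSubdivision.sampleSeq, Finsupp.onFinset_apply, Matrix.of_apply, if_neg]
  · rfl
  · rw [not_lt]
    have h1 : (((M : ℤ) + 2 : ℤ) : ℝ) < ((|k| : ℤ) : ℝ) := Int.cast_lt.mpr hk
    push_cast at h1
    have h2 := abs_sub_abs_le_abs_sub (k : ℝ) (-s)
    rw [abs_neg, abs_of_nonneg hs.1, sub_neg_eq_add] at h2
    linarith [hs.2]

/-- The difference of f^{(m)} at (k + s)/2^n and (k + t)/2^n is 2^{mn} A_n * (u_s - u_t), with u_s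
the samples of f^{(m)} on ℤ + s. Uniform continuity makes it decay without a rate. For s, t in [0,
2] the sequences have a common support and a common bound, so the uniform exponential rate applies
and becomes a Hölder exponent. -/
theorem Refinable.exists_holder {a : FinSeq (Fin r) (Fin r)} {f : Fin r → ℝ → ℂ}
    (h : Refinable a f) {m M : ℕ} (hf : ∀ j, ContDiff ℝ m (f j))
    (hM : ∀ l x, (M : ℝ) ≤ |x| → f l x = 0) :
    ∃ τ : ℝ, 0 < τ ∧ τ < 1 ∧ ∃ C : ℝ, 0 < C ∧ ∀ j x y,
      ‖iteratedDeriv m (f j) x - iteratedDeriv m (f j) y‖ ≤ C * |x - y| ^ τ := by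
  obtain ⟨g, hg⟩ : ∃ g : Fin r → ℝ → ℂ, g = fun l => iteratedDeriv m (f l) := ⟨_, rfl⟩
  have hgM : ∀ l x, ((M + 1 : ℕ) : ℝ) ≤ |x| → g l x = 0 := fun l x hx => by
    rw [hg]
    exact iteratedDeriv_eq_zero_of_le_abs (hM l) m x (by exact_mod_cast hx)
  have hgc : ∀ l, Continuous (g l) := fun l => by
    rw [hg]
    exact (hf l).continuous_iteratedDeriv m le_rfl
  choose B' hB'0 hB' using fun l => exists_bound_of_le_abs (hgc l) (hgM l)
  obtain ⟨B, hB0, hB⟩ : ∃ B, 0 ≤ B ∧ ∀ l x, ‖g l x‖ ≤ B :=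
    ⟨∑ l, B' l, Finset.sum_nonneg fun l _ => hB'0 l, fun l x => (hB' l x).trans
      (Finset.single_le_sum (fun l _ => hB'0 l) (Finset.mem_univ l))⟩
  obtain ⟨N, hN⟩ := exists_supportedIn a
  -- The support bound of the mask is enlarged so that the invariant radius N + M + 3 also contains
  -- all sample sequences, of radius M + 3.
  obtain ⟨τ₀, hτ₀, h1⟩ := exists_decay_rate_of_supportedIn a (l := (2 : ℝ) ^ m) (by positivity)
    (N := (N + M + 2 : ℤ)) (hN.mono (by linarith [Int.natCast_nonneg M]))
  obtain ⟨C₀, hC₀, h2⟩ := h1 (N + M + 3) (by ring)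
  have hdiff : ∀ s t : ℝ, ∀ n (k : ℤ) j, ((2 : ℝ) ^ m) ^ n *
      ‖fconv (iterMask a n) (sampleSeq (M + 1) g s - sampleSeq (M + 1) g t) k j 0‖ =
      ‖g j (((k : ℝ) + s) / 2 ^ n) - g j (((k : ℝ) + t) / 2 ^ n)‖ := fun s t n k j => by
    have h3 : ∀ s : ℝ, g j (((k : ℝ) + s) / 2 ^ n) =
        (2 : ℂ) ^ (m * n) * fconv (iterMask a n) (sampleSeq (M + 1) g s) k j 0 := fun s => by
      subst hg
      exact h.iteratedDeriv_eq hf hgM n k s j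
    rw [h3, h3, ← mul_sub, norm_mul, norm_pow, Complex.norm_ofNat, ← pow_mul, fconv_sub]
    rfl
  have hdec : ∀ s ∈ Set.Icc (0 : ℝ) 2, ∀ t ∈ Set.Icc (0 : ℝ) 2,
      Decays a ((2 : ℝ) ^ m) (sampleSeq (M + 1) g s - sampleSeq (M + 1) g t) := by
    intro s hs t ht ε hε
    have h3 : ∀ᶠ n : ℕ in atTop, ∀ j, ∀ k : ℤ,
        ‖g j (((k : ℝ) + s) / 2 ^ n) - g j (((k : ℝ) + t) / 2 ^ n)‖ ≤ ε := by
      refine eventually_all.mpr fun j => ?_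
      obtain ⟨δ, hδ, h4⟩ := Metric.uniformContinuous_iff.mp
        (uniformContinuous_of_le_abs (hgc j) (hgM j)) ε hε
      have h5 : Tendsto (fun n : ℕ => |s - t| * ((2 : ℝ) ^ n)⁻¹) atTop (𝓝 0) := by
        simpa using tendsto_inv_two_pow.const_mul |s - t|
      filter_upwards [h5.eventually (gt_mem_nhds hδ)] with n hn k
      rw [← dist_eq_norm]
      refine (h4 ?_).le
      rw [Real.dist_eq, ← sub_div, add_sub_add_left_eq_sub, abs_div,
        abs_of_pos (show (0 : ℝ) < 2 ^ n by positivity)]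
      exact hn
    filter_upwards [h3] with n hn k j
    rw [hdiff]
    exact hn j k
  have hbase : ∀ s ∈ Set.Icc (0 : ℝ) 2, ∀ t ∈ Set.Icc (0 : ℝ) 2, ∀ (n : ℕ) (k : ℤ) j,
      ‖g j (((k : ℝ) + s) / 2 ^ n) - g j (((k : ℝ) + t) / 2 ^ n)‖ ≤
        C₀ * (2 * B) * (2 : ℝ) ^ (-(τ₀ * (n : ℝ))) := by
    intro s hs t ht n k j
    rw [← hdiff]
    refine h2 _ ?_ (hdec s hs t ht) (2 * B) (by positivity) ?_ n k j
    · intro k hk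
      have h3 : ((M + 1 : ℕ) : ℤ) + 2 < |k| := by push_cast; linarith [Int.natCast_nonneg N]
      rw [Finsupp.sub_apply, SupportedIn.sampleSeq _ _ hs k h3, SupportedIn.sampleSeq _ _ ht k h3,
        sub_zero]
    · intro k i
      rw [Finsupp.sub_apply, Matrix.sub_apply, sampleSeq_apply hgM, sampleSeq_apply hgM, two_mul]
      exact (norm_sub_le _ _).trans (add_le_add (hB _ _) (hB _ _))
  -- Capped at 1/2 because the smoothness exponent admits only τ < 1.
  obtain ⟨τ, hτ⟩ : ∃ τ, τ = min τ₀ (1 / 2) := ⟨_, rfl⟩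
  have hτ0 : 0 < τ := by rw [hτ]; positivity
  have hττ₀ : τ ≤ τ₀ := by rw [hτ]; exact min_le_left _ _
  have hτ1 : τ < 1 := by
    rw [hτ]; exact (min_le_right _ _).trans_lt (by norm_num)
  refine ⟨τ, hτ0, hτ1, C₀ * (2 * B) * 2 ^ τ + 2 * B + 1, by positivity, ?_⟩
  have hlt : ∀ j x y, x < y →
      ‖g j x - g j y‖ ≤ (C₀ * (2 * B) * 2 ^ τ + 2 * B + 1) * |x - y| ^ τ := by
    intro j x y hxy
    have hd : 0 < y - x := sub_pos.mpr hxy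
    rw [abs_sub_comm, abs_of_pos hd]
    have hp : 0 < (y - x) ^ τ := Real.rpow_pos_of_pos hd τ
    have hc1 : 0 ≤ C₀ * (2 * B) * (2 : ℝ) ^ τ := by positivity
    rcases lt_or_ge 1 (y - x) with h3 | h3
    · have h4 : 1 ≤ (y - x) ^ τ := Real.one_le_rpow h3.le hτ0.le
      have h5 : ‖g j x - g j y‖ ≤ 2 * B := by
        rw [two_mul]
        exact (norm_sub_le _ _).trans (add_le_add (hB _ _) (hB _ _))
      nlinarith
    -- With 2^{-(n+1)} < y - x ≤ 2^{-n} and k = ⌊2^n x⌋, the offset of 2^n x from k lies in [0, 1)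
    -- and that of 2^n y in [0, 2]; hence the parameter interval.
    · obtain ⟨n, hn1, hn2⟩ := exists_nat_pow_near_of_lt_one hd h3 (y := (2 : ℝ)⁻¹) (by norm_num)
        (by norm_num)
      have h2n : (0 : ℝ) < 2 ^ n := by positivity
      rw [inv_pow, inv_lt_iff_one_lt_mul₀ (by positivity)] at hn1
      rw [inv_pow, le_inv_comm₀ hd h2n, ← one_div, le_div_iff₀ hd] at hn2
      have hfl := Int.floor_le ((2 : ℝ) ^ n * x)
      have hfl' := Int.lt_floor_add_one ((2 : ℝ) ^ n * x)
      have h4 := hbase (2 ^ n * x - ⌊2 ^ n * x⌋) ⟨by linarith, by linarith⟩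
        (2 ^ n * y - ⌊2 ^ n * x⌋) ⟨by nlinarith, by nlinarith⟩ n ⌊2 ^ n * x⌋ j
      rw [add_sub_cancel, add_sub_cancel, mul_div_cancel_left₀ _ h2n.ne',
        mul_div_cancel_left₀ _ h2n.ne'] at h4
      have h5 : (2 : ℝ) ^ (-(τ₀ * (n : ℝ))) ≤ 2 ^ τ * (y - x) ^ τ := by
        rw [← Real.mul_rpow two_pos.le hd.le]
        calc (2 : ℝ) ^ (-(τ₀ * (n : ℝ))) ≤ 2 ^ (-(τ * (n : ℝ))) := by
              refine Real.rpow_le_rpow_of_exponent_le one_le_two (neg_le_neg ?_)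
              gcongr
          _ = ((2 : ℝ) ^ n)⁻¹ ^ τ := by
              rw [← Real.rpow_natCast, ← Real.rpow_neg two_pos.le, ← Real.rpow_mul two_pos.le]
              congr 1
              ring
          _ ≤ (2 * (y - x)) ^ τ := by
              refine Real.rpow_le_rpow (by positivity) ?_ hτ0.le
              rw [inv_le_iff_one_le_mul₀ h2n]
              rw [pow_succ] at hn1
              linarith
      have h6 : C₀ * (2 * B) * (2 : ℝ) ^ (-(τ₀ * (n : ℝ))) ≤
          C₀ * (2 * B) * (2 ^ τ * (y - x) ^ τ) := by gcongr
      nlinarith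
  intro j x y
  have hgj : ∀ x, iteratedDeriv m (f j) x = g j x := fun x => by rw [hg]
  rw [hgj, hgj]
  rcases lt_trichotomy x y with h3 | h3 | h3
  · exact hlt j x y h3
  · rw [h3, sub_self, norm_zero]
    positivity
  · rw [norm_sub_rev, abs_sub_comm]
    exact hlt j y x h3

/-! ### Smoothness exponents of distributions -/

lemma lt_smDistribution {T : 𝓢'(ℝ, ℂ)} {f : ℝ → ℂ} (hTf : ∀ g : 𝓢(ℝ, ℂ), T g = ∫ x, g x * f x)
    {m M : ℕ} (hf : ContDiff ℝ m f) (hM : ∀ x, (M : ℝ) ≤ |x| → f x = 0) {τ C : ℝ} (hτ : 0 < τ)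
    (hτ1 : τ < 1) (hC : 0 < C)
    (h : ∀ x y, ‖iteratedDeriv m f x - iteratedDeriv m f y‖ ≤ C * |x - y| ^ τ) :
    (m : EReal) < smDistribution T := by
  have h1 : (m : EReal) < (((m : ℝ) + τ : ℝ) : EReal) := by
    rw [← EReal.coe_natCast, EReal.coe_lt_coe_iff]
    linarith
  refine h1.trans_le (le_sSup ⟨m, τ, f, hτ.le, hτ1, ⟨fun j hj x y => ?_, fun j hj => ?_⟩,
    ⟨C, hC, fun t => ?_⟩, hTf, rfl⟩)
  · refine ContDiffOn.absolutelyContinuousOnInterval (ContDiff.contDiffOn ?_)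
    exact ContDiff.iterate_deriv' 1 j (hf.of_le (by exact_mod_cast (by omega : 1 + j ≤ m))) |>
      fun h2 => by rwa [← iteratedDeriv_eq_iterate] at h2
  · have h2 : Continuous (iteratedDeriv j f) :=
      hf.continuous_iteratedDeriv j (by exact_mod_cast hj)
    exact h2.memLp_of_hasCompactSupport (hasCompactSupport_of_le_abs (M := M + 1)
      fun x hx => iteratedDeriv_eq_zero_of_le_abs hM j x (by exact_mod_cast hx))
  · rw [eLpNorm_exponent_top]
    refine eLpNormEssSup_le_of_ae_bound (Eventually.of_forall fun x => ?_)
    simpa using h x (x - t)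

/-- The L_∞ bound holds for each t and almost every x; Fubini exchanges the quantifiers. Two good
points are then compared through a third point that is good for both, so g is uniformly continuous
on a dense set of full measure and extends. -/
lemma exists_continuous_ae_eq_of_lip {g : ℝ → ℂ} (hg : AEStronglyMeasurable g volume) {τ : ℝ}
    (hτ : 0 < τ) (h : MemLipInf τ g) : ∃ G : ℝ → ℂ, Continuous G ∧ g =ᵐ[volume] G := by
  obtain ⟨C, hC, h⟩ := h
  obtain ⟨g', hg', hgg'⟩ := hg
  have hmeas : MeasurableSet {p : ℝ × ℝ | ‖g' p.2 - g' (p.2 - p.1)‖ ≤ C * |p.1| ^ τ} := by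
    have := hg'.measurable
    refine measurableSet_le (by fun_prop) ?_
    exact (continuous_const.mul ((continuous_fst.abs).rpow_const
      fun _ => Or.inr hτ.le)).measurable
  have h1 : ∀ᵐ t : ℝ, ∀ᵐ x : ℝ, ‖g' x - g' (x - t)‖ ≤ C * |t| ^ τ := by
    refine Eventually.of_forall fun t => ?_
    have h2 := h t
    rw [eLpNorm_exponent_top] at h2
    have h3 : ∀ᵐ x : ℝ, g (x - t) = g' (x - t) :=
      (measurePreserving_sub_right volume t).quasiMeasurePreserving.ae hgg'
    filter_upwards [ae_le_eLpNormEssSup (f := fun x => g x - g (x - t)) (μ := volume), hgg', h3]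
      with x h4 h5 h6
    rw [← h5, ← h6]
    have h7 := h4.trans h2
    rwa [← ofReal_norm, ENNReal.ofReal_le_ofReal_iff (by positivity)] at h7
  have h2 : ∀ᵐ x : ℝ, ∀ᵐ t : ℝ, ‖g' x - g' (x - t)‖ ≤ C * |t| ^ τ :=
    (Measure.ae_ae_comm hmeas).mp h1
  obtain ⟨S, hS⟩ : ∃ S : Set ℝ, S = {x | ∀ᵐ t : ℝ, ‖g' x - g' (x - t)‖ ≤ C * |t| ^ τ} := ⟨_, rfl⟩
  have hSae : ∀ᵐ x : ℝ, x ∈ S := by rw [hS]; exact h2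
  have hSd : Dense S := Measure.dense_of_ae hSae
  have hSy : ∀ x ∈ S, ∀ᵐ y : ℝ, ‖g' x - g' y‖ ≤ C * |x - y| ^ τ := fun x hx => by
    rw [hS] at hx
    have h3 := (quasiMeasurePreserving_sub_left volume x).ae hx
    simpa using h3
  have huc : UniformContinuous fun x : S => g' x := by
    refine Metric.uniformContinuous_iff.mpr fun ε hε => ?_
    have h3 : Tendsto (fun δ : ℝ => C * δ ^ τ + C * (2 * δ) ^ τ) (𝓝 0) (𝓝 0) := by
      have h4 : Continuous fun δ : ℝ => C * δ ^ τ + C * (2 * δ) ^ τ :=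
        (continuous_const.mul (continuous_id.rpow_const fun _ => Or.inr hτ.le)).add
          (continuous_const.mul ((continuous_const.mul continuous_id).rpow_const
            fun _ => Or.inr hτ.le))
      simpa [Real.zero_rpow hτ.ne'] using h4.tendsto 0
    obtain ⟨δ, hδ0, hδ⟩ := ((h3.mono_left nhdsWithin_le_nhds).eventually (gt_mem_nhds hε)).and
      (self_mem_nhdsWithin (a := (0 : ℝ)) (s := Set.Ioi 0)) |>.exists
    refine ⟨δ, hδ, fun {x x'} hxx' => ?_⟩
    -- The bound between x and x' themselves may fail, as it is known only for almost every second
    -- point; y lies in the full-measure sets of both.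
    obtain ⟨y, ⟨hy1, hy2⟩, hy3⟩ := (Measure.dense_of_ae
      ((hSy x x.2).and (hSy x' x'.2))).exists_dist_lt (x : ℝ) hδ
    rw [Subtype.dist_eq, Real.dist_eq] at hxx'
    rw [Real.dist_eq] at hy3
    have h5 : C * |(x : ℝ) - y| ^ τ ≤ C * δ ^ τ := by gcongr
    have h6 : C * |(x' : ℝ) - y| ^ τ ≤ C * (2 * δ) ^ τ := by
      have h7 : |(x' : ℝ) - y| ≤ 2 * δ := by
        have := abs_sub_le (x' : ℝ) x y
        rw [abs_sub_comm (x' : ℝ) x] at this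
        linarith
      gcongr
    rw [dist_eq_norm]
    have h8 := norm_sub_le_norm_sub_add_norm_sub (g' x) (g' y) (g' x')
    rw [norm_sub_rev (g' y)] at h8
    linarith
  refine ⟨hSd.extend fun x : S => g' x, (hSd.uniformContinuous_extend huc).continuous, ?_⟩
  filter_upwards [hgg', hSae] with x h3 h4
  rw [h3]
  exact (hSd.extend_of_ind huc ⟨x, h4⟩).symm

/-- The difference of h and a primitive of G is absolutely continuous with zero derivative almost
everywhere, hence constant. -/
lemma hasDerivAt_of_absolutelyContinuous {h G : ℝ → ℂ}
    (hac : ∀ x y, AbsolutelyContinuousOnInterval h x y) (hG : Continuous G)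
    (hae : deriv h =ᵐ[volume] G) (x : ℝ) : HasDerivAt h (G x) x := by
  obtain ⟨P, hP⟩ : ∃ P : ℝ → ℂ, P = fun x => ∫ t in (0 : ℝ)..x, G t := ⟨_, rfl⟩
  have hPd : ∀ x, HasDerivAt P (G x) x := fun x => by
    rw [hP]
    exact intervalIntegral.integral_hasDerivAt_right (hG.intervalIntegrable _ _)
      (hG.stronglyMeasurableAtFilter _ _) hG.continuousAt
  have hPc : ContDiff ℝ 1 P := by
    rw [contDiff_one_iff_deriv]
    exact ⟨fun x => (hPd x).differentiableAt, by rwa [funext fun x => (hPd x).deriv]⟩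
  have hconst : ∀ y, h y - P y = h 0 - P 0 := fun y => by
    obtain ⟨lo, hi, hlo, hhi⟩ : ∃ lo hi : ℝ, y ∈ Set.uIcc lo hi ∧ (0 : ℝ) ∈ Set.uIcc lo hi :=
      ⟨0, y, Set.right_mem_uIcc, Set.left_mem_uIcc⟩
    have h1 : AbsolutelyContinuousOnInterval (h - P) lo hi :=
      (hac lo hi).sub hPc.contDiffOn.absolutelyContinuousOnInterval
    obtain ⟨c, hc⟩ := h1.const_of_ae_hasDerivAt_zero (by
      filter_upwards [(hac lo hi).boundedVariationOn.ae_differentiableAt_of_mem_uIcc, hae]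
        with z h2 h3 hz
      have h4 := (h2 hz).hasDerivAt.sub (hPd z)
      rwa [h3, sub_self] at h4)
    exact (hc y hlo).trans (hc 0 hhi).symm
  have heq : h = fun y => P y + (h 0 - P 0) := by
    ext y
    rw [← hconst y]
    ring
  rw [heq]
  exact (hPd x).add_const _

/-- For m = 0 the function may have to be changed on a null set. For m > 0 absolute continuity makes
f itself C^m, because the continuous representative of the top derivative is a true derivative. -/
lemma exists_contDiff_ae_eq {m : ℕ} {f G : ℝ → ℂ}
    (hac : ∀ j < m, ∀ x y, AbsolutelyContinuousOnInterval (iteratedDeriv j f) x y)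
    (hG : Continuous G) (hae : iteratedDeriv m f =ᵐ[volume] G) :
    ∃ F : ℝ → ℂ, ContDiff ℝ m F ∧ f =ᵐ[volume] F := by
  rcases m with _ | m
  · rw [iteratedDeriv_zero] at hae
    exact ⟨G, (contDiff_zero (𝕜 := ℝ)).mpr hG, hae⟩
  have hcont : ∀ j < m + 1, Continuous (iteratedDeriv j f) := fun j hj => by
    refine continuous_iff_continuousAt.mpr fun x => ?_
    refine (hac j hj (x - 1) (x + 1)).continuousOn.continuousAt ?_
    rw [Set.uIcc_of_le (by linarith)]
    exact Icc_mem_nhds (by linarith) (by linarith)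
  have hderiv : ∀ j < m + 1, ∃ G', Continuous G' ∧ ∀ x, HasDerivAt (iteratedDeriv j f) (G' x) x := by
    intro j hj
    rcases Nat.lt_succ_iff_lt_or_eq.mp hj with h1 | h1
    · refine ⟨_, hcont (j + 1) (by omega), hasDerivAt_of_absolutelyContinuous (hac j hj)
        (hcont (j + 1) (by omega)) ?_⟩
      rw [iteratedDeriv_succ]
    · subst h1
      refine ⟨_, hG, hasDerivAt_of_absolutelyContinuous (hac j hj) hG ?_⟩
      rw [← iteratedDeriv_succ]
      exact hae
  refine ⟨f, contDiff_nat_iff_iteratedDeriv.mpr ⟨fun j hj => ?_, fun j hj => ?_⟩, ae_eq_refl f⟩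
  · rcases Nat.le_iff_lt_or_eq.mp hj with h1 | h1
    · exact hcont j h1
    · obtain ⟨G', hG', h2⟩ := hderiv m (by omega)
      rw [h1, iteratedDeriv_succ, funext fun x => (h2 x).deriv]
      exact hG'
  · obtain ⟨G', -, h2⟩ := hderiv j hj
    exact fun x => (h2 x).differentiableAt

/-- From m < k + τ and τ < 1 it follows that m ≤ k. If m < k, the m-th derivative is absolutely
continuous; if m = k, then τ > 0 and the Lipschitz condition provides a continuous representative.
-/
theorem exists_contDiff_of_lt_smDistribution {T : 𝓢'(ℝ, ℂ)} {m : ℕ}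
    (h : (m : EReal) < smDistribution T) :
    ∃ F : ℝ → ℂ, ContDiff ℝ m F ∧ ∀ g : 𝓢(ℝ, ℂ), T g = ∫ x, g x * F x := by
  obtain ⟨s, ⟨k, τ, f, hτ, hτ1, ⟨hac, hLp⟩, hlip, hT, rfl⟩, hs⟩ := lt_sSup_iff.mp h
  rw [← EReal.coe_natCast, EReal.coe_lt_coe_iff] at hs
  have hmk : m ≤ k := by
    have h1 : (m : ℝ) < k + 1 := by linarith
    exact Nat.lt_succ_iff.mp (by exact_mod_cast h1)
  obtain ⟨G, hG, hae⟩ : ∃ G : ℝ → ℂ, Continuous G ∧ iteratedDeriv m f =ᵐ[volume] G := by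
    rcases Nat.lt_or_eq_of_le hmk with h1 | h1
    · refine ⟨_, continuous_iff_continuousAt.mpr fun x => ?_, ae_eq_refl _⟩
      refine (hac m h1 (x - 1) (x + 1)).continuousOn.continuousAt ?_
      rw [Set.uIcc_of_le (by linarith)]
      exact Icc_mem_nhds (by linarith) (by linarith)
    · subst h1
      exact exists_continuous_ae_eq_of_lip (hLp m le_rfl).1 (by linarith) hlip
  obtain ⟨F, hF, hfF⟩ := exists_contDiff_ae_eq (fun j hj => hac j (hj.trans_le hmk)) hG hae
  refine ⟨F, hF, fun g => ?_⟩
  rw [hT]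
  refine integral_congr_ae ?_
  filter_upwards [hfF] with x hx
  rw [hx]

/-! ### Necessary conditions for convergence -/

lemma IsFourierTransform.continuous {T : 𝓢'(ℝ, ℂ)} {F : ℝ → ℂ} (h : IsFourierTransform T F) :
    Continuous F := by
  obtain ⟨h1, -⟩ := h
  have h2 : Continuous fun x : ℝ => F (2 * Real.pi * x) := h1.1.continuous
  have h3 := h2.comp (continuous_id.div_const (2 * Real.pi))
  convert h3 using 1
  ext x
  simp only [Function.comp_apply, id]
  rw [mul_div_cancel₀ _ (by positivity)]

theorem IsBasicLimit.lt_smVector {m : ℕ} {ν : Fin r → ℕ} {a : FinSeq (Fin r) (Fin r)} {M : ℕ}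
    {η : Fin r → ℝ → ℂ} (h : IsBasicLimit m ν a M η) (hν : ∀ l, ν l ≤ m) [NeZero r]
    {φ : Fin r → 𝓢'(ℝ, ℂ)} {φhat : ℝ → Fin r → ℂ}
    (hφhat : ∀ l, IsFourierTransform (φ l) fun ξ => φhat ξ l)
    (hφ_ref : ∀ ξ : ℝ, φhat (2 * ξ) = (symbol a ξ).mulVec (φhat ξ))
    (hφ_norm : ∑ l, (if ν l = 0 then φhat 0 l else 0) = 1) : (m : EReal) < smVector φ := by
  have h1 := h.fourierHat_eq hν (fun l => (hφhat l).continuous) hφ_ref hφ_norm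
  have href : Refinable a η := refinable_of_fourierHat (fun j => (h.contDiff j).continuous)
    h.eq_zero fun ξ j => by
      rw [← h1, hφ_ref]
      congr 2
      ext l
      exact h1 ξ l
  obtain ⟨τ, hτ, hτ1, C, hC, h2⟩ := href.exists_holder h.contDiff h.eq_zero
  have h3 : ∀ l, (m : EReal) < smDistribution (φ l) := fun l =>
    lt_smDistribution (eq_integral_of_isFourierTransform (hφhat l)
      (integrable_of_le_abs (h.contDiff l).continuous (h.eq_zero l)) fun ξ => h1 ξ l)
      (h.contDiff l) (h.eq_zero l) hτ hτ1 hC (h2 l)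
  -- The infimum over finitely many entries is attained, so the strict inequality survives.
  obtain ⟨l, hl⟩ := exists_eq_ciInf_of_finite (f := fun l => smDistribution (φ l))
  rw [smVector, ← hl]
  exact h3 l

/-! ### Convergence for all initial sequences -/

lemma SampleLimit.comp_sub_two_pow_mul {b : ℕ → ℤ → ℂ} {f : ℝ → ℂ} (h : SampleLimit b f) (p : ℤ) :
    SampleLimit (fun n k => b n (k - 2 ^ n * p)) fun x => f (x - p) := by
  intro ε hε
  filter_upwards [h ε hε] with n hn k
  have h1 := hn (k - 2 ^ n * p)
  rwa [Int.cast_sub, sub_div, Int.cast_mul, Int.cast_pow, Int.cast_ofNat,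
    mul_div_cancel_left₀ _ (by positivity)] at h1

/-- The limit for w₀ is the sum of w₀(p) f(· - p). On a bounded interval finitely many p contribute,
whatever the growth of w₀, and both smoothness and convergence are local. -/
theorem IsBasicLimit.hermiteConvergent {m : ℕ} {ν : Fin r → ℕ} {a : FinSeq (Fin r) (Fin r)} {M : ℕ}
    {f : Fin r → ℝ → ℂ} (h : IsBasicLimit m ν a M f) (hν : ∀ l, ν l ≤ m) :
    HermiteConvergent m ν a := by
  intro w₀
  obtain ⟨S, hS⟩ : ∃ S : ℕ → Finset ℤ, ∀ K (p : ℤ), p ∉ S K → (K + M : ℝ) < |(p : ℝ)| := by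
    refine ⟨fun K => Finset.Icc (-(K + M : ℤ)) (K + M), fun K p hp => ?_⟩
    rw [Finset.mem_Icc, ← abs_le, not_le] at hp
    exact_mod_cast hp
  obtain ⟨η, hη⟩ : ∃ η : ℝ → ℂ, η = fun x => ∑ᶠ p : ℤ, ∑ j, w₀ p 0 j * f j (x - p) := ⟨_, rfl⟩
  have hηS : ∀ (K : ℕ) (x : ℝ), |x| ≤ K → η x = ∑ p ∈ S K, ∑ j, w₀ p 0 j * f j (x - p) := by
    intro K x hx
    rw [hη]
    refine finsum_eq_sum_of_support_subset _ fun p hp => ?_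
    by_contra h1
    refine hp (Finset.sum_eq_zero fun j _ => ?_)
    rw [h.eq_zero, mul_zero]
    have h2 := hS K p h1
    have h3 := abs_sub_abs_le_abs_sub (p : ℝ) x
    rw [abs_sub_comm] at h3
    linarith
  have hloc : ∀ (K : ℕ) (x : ℝ), |x| < K →
      η =ᶠ[𝓝 x] fun x => ∑ p ∈ S K, ∑ j, w₀ p 0 j * f j (x - p) := fun K x hx => by
    filter_upwards [continuous_abs.continuousAt.eventually (gt_mem_nhds hx)] with y hy
    exact hηS K y hy.le
  have hcd : ∀ n, n ≤ m → ∀ (p : ℤ) (j : Fin r),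
      ContDiff ℝ n fun x : ℝ => w₀ p 0 j * f j (x - p) := fun n hn p j =>
    contDiff_const.mul (((h.contDiff j).of_le (by exact_mod_cast hn)).comp
      (contDiff_id.sub contDiff_const))
  have hηd : ContDiff ℝ m η := by
    refine contDiff_iff_contDiffAt.mpr fun x => ?_
    obtain ⟨K, hK⟩ := exists_nat_gt |x|
    exact (ContDiff.sum fun p _ => ContDiff.sum fun j _ =>
      hcd m le_rfl p j).contDiffAt.congr_of_eventuallyEq (hloc K x hK)
  have hderiv : ∀ (K : ℕ) (x : ℝ), |x| < K → ∀ l, iteratedDeriv (ν l) η x =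
      ∑ p ∈ S K, ∑ j, w₀ p 0 j * iteratedDeriv (ν l) (f j) (x - p) := by
    intro K x hx l
    rw [(hloc K x hx).iteratedDeriv_eq, iteratedDeriv_fun_sum fun p _ =>
      (ContDiff.sum fun j _ => hcd (ν l) (hν l) p j).contDiffAt]
    refine Finset.sum_congr rfl fun p _ => ?_
    rw [iteratedDeriv_fun_sum fun j _ => (hcd (ν l) (hν l) p j).contDiffAt]
    refine Finset.sum_congr rfl fun j _ => ?_
    have h1 := iteratedDeriv_comp_mul_sub ((h.contDiff j).of_le (by exact_mod_cast hν l)) 1 p x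
      (ν := ν l)
    simp only [one_mul, Complex.ofReal_one, one_pow] at h1
    rw [iteratedDeriv_const_mul_field, h1]
  refine ⟨η, hηd, fun K hK l => tendsto_iSup_enorm_iff.mpr fun ε hε => ?_⟩
  obtain ⟨K', hK'⟩ := exists_nat_gt K
  have hlim : SampleLimit
      (fun n k => ∑ p ∈ S K', ∑ j, w₀ p 0 j *
        ((2 : ℂ) ^ (ν l * n) * iterMask a n (k - 2 ^ n * p) j l))
      fun x => ∑ p ∈ S K', ∑ j, w₀ p 0 j * iteratedDeriv (ν l) (f j) (x - p) :=
    SampleLimit.sum _ fun p _ => SampleLimit.sum _ fun j _ =>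
      ((h.sampleLimit j l).comp_sub_two_pow_mul p).const_mul _
  filter_upwards [hlim ε hε] with n hn k hk
  have hp : (0 : ℝ) < 2 ^ n := by positivity
  have hkK : |(k : ℝ) / 2 ^ n| ≤ K := by
    rwa [abs_div, abs_of_pos hp, div_le_iff₀ hp, mul_comm]
  have h1 : dilatedSupport (iterMask a n) n k ⊆ S K' := by
    intro p hpm
    by_contra h2
    refine absurd hpm (notMem_dilatedSupport.mpr (h.iterMask_eq_zero n _ fun h3 => ?_))
    have h4 := abs_div_le_of_mem_dyadicBox h3
    rw [Int.cast_sub, sub_div, Int.cast_mul, Int.cast_pow, Int.cast_ofNat,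
      mul_div_cancel_left₀ _ hp.ne'] at h4
    have h5 := hS K' p h2
    have h6 := abs_sub_abs_le_abs_sub (p : ℝ) ((k : ℝ) / 2 ^ n)
    rw [abs_sub_comm] at h6
    linarith
  rw [hderiv K' _ (hkK.trans_lt hK'), iterate_subdivision_apply, finsum_mul_eq_sum h1]
  refine le_of_eq_of_le ?_ (hn k)
  congr 2
  rw [Matrix.sum_apply, Finset.sum_mul]
  refine Finset.sum_congr rfl fun p _ => ?_
  rw [Matrix.mul_apply, Finset.sum_mul]
  exact Finset.sum_congr rfl fun j _ => by ring

/-! ### Sufficient conditions for convergence -/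

lemma geometricDecay_of_eventually {a : FinSeq (Fin r) (Fin r)} {q : ℝ} (hq : 0 < q)
    {u : FinSeq (Fin r) (Fin 1)}
    (h : ∀ᶠ n : ℕ in atTop, ∀ k i, ‖fconv (iterMask a n) u k i 0‖ ≤ q ^ n) :
    GeometricDecay a q u := by
  obtain ⟨n₀, hn₀⟩ := eventually_atTop.mp h
  choose B hB0 hB using fun (n : ℕ) (i : Fin r) => exists_bound_apply (fconv (iterMask a n) u) i 0
  have hterm : ∀ n i, 0 ≤ B n i / q ^ n := fun n i => div_nonneg (hB0 n i) (by positivity)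
  have hsum : ∀ n, 0 ≤ ∑ i, B n i / q ^ n := fun n => Finset.sum_nonneg fun i _ => hterm n i
  have hS : 0 ≤ ∑ n ∈ Finset.range n₀, ∑ i, B n i / q ^ n := Finset.sum_nonneg fun n _ => hsum n
  refine ⟨1 + ∑ n ∈ Finset.range n₀, ∑ i, B n i / q ^ n, by positivity, fun n k i => ?_⟩
  have hqn : 0 < q ^ n := by positivity
  rcases lt_or_ge n n₀ with h1 | h1
  · have h2 : B n i / q ^ n ≤ ∑ i, B n i / q ^ n :=
      Finset.single_le_sum (f := fun i => B n i / q ^ n) (fun i _ => hterm n i) (Finset.mem_univ i)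
    have h3 : ∑ i, B n i / q ^ n ≤ ∑ n ∈ Finset.range n₀, ∑ i, B n i / q ^ n :=
      Finset.single_le_sum (f := fun n => ∑ i, B n i / q ^ n) (fun n _ => hsum n)
        (Finset.mem_range.mpr h1)
    rw [← div_le_iff₀ hqn]
    have h4 : ‖fconv (iterMask a n) u k i 0‖ / q ^ n ≤ B n i / q ^ n := by
      gcongr
      exact hB n i k
    linarith
  · have h2 := hn₀ n h1 k i
    nlinarith

lemma geometricDecay_of_rho_lt {a : FinSeq (Fin r) (Fin r)} {J : ℕ} {w : FinSeq (Fin 1) (Fin r)}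
    {q : ℝ} (hq : 0 < q) (h : rho a J w < ENNReal.ofReal q) {u : FinSeq (Fin r) (Fin 1)}
    (hu : u ∈ vanishingSpace J w) : GeometricDecay a q u := by
  have h1 : limsup (fun n : ℕ =>
      supNorm (convolution ((subdivision a)^[n] (diracId r)) u) ^ (1 / (n : ℝ))) atTop <
        ENNReal.ofReal q := (le_iSup₂ (f := fun u (_ : u ∈ vanishingSpace J w) =>
    limsup (fun n : ℕ =>
      supNorm (convolution ((subdivision a)^[n] (diracId r)) u) ^ (1 / (n : ℝ))) atTop)
        u hu).trans_lt h
  refine geometricDecay_of_eventually hq ?_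
  filter_upwards [eventually_lt_of_limsup_lt h1, eventually_gt_atTop 0] with n hn hn0 k i
  have hn' : (n : ℝ) ≠ 0 := by exact_mod_cast hn0.ne'
  have h2 : supNorm (convolution ((subdivision a)^[n] (diracId r)) u) ≤
      ENNReal.ofReal (q ^ n) := by
    rw [ENNReal.ofReal_pow hq.le, ← ENNReal.rpow_natCast]
    have h3 := ENNReal.rpow_le_rpow hn.le (Nat.cast_nonneg (α := ℝ) n)
    rwa [← ENNReal.rpow_mul, one_div_mul_cancel hn', ENNReal.rpow_one] at h3
  rw [← coe_iterMask, ← coe_fconv] at h2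
  have h4 : ‖fconv (iterMask a n) u k i 0‖ₑ ≤ supNorm ⇑(fconv (iterMask a n) u) :=
    le_iSup_of_le k (le_iSup_of_le i (le_iSup_of_le (0 : Fin 1) le_rfl))
  have h5 := h4.trans h2
  rwa [← ofReal_norm, ENNReal.ofReal_le_ofReal_iff (by positivity)] at h5

/-- The exponent gives a rate q < 2^{-K} only on the smallest space, and with respect to w. This
decay forces vanishing of order K + 1 against v, so the two filters are proportional to that order
and sr(a) ≥ K + 1. Vanishing of order ν + 1 against v then means the same against w, and the decay
spreads upwards from the smallest space. -/
theorem HasSumRules.decays_of_lt_smMask {a : FinSeq (Fin r) (Fin r)} {w v : FinSeq (Fin 1) (Fin r)}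
    (hw : HasSumRules a (sr a) w) {K : ℕ} (hv : IsMatchingFilter a (K + 1) v)
    (h : (K : EReal) < smMask a w) {ν : ℕ} (hν : ν ≤ K) {u : FinSeq (Fin r) (Fin 1)}
    (hu : u ∈ vanishingSpace (ν + 1) v) : Decays a ((2 : ℝ) ^ ν) u := by
  have h2K : (0 : ℝ) < 2 ^ K := by positivity
  rw [← EReal.coe_natCast, lt_smMask_iff, Real.rpow_neg two_pos.le, Real.rpow_natCast] at h
  obtain ⟨q, hq0, hq1, hq2⟩ := ENNReal.lt_iff_exists_real_btwn.mp h
  have hq : 0 < q := ENNReal.ofReal_pos.mp (bot_le.trans_lt hq1)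
  rw [ENNReal.ofReal_lt_ofReal_iff (by positivity)] at hq2
  have hpow : ∀ d ≤ K, (2 : ℝ) ^ d ≤ 2 ^ K := fun d hd => pow_le_pow_right₀ one_le_two hd
  have hgeo : ∀ u ∈ vanishingSpace (sr a) w, GeometricDecay a q u := fun u hu =>
    geometricDecay_of_rho_lt hq hq1 hu
  have hsub : vanishingSpace (sr a) w ⊆ vanishingSpace (K + 1) v := by
    intro u hu
    refine mem_vanishingSpace_iff.mpr (X_pow_dvd_iff.mpr fun d hd => ?_)
    refine Decays.coeff_eq_zero hv hd ((hgeo u hu).decays hq.le (by positivity) ?_)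
    calc (2 : ℝ) ^ d * q ≤ 2 ^ K * q := by gcongr; exacts [one_le_two, by omega]
      _ < 2 ^ K * (2 ^ K)⁻¹ := by gcongr
      _ = 1 := mul_inv_cancel₀ h2K.ne'
  obtain ⟨hK, hj⟩ := le_of_vanishingSpace_subset hv.1 hw.1.1 (by omega) hsub
  have hlt1 : q < ((2 : ℝ) ^ ν)⁻¹ := hq2.trans_le (inv_anti₀ (by positivity) (hpow ν hν))
  have hlt2 : ((2 : ℝ) ^ (ν + 1))⁻¹ < ((2 : ℝ) ^ ν)⁻¹ :=
    inv_strictAnti₀ (by positivity) (pow_lt_pow_right₀ one_lt_two (Nat.lt_succ_self ν))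
  -- Q must exceed q and 2^{-(ν+1)}, the largest eigenvalue met on the way, yet stay below 2^{-ν}.
  obtain ⟨Q, hQ1, hQ2⟩ := exists_between (max_lt hlt1 hlt2)
  have hqQ := (le_max_left _ _).trans_lt hQ1
  have hQ0 : 0 < Q := hq.trans hqQ
  refine GeometricDecay.decays (hw.geometricDecay ((le_max_right _ _).trans_lt hQ1)
    (fun u hu => (hgeo u hu).mono hq.le hqQ.le) (by omega) (hj (ν + 1) (by omega) hu)) hQ0.le
    (by positivity) ?_
  calc (2 : ℝ) ^ ν * Q < 2 ^ ν * (2 ^ ν)⁻¹ := by gcongr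
    _ = 1 := mul_inv_cancel₀ (by positivity)

/-- Compares column l of A_n, which is A_n * δ e_l, with A_n applied to the integer samples of
f^{(ν_l)}; after the Hermite scaling the latter gives the dyadic samples of f^{(ν_l)} without error.
-/
theorem Refinable.isBasicLimit {a : FinSeq (Fin r) (Fin r)} {f : Fin r → ℝ → ℂ}
    (href : Refinable a f) {m M : ℕ} (hf : ∀ j, ContDiff ℝ m (f j))
    (hM : ∀ j x, (M : ℝ) ≤ |x| → f j x = 0) {ν : Fin r → ℕ} (hν : ∀ l, ν l ≤ m)
    {K : ℕ} (hνK : ∀ l, ν l ≤ K) {v w : FinSeq (Fin 1) (Fin r)}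
    (hv : IsMatchingFilter a (K + 1) v) (hvν : HermiteFilterCondition ν v)
    (hvf : ∑ j, symbol v 0 0 j * ∫ x, f j x = 1) (hw : HasSumRules a (sr a) w)
    (h : (K : EReal) < smMask a w) : ∃ M', IsBasicLimit m ν a M' f := by
  obtain ⟨N, hN⟩ := exists_supportedIn a
  refine ⟨max M (N + 1), hf, fun j x hx => hM j x ?_, fun n k hk => ?_, fun j l ε hε => ?_⟩
  · exact (Nat.cast_le.mpr (le_max_left M (N + 1))).trans hx
  · refine hN.iterMask n k ?_
    have h1 := notMem_dyadicBox hk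
    have h2 : ((N + 1 : ℕ) : ℤ) ≤ (max M (N + 1) : ℕ) := Nat.cast_le.mpr (le_max_right _ _)
    push_cast at h1 h2
    have h3 : (0 : ℤ) < 2 ^ n := by positivity
    nlinarith
  obtain ⟨g, hg⟩ : ∃ g : Fin r → ℝ → ℂ, g = fun j => iteratedDeriv (ν l) (f j) := ⟨_, rfl⟩
  have hgM : ∀ j x, ((M + 1 : ℕ) : ℝ) ≤ |x| → g j x = 0 := fun j x hx => by
    rw [hg]
    exact iteratedDeriv_eq_zero_of_le_abs (hM j) (ν l) x (by exact_mod_cast hx)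
  have hfν : ∀ j, ContDiff ℝ (ν l) (f j) := fun j => (hf j).of_le (by exact_mod_cast hν l)
  have hsamp : ∀ n (k : ℤ) j, (2 : ℂ) ^ (ν l * n) *
      fconv (iterMask a n) (sampleSeq (M + 1) g 0) k j 0 = g j ((k : ℝ) / 2 ^ n) := fun n k j => by
    subst hg
    have h1 := href.iteratedDeriv_eq hfν hgM n k 0 j
    rw [add_zero] at h1
    exact h1.symm
  -- The scaled convolutions equal the samples for every n, so the limit hypothesis of the moment
  -- argument holds trivially.
  have hcoeff := hv.coeff_of_sampleLimit (Nat.lt_succ_of_le (hνK l)) (sampleSeq (M + 1) g 0) hfν hM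
    (fun j ε hε => Eventually.of_forall fun n k => by
      beta_reduce
      rw [hsamp, hg, sub_self, norm_zero]
      exact hε.le)
  obtain ⟨hv1, hv2⟩ := hermiteFilterCondition_iff.mp hvν l
  have hu : diracCol l - sampleSeq (M + 1) g 0 ∈ vanishingSpace (ν l + 1) v := by
    refine mem_vanishingSpace_iff.mpr (X_pow_dvd_iff.mpr fun d hd => ?_)
    rw [symbolSeries_sub, Matrix.mul_sub, Matrix.sub_apply, symbolSeries_mul_diracCol, map_sub,
      sub_eq_zero]
    rcases Nat.lt_succ_iff_lt_or_eq.mp hd with h1 | h1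
    · rw [hv1 d h1, hcoeff.1 d h1]
    · rw [h1, hv2, hcoeff.2, hvf, mul_one]
  filter_upwards [hw.decays_of_lt_smMask hv h (hνK l) hu ε hε] with n hn k
  refine le_of_eq_of_le ?_ (hn k j)
  have h1 : fconv (iterMask a n) (diracCol l - sampleSeq (M + 1) g 0) k j 0 =
      iterMask a n k j l - fconv (iterMask a n) (sampleSeq (M + 1) g 0) k j 0 := by
    rw [fconv_sub, ← fconv_diracCol (iterMask a n) l]
    rfl
  have h2 : iteratedDeriv (ν l) (f j) ((k : ℝ) / 2 ^ n) = g j ((k : ℝ) / 2 ^ n) := by rw [hg]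
  rw [h1, h2, ← hsamp, ← mul_sub, norm_mul, norm_pow, Complex.norm_ofNat, ← pow_mul]

lemma exists_contDiff_of_lt_smVector {φ : Fin r → 𝓢'(ℝ, ℂ)}
    (hφ : ∀ l, IsCompact (Distribution.dsupport (φ l))) {m : ℕ} (h : (m : EReal) < smVector φ) :
    ∃ (M : ℕ) (f : Fin r → ℝ → ℂ), (∀ l, ContDiff ℝ m (f l)) ∧
      (∀ l x, (M : ℝ) ≤ |x| → f l x = 0) ∧ ∀ l (g : 𝓢(ℝ, ℂ)), φ l g = ∫ x, g x * f l x := by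
  choose f hf hφf using fun l => exists_contDiff_of_lt_smDistribution (h.trans_le (iInf_le _ l))
  choose R hR using fun l => (hφ l).isBounded.subset_ball (0 : ℝ)
  obtain ⟨M, hM⟩ := exists_nat_gt (∑ l, |R l|)
  refine ⟨M, f, hf, fun l x hx => ?_, hφf⟩
  refine eq_zero_of_notMem_dsupport (hf l).continuous (hφf l) fun hx' => ?_
  have h1 := hR l hx'
  rw [Metric.mem_ball, Real.dist_eq, sub_zero] at h1
  have h2 : |R l| ≤ ∑ l, |R l| :=
    Finset.single_le_sum (f := fun l => |R l|) (fun l _ => abs_nonneg _) (Finset.mem_univ l)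
  linarith [le_abs_self (R l)]

end VectorSubdivision

end

/-! ### The two implications -/

theorem mainTheorem6 (r : ℕ) [NeZero r] (m : ℕ)
    (ν : Fin r → ℕ) (hν : ∀ l, ν l ≤ m) (hν₀ : ν 0 = 0)
    (a : VectorSubdivision.FinSeq (Fin r) (Fin r))
    (ha : VectorSubdivision.SpectralCondition a)
    -- the matching filter of order `max ν + 1`, normalized
    (v : VectorSubdivision.FinSeq (Fin 1) (Fin r))
    (hv : VectorSubdivision.IsMatchingFilter a (Finset.univ.sup ν + 1) v)
    (hv₁ : ∃ l : Fin r, VectorSubdivision.symbol v 0 0 l = 1 ∧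
      ∀ j < l, VectorSubdivision.symbol v 0 0 j = 0)
    -- the refinable vector of compactly supported distributions and its Fourier transform
    (φ : Fin r → 𝓢'(ℝ, ℂ)) (hφ : ∀ l, IsCompact (Distribution.dsupport (φ l)))
    (φhat : ℝ → Fin r → ℂ)
    (hφhat : ∀ l, VectorSubdivision.IsFourierTransform (φ l) (fun ξ => φhat ξ l))
    (hφ_ref : ∀ ξ : ℝ, φhat (2 * ξ) = (VectorSubdivision.symbol a ξ).mulVec (φhat ξ))
    (hφ_norm : ∑ l, VectorSubdivision.symbol v 0 0 l * φhat 0 l = 1)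
    -- any filter that may be used to compute `sm_∞(a)`
    (w : VectorSubdivision.FinSeq (Fin 1) (Fin r))
    (hw : VectorSubdivision.HasSumRules a (VectorSubdivision.sr a) w) :
    (VectorSubdivision.HermiteConvergent m ν a →
      0 < VectorSubdivision.smMask a w ∧
      (m : EReal) < VectorSubdivision.smVector φ ∧
      VectorSubdivision.HermiteFilterCondition ν v) ∧
    (((Finset.univ.sup ν : ℕ) : EReal) < VectorSubdivision.smMask a w →
      (m : EReal) < VectorSubdivision.smVector φ →
      VectorSubdivision.HermiteFilterCondition ν v →
      VectorSubdivision.HermiteConvergent m ν a) := by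
  classical
  have hνs : ∀ l, ν l ≤ Finset.univ.sup ν := fun l => Finset.le_sup (Finset.mem_univ l)
  constructor
  · intro h
    obtain ⟨M, η, hη⟩ := h.exists_isBasicLimit hν₀
    have hcond := hη.hermiteFilterCondition hν hv (fun l => Nat.lt_succ_of_le (hνs l)) hv₁
    refine ⟨hη.smMask_pos hν hν₀ hv (Nat.succ_pos _) hw, ?_, hcond⟩
    -- By (*) the row v̂(0) is the indicator of ν_l = 0, so the normalization of φ̂(0) against v is
    -- the one under which φ̂ is identified with the transforms of the limits.
    refine hη.lt_smVector hν hφhat hφ_ref (Eq.trans (Finset.sum_congr rfl fun l _ => ?_) hφ_norm)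
    rw [hcond.symbol_zero_apply]
    split_ifs <;> simp
  · intro h hsm hcond
    obtain ⟨M, f, hf, hM, hφf⟩ := VectorSubdivision.exists_contDiff_of_lt_smVector hφ hsm
    have hint : ∀ l, Integrable (f l) := fun l =>
      VectorSubdivision.integrable_of_le_abs (hf l).continuous (hM l)
    have hhat : ∀ ξ l, φhat ξ l = VectorSubdivision.fourierHat (f l) ξ := fun ξ l =>
      VectorSubdivision.isFourierTransform_eq_fourierHat (hφhat l) (hint l) (hφf l) ξ
    have href : VectorSubdivision.Refinable a f :=
      VectorSubdivision.refinable_of_fourierHat (fun l => (hf l).continuous) hM fun ξ l => by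
        simp only [← hhat]
        rw [hφ_ref]
    obtain ⟨M', hbl⟩ := href.isBasicLimit hf hM hν hνs hv hcond
      (by simpa only [hhat, VectorSubdivision.fourierHat_zero] using hφ_norm) hw h
    exact hbl.hermiteConvergent hν
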